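/- Let $R$ be a Dedekind domain whose field of fractions $K$ is a number field. Let $\Lambda,\Lambda_1,\Lambda_2$ be $R$-orders in finite-dimensional semisimple $K$-algebras $A,A_1,A_2$, respectively (an $R$-order in $A$ is an $R$-subalgebra of $A$ that is finitely generated as an $R$-module and spans $A$ over $K$). Let $\overline{\Lambda}$ be an $R$-algebra that is $R$-torsion, and suppose that there is a fibre product of $R$-algebras, given by $\pi_i:\Lambda\to\Lambda_i$ and $g_i:\Lambda_i\to\overline{\Lambda}$ ($i=1,2$), that is, $g_1\pi_1=g_2\pi_2$ and $(\pi_1,\pi_2)$ identifies $\Lambda$ with $\{(x_1,x_2)\in\Lambda_1\oplus\Lambda_2 : g_1(x_1)=g_2(x_2)\}$. Assume that at least one of $g_1,g_2$ is surjective. A left $\Lambda$-lattice $X$ (a left $\Lambda$-module that is finitely generated and torsion-free over $R$) is locally free of rank $1$ if $X_{\mathfrak p}\cong\Lambda_{\mathfrak p}$ as $\Lambda_{\mathfrak p}$-modules for every maximal ideal $\mathfrak p$ of $R$. The locally free class group $\mathrm{Cl}(\Lambda)$ is the set of stable isomorphism classes $[X]$ of such $X$, where $X,Y$ are stably isomorphic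 if $X\oplus\Lambda^{m}\cong Y\oplus\Lambda^{m}$ for some $m\ge 0$; it is an abelian group with $[X_1]+[X_2]=[X_3]$ whenever $X_1\oplus X_2\cong\Lambda\oplus X_3$. We say that $\Lambda$ has stably free cancellation (SFC) if, for every finitely generated left $\Lambda$-module $X$ and all $m,n\ge 0$, $X\oplus\Lambda^{m}\cong\Lambda^{m+n}$ implies $X\cong\Lambda^{n}$. For $u\in\overline{\Lambda}^{\times}$ put \[ M(u)=\{(x_1,x_2)\in\Lambda_1\oplus\Lambda_2 : g_1(x_1)u=g_2(x_2)\}, \qquad W=\{w_1w_2 : w_i\in g_i(\Lambda_i^{\times}),\ i=1,2\}\subseteq\overline{\Lambda}^{\times}. \] Then each $M(u)$ is a locally free left $\Lambda$-lattice of rank $1$, the map $\partial:\overline{\Lambda}^{\times}\to\mathrm{Cl}(\Lambda)$, $u\mapsto[M(u)]$, is a group homomorphism, extension of scalars $[X]\mapsto([\Lambda_1\otimes_\Lambda X],[\Lambda_2\otimes_\Lambda X])$ is a well-defined group homomorphism $\mathrm{Cl}(\Lambda)\to\mathrm{Cl}(\Lambda_1)\oplus\mathrm{Cl}(\Lambda_2)$,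 and the sequence \[ 1\to\ker(\partial)\to\overline{\Lambda}^{\times}\xrightarrow{\ \partial\ }\mathrm{Cl}(\Lambda)\to\mathrm{Cl}(\Lambda_1)\oplus\mathrm{Cl}(\Lambda_2)\to 0 \] is exact. The groups $\overline{\Lambda}^{\times}$, $\mathrm{Cl}(\Lambda)$, $\mathrm{Cl}(\Lambda_1)$, $\mathrm{Cl}(\Lambda_2)$ are finite, and \[ |W|\le|\ker(\partial)|=\frac{|\mathrm{Cl}(\Lambda_1)|\,|\mathrm{Cl}(\Lambda_2)|\,|\overline{\Lambda}^{\times}|}{|\mathrm{Cl}(\Lambda)|}. \] Moreover, $\Lambda$ has SFC if and only if both $\Lambda_1$ and $\Lambda_2$ have SFC and $|W|=|\mathrm{Cl}(\Lambda_1)|\,|\mathrm{Cl}(\Lambda_2)|\,|\overline{\Lambda}^{\times}|\,|\mathrm{Cl}(\Lambda)|^{-1}$. -/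

import Mathlib

open scoped TensorProduct nonZeroDivisors

universe u v w

namespace Orders

section Definitions

variable (R : Type v) [CommRing R] (Λ : Type u) [Ring Λ] [Algebra R Λ]

/-- Local isomorphism at a maximal ideal `p` of two left `Λ`-modules: an isomorphism
`X_p ≅ Y_p` of modules over `Λ_p`. As `Λ_p` is generated by the images of `R_p` and `Λ`,
this is an `R_p`-linear isomorphism which commutes with the action of every `a : Λ`, the latter
acting on `X_p` by the localisation of the `R`-linear map `x ↦ a • x`. -/
def LocallyIsoAt (p : Ideal R) [p.IsPrime]
    (X : Type*) [AddCommGroup X] [Module R X] [Module Λ X] [IsScalarTower R Λ X]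
    (Y : Type*) [AddCommGroup Y] [Module R Y] [Module Λ Y] [IsScalarTower R Λ Y] : Prop :=
  ∃ e : LocalizedModule p.primeCompl X ≃ₗ[Localization p.primeCompl]
      LocalizedModule p.primeCompl Y,
    ∀ (a : Λ) (z : LocalizedModule p.primeCompl X),
      e (LocalizedModule.map p.primeCompl (Algebra.lsmul R R X a) z) =
        LocalizedModule.map p.primeCompl (Algebra.lsmul R R Y a) (e z)

/-- `X` is a locally free left `Λ`-lattice of rank `n`: it is finitely generated over `R` and
`X_p ≅ (Λ_p)^n` for every maximal ideal `p` of `R`. (If `Λ` is torsion-free over the domain `R`,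
then so is such an `X`, see `IsLocallyFree.isTorsionFree`.) -/
structure IsLocallyFree (n : ℕ)
    (X : Type*) [AddCommGroup X] [Module R X] [Module Λ X] [IsScalarTower R Λ X] : Prop where
  finite : Module.Finite R X
  locallyIso : ∀ (p : Ideal R) [p.IsMaximal], LocallyIsoAt R Λ p X (Fin n → Λ)

/-- Stable isomorphism: `X ⊕ Λ^m ≅ Y ⊕ Λ^m` for some `m ≥ 0`. -/
def StablyIso (X : Type*) [AddCommGroup X] [Module Λ X]
    (Y : Type*) [AddCommGroup Y] [Module Λ Y] : Prop :=
  ∃ m : ℕ, Nonempty ((X × (Fin m → Λ)) ≃ₗ[Λ] (Y × (Fin m → Λ)))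

/-- Stably free cancellation: every finitely generated stably free left module is free. -/
def HasSFC : Prop :=
  ∀ (X : Type u) [AddCommGroup X] [Module Λ X], Module.Finite Λ X → ∀ m n : ℕ,
    Nonempty ((X × (Fin m → Λ)) ≃ₗ[Λ] (Fin (m + n) → Λ)) → Nonempty (X ≃ₗ[Λ] (Fin n → Λ))

/-- The principal genus: locally free left `Λ`-lattices of rank `1`. -/
structure PrincipalGenus where
  carrier : Type u
  [addCommGroup : AddCommGroup carrier]
  [moduleBase : Module R carrier]
  [module : Module Λ carrier]
  [isScalarTower : IsScalarTower R Λ carrier]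
  isLocallyFree : IsLocallyFree R Λ 1 carrier

attribute [instance] PrincipalGenus.addCommGroup PrincipalGenus.moduleBase
  PrincipalGenus.module PrincipalGenus.isScalarTower

end Definitions

section LocalLemmas

variable {R : Type v} [CommRing R] {Λ : Type u} [Ring Λ] [Algebra R Λ]
variable {X : Type*} [AddCommGroup X] [Module R X] [Module Λ X] [IsScalarTower R Λ X]
variable {Y : Type*} [AddCommGroup Y] [Module R Y] [Module Λ Y] [IsScalarTower R Λ Y]
variable {Z : Type*} [AddCommGroup Z] [Module R Z] [Module Λ Z] [IsScalarTower R Λ Z]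

/-- `f` has an inverse up to a scalar outside `p`. -/
def InvertibleAt (p : Ideal R) (f : X →ₗ[Λ] Y) : Prop :=
  ∃ s ∉ p, ∃ h : Y →ₗ[Λ] X, (∀ x, h (f x) = s • x) ∧ ∀ y, f (h y) = s • y

theorem smul_map (f : X →ₗ[Λ] Y) (r : R) (x : X) : f (r • x) = r • f x := by
  rw [← algebraMap_smul Λ r x, map_smul, algebraMap_smul]

theorem InvertibleAt.comp {p : Ideal R} [p.IsPrime] {f : X →ₗ[Λ] Y} {g : Y →ₗ[Λ] Z}
    (hg : InvertibleAt p g) (hf : InvertibleAt p f) : InvertibleAt p (g ∘ₗ f) := by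
  obtain ⟨s, hs, h, h1, h2⟩ := hf
  obtain ⟨t, ht, k, k1, k2⟩ := hg
  refine ⟨s * t, fun hst => (Ideal.IsPrime.mem_or_mem ‹_› hst).elim hs ht, h ∘ₗ k, ?_, ?_⟩
  · intro x
    simp only [LinearMap.comp_apply, k1, smul_map, h1, smul_smul, mul_comm]
  · intro x
    simp only [LinearMap.comp_apply, h2, smul_map, k2, smul_smul]

theorem LocallyIsoAt.symm {p : Ideal R} [p.IsPrime] (h : LocallyIsoAt R Λ p X Y) :
    LocallyIsoAt R Λ p Y X := by
  obtain ⟨e, he⟩ := h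
  refine ⟨e.symm, fun a z => ?_⟩
  rw [LinearEquiv.symm_apply_eq, he, LinearEquiv.apply_symm_apply]

theorem LocallyIsoAt.trans {p : Ideal R} [p.IsPrime] (h : LocallyIsoAt R Λ p X Y)
    (h' : LocallyIsoAt R Λ p Y Z) : LocallyIsoAt R Λ p X Z := by
  obtain ⟨e, he⟩ := h
  obtain ⟨e', he'⟩ := h'
  exact ⟨e.trans e', fun a z => by simp only [LinearEquiv.trans_apply, he, he']⟩

/-- A map which is invertible at `p` induces an isomorphism at `p`. -/
theorem InvertibleAt.locallyIsoAt {p : Ideal R} [p.IsPrime] {f : X →ₗ[Λ] Y}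
    (hf : InvertibleAt p f) : LocallyIsoAt R Λ p X Y := by
  obtain ⟨s, hs, h, h1, h2⟩ := hf
  let f' : X →ₗ[R] Y := { toFun := f, map_add' := map_add f, map_smul' := smul_map f }
  let F := LocalizedModule.map p.primeCompl f'
  have hF : Function.Bijective F := by
    constructor
    · rw [injective_iff_map_eq_zero]
      intro z
      induction z using LocalizedModule.induction_on with
      | h x t =>
        intro hz
        rw [LocalizedModule.map_mk, ← LocalizedModule.zero_mk 1, LocalizedModule.mk_eq] at hz
        obtain ⟨c, hc⟩ := hz
        simp only [one_smul, smul_zero] at hc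
        rw [← LocalizedModule.zero_mk 1, LocalizedModule.mk_eq]
        refine ⟨c * ⟨s, hs⟩, ?_⟩
        simp only [one_smul, smul_zero]
        have : f (c • x) = 0 := by
          rw [Submonoid.smul_def, smul_map]; exact hc
        rw [mul_comm, mul_smul, Submonoid.smul_def, ← h1, this, map_zero]
    · intro z
      induction z using LocalizedModule.induction_on with
      | h y t =>
        refine ⟨LocalizedModule.mk (h y) (⟨s, hs⟩ * t), ?_⟩
        rw [LocalizedModule.map_mk]
        have : f' (h y) = (⟨s, hs⟩ : p.primeCompl) • y := h2 y
        rw [this, LocalizedModule.mk_cancel_common_left]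
  refine ⟨LinearEquiv.ofBijective F hF, fun a z => ?_⟩
  induction z using LocalizedModule.induction_on with
  | h x t =>
    simp only [LinearEquiv.ofBijective_apply, LocalizedModule.map_mk, F]
    congr 1
    exact map_smul f a x

/-- A local homomorphism comes from a global one, up to a scalar outside `p`. -/
theorem exists_lift [IsNoetherianRing R] [Module.Finite R Λ] [Module.Finite R X]
    (p : Ideal R) [p.IsPrime]
    (e : LocalizedModule p.primeCompl X →ₗ[Localization p.primeCompl]
      LocalizedModule p.primeCompl Y)
    (he : ∀ (a : Λ) (z : LocalizedModule p.primeCompl X),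
      e (LocalizedModule.map p.primeCompl (Algebra.lsmul R R X a) z) =
        LocalizedModule.map p.primeCompl (Algebra.lsmul R R Y a) (e z)) :
    ∃ (f : X →ₗ[Λ] Y) (s : p.primeCompl), ∀ x,
      LocalizedModule.mkLinearMap p.primeCompl Y (f x) =
        (s : R) • e (LocalizedModule.mkLinearMap p.primeCompl X x) := by
  have := Module.finitePresentation_of_finite R X
  obtain ⟨h, s, hs⟩ := Module.FinitePresentation.exists_lift_of_isLocalizedModule p.primeCompl
    (LocalizedModule.mkLinearMap p.primeCompl Y)
    ((e.restrictScalars R) ∘ₗ LocalizedModule.mkLinearMap p.primeCompl X)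
  have hs' : ∀ x, LocalizedModule.mkLinearMap p.primeCompl Y (h x) =
        (s : R) • e (LocalizedModule.mkLinearMap p.primeCompl X x) :=
    fun x => LinearMap.congr_fun hs x
  let μX : Λ ⊗[R] X →ₗ[R] X := TensorProduct.lift (Algebra.lsmul R R X).toLinearMap
  let μY : Λ ⊗[R] Y →ₗ[R] Y := TensorProduct.lift (Algebra.lsmul R R Y).toLinearMap
  obtain ⟨t, ht⟩ := Module.Finite.exists_smul_of_comp_eq_of_isLocalizedModule p.primeCompl
    (LocalizedModule.mkLinearMap p.primeCompl Y) (h ∘ₗ μX) (μY ∘ₗ h.lTensor Λ) (by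
      ext a x
      have h1 := hs' (a • x)
      have h2 := he a (LocalizedModule.mkLinearMap p.primeCompl X x)
      have h3 : LocalizedModule.mkLinearMap p.primeCompl X (a • x) =
          LocalizedModule.map p.primeCompl (Algebra.lsmul R R X a)
            (LocalizedModule.mkLinearMap p.primeCompl X x) := by
        simp [LocalizedModule.mkLinearMap_apply, LocalizedModule.map_mk]
      have h4 : LocalizedModule.mkLinearMap p.primeCompl Y (a • h x) =
          LocalizedModule.map p.primeCompl (Algebra.lsmul R R Y a)
            (LocalizedModule.mkLinearMap p.primeCompl Y (h x)) := by
        simp [LocalizedModule.mkLinearMap_apply, LocalizedModule.map_mk]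
      have h5 : LocalizedModule.mkLinearMap p.primeCompl Y (h (a • x)) =
          LocalizedModule.mkLinearMap p.primeCompl Y (a • h x) := by
        rw [h1, h4, hs', h3, h2]
        exact (LinearMap.map_smul_of_tower (LocalizedModule.map p.primeCompl _) (s : R) _).symm
      simpa [μX, μY] using h5)
  have ht' : ∀ (a : Λ) (x : X), (t : R) • h (a • x) = (t : R) • (a • h x) := by
    intro a x
    have := LinearMap.congr_fun ht (a ⊗ₜ x)
    simpa [μX, μY, Submonoid.smul_def] using this
  refine ⟨{ toFun := fun x => (t : R) • h x, map_add' := fun x y => by simp,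
            map_smul' := fun a x => by
              simp only [RingHom.id_apply]
              rw [ht', smul_comm] }, t * s, fun x => ?_⟩
  simp only [LinearMap.coe_mk, AddHom.coe_mk, map_smul, hs', Submonoid.coe_mul, mul_smul]

theorem LocallyIsoAt.exists_invertibleAt [IsNoetherianRing R] [Module.Finite R Λ]
    [Module.Finite R X] [Module.Finite R Y] {p : Ideal R} [p.IsPrime]
    (H : LocallyIsoAt R Λ p X Y) : ∃ f : X →ₗ[Λ] Y, InvertibleAt p f := by
  obtain ⟨e, he⟩ := H
  obtain ⟨f, s, hf⟩ := exists_lift p e.toLinearMap he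
  obtain ⟨g, t, hg⟩ := exists_lift (Λ := Λ) p e.symm.toLinearMap (fun a z => by
    simp only [LinearEquiv.coe_coe]
    rw [LinearEquiv.symm_apply_eq, he, LinearEquiv.apply_symm_apply])
  let f' : X →ₗ[R] Y := { toFun := f, map_add' := map_add f, map_smul' := smul_map f }
  let g' : Y →ₗ[R] X := { toFun := g, map_add' := map_add g, map_smul' := smul_map g }
  have key1 : ∀ x, LocalizedModule.mkLinearMap p.primeCompl X (g (f x)) =
      LocalizedModule.mkLinearMap p.primeCompl X (((t : R) * s) • x) := by
    intro x
    rw [hg, hf, LinearMap.map_smul_of_tower, map_smul, mul_smul]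
    simp only [LinearEquiv.coe_coe, LinearEquiv.symm_apply_apply]
  have key2 : ∀ y, LocalizedModule.mkLinearMap p.primeCompl Y (f (g y)) =
      LocalizedModule.mkLinearMap p.primeCompl Y (((t : R) * s) • y) := by
    intro y
    rw [hf, hg, LinearMap.map_smul_of_tower, map_smul, mul_comm, mul_smul]
    simp only [LinearEquiv.coe_coe, LinearEquiv.apply_symm_apply]
  obtain ⟨c, hc⟩ := Module.Finite.exists_smul_of_comp_eq_of_isLocalizedModule p.primeCompl
    (LocalizedModule.mkLinearMap p.primeCompl X) (g' ∘ₗ f') (((t : R) * s) • LinearMap.id)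
    (LinearMap.ext key1)
  obtain ⟨d, hd⟩ := Module.Finite.exists_smul_of_comp_eq_of_isLocalizedModule p.primeCompl
    (LocalizedModule.mkLinearMap p.primeCompl Y) (f' ∘ₗ g') (((t : R) * s) • LinearMap.id)
    (LinearMap.ext key2)
  have hc' : ∀ x, (c : R) • g (f x) = (c : R) • (((t : R) * s) • x) :=
    fun x => LinearMap.congr_fun hc x
  have hd' : ∀ y, (d : R) • f (g y) = (d : R) • (((t : R) * s) • y) :=
    fun y => LinearMap.congr_fun hd y
  refine ⟨f, ((c * d * (t * s) : p.primeCompl) : R), (c * d * (t * s)).2,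
    { toFun := fun y => ((c : R) * d) • g y, map_add' := fun x y => by simp,
      map_smul' := fun a x => by simp only [RingHom.id_apply, map_smul]; rw [smul_comm] },
    fun x => ?_, fun y => ?_⟩
  · simp only [LinearMap.coe_mk, AddHom.coe_mk, Submonoid.coe_mul]
    rw [mul_comm (c : R), mul_smul, hc', smul_smul, smul_smul]
  · simp only [LinearMap.coe_mk, AddHom.coe_mk, Submonoid.coe_mul]
    rw [smul_map, mul_smul, hd', smul_smul, smul_smul]

/-- An endomorphism congruent modulo `p` to a scalar outside `p` is invertible at `p`. -/
theorem exists_inverse_of_congr [Module.Finite R X] (p : Ideal R) [p.IsPrime]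
    (ψ : X →ₗ[Λ] X) (s : R) (hs : s ∉ p) (hψ : ∀ x, ψ x - s • x ∈ p • (⊤ : Submodule R X)) :
    ∃ t ∉ p, ∃ k : X →ₗ[Λ] X, (∀ x, ψ (k x) = t • x) ∧ ∀ x, k (ψ x) = t • x := by
  let ρ : Module.End Λ X →ₐ[R] Module.End R X :=
    { toFun := fun f => { toFun := f, map_add' := map_add f, map_smul' := smul_map f }
      map_one' := rfl
      map_mul' := fun _ _ => rfl
      map_zero' := rfl
      map_add' := fun _ _ => rfl
      commutes' := fun _ => rfl }
  have hρ : Function.Injective ρ := fun f g h => LinearMap.ext fun x => LinearMap.congr_fun h x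
  let ψ' : Module.End Λ X := ψ
  let δ : Module.End Λ X := ψ' - algebraMap R _ s
  obtain ⟨q, hq, -, hqp, hq0⟩ :=
    LinearMap.exists_monic_and_natDegree_eq_and_coeff_mem_pow_and_aeval_eq_zero R (ρ δ) p (by
      rintro _ ⟨x, rfl⟩
      exact hψ x)
  have hδ : Polynomial.aeval δ q = 0 := by
    apply hρ
    rw [map_zero, ← hq0, Polynomial.aeval_algHom_apply]
  obtain ⟨k, hk⟩ := Polynomial.X_sub_C_dvd_sub_C_eval (a := -s) (p := q)
  have hk' := congrArg (Polynomial.aeval δ) hk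
  have hXs : Polynomial.aeval δ (Polynomial.X - Polynomial.C (-s)) = ψ' := by
    simp [δ]
  have hv : q.eval (-s) ∉ p := by
    intro hmem
    have h1 : q.map (Ideal.Quotient.mk p) = Polynomial.X ^ q.natDegree := by
      ext n
      rw [Polynomial.coeff_map, Polynomial.coeff_X_pow]
      split_ifs with hn
      · rw [hn, hq.coeff_natDegree, map_one]
      · rw [Ideal.Quotient.eq_zero_iff_mem]
        by_cases hlt : n < q.natDegree
        · exact Ideal.pow_le_self (by omega) (hqp n)
        · rw [Polynomial.coeff_eq_zero_of_natDegree_lt (by omega)]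
          exact p.zero_mem
    have h2 : Ideal.Quotient.mk p (q.eval (-s)) = Ideal.Quotient.mk p ((-s) ^ q.natDegree) := by
      rw [← Polynomial.eval_map_apply, h1]
      simp
    rw [Ideal.Quotient.eq_zero_iff_mem.mpr hmem, eq_comm, Ideal.Quotient.eq_zero_iff_mem] at h2
    exact hs (neg_mem_iff.mp (Ideal.IsPrime.mem_of_pow_mem ‹_› _ h2))
  have e1 : ψ' * Polynomial.aeval δ k = algebraMap R _ (-(q.eval (-s))) := by
    rw [map_mul, hXs, map_sub, hδ, Polynomial.aeval_C, zero_sub] at hk'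
    rw [map_neg, hk']
  have e2 : Polynomial.aeval δ k * ψ' = algebraMap R _ (-(q.eval (-s))) := by
    rw [mul_comm, map_mul, hXs, map_sub, hδ, Polynomial.aeval_C, zero_sub] at hk'
    rw [map_neg, hk']
  exact ⟨-(q.eval (-s)), fun h => hv (neg_mem_iff.mp h), Polynomial.aeval δ k,
    fun x => LinearMap.congr_fun e1 x, fun x => LinearMap.congr_fun e2 x⟩

theorem InvertibleAt.of_congr [Module.Finite R X] [Module.Finite R Y] {p : Ideal R} [p.IsPrime]
    {f g : X →ₗ[Λ] Y} (hg : InvertibleAt p g)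
    (hfg : ∀ x, f x - g x ∈ p • (⊤ : Submodule R Y)) : InvertibleAt p f := by
  obtain ⟨s, hs, h, h1, h2⟩ := hg
  have hmap : ∀ y ∈ p • (⊤ : Submodule R Y), h y ∈ p • (⊤ : Submodule R X) := by
    intro y hy
    let h' : Y →ₗ[R] X := { toFun := h, map_add' := map_add h, map_smul' := smul_map h }
    have : h' y ∈ (p • (⊤ : Submodule R Y)).map h' := ⟨y, hy, rfl⟩
    rw [Submodule.map_smul''] at this
    exact Submodule.smul_mono le_rfl le_top this
  obtain ⟨t, ht, k, k1, -⟩ := exists_inverse_of_congr p (f ∘ₗ h) s hs (fun y => by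
    rw [← h2 y]; exact hfg (h y))
  obtain ⟨t', ht', k', -, k2⟩ := exists_inverse_of_congr p (h ∘ₗ f) s hs (fun x => by
    rw [← h1 x, LinearMap.comp_apply, ← map_sub]; exact hmap _ (hfg x))
  have e1 : ∀ y, f (h (k y)) = t • y := k1
  have e2 : ∀ x, k' (h (f x)) = t' • x := k2
  refine ⟨t' * t, fun hst => (Ideal.IsPrime.mem_or_mem ‹_› hst).elim ht' ht,
    { toFun := fun y => t • k' (h y), map_add' := fun x y => by simp,
      map_smul' := fun a x => by simp only [RingHom.id_apply, map_smul]; rw [smul_comm] },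
    fun x => ?_, fun y => ?_⟩
  · simp only [LinearMap.coe_mk, AddHom.coe_mk, e2, smul_smul, mul_comm]
  · simp only [LinearMap.coe_mk, AddHom.coe_mk]
    have : t • k' (h y) = t' • h (k y) := by
      rw [← e2, e1, smul_map, smul_map]
    rw [this, smul_map, e1, smul_smul]

/-- Simultaneous approximation of local isomorphisms at finitely many maximal ideals. -/
theorem exists_invertibleAt_finset [IsNoetherianRing R] [Module.Finite R Λ]
    [Module.Finite R X] [Module.Finite R Y] (T : Finset (MaximalSpectrum R))
    (H : ∀ p : MaximalSpectrum R, LocallyIsoAt R Λ p.asIdeal X Y) :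
    ∃ f : X →ₗ[Λ] Y, ∀ p ∈ T, InvertibleAt p.asIdeal f := by
  classical
  choose φ hφ using fun p => (H p).exists_invertibleAt
  have crt : ∀ p : MaximalSpectrum R, ∃ r : R, ∀ q ∈ T,
      r - (if q = p then 1 else 0) ∈ q.asIdeal := by
    intro p
    obtain ⟨r, hr⟩ := Ideal.exists_forall_sub_mem_ideal (R := R) (ι := T)
      (I := fun q => q.1.asIdeal) (fun q q' hqq' => Ideal.isCoprime_of_isMaximal
        (fun h => hqq' (Subtype.ext (MaximalSpectrum.ext h))))
      (fun q => if q.1 = p then 1 else 0)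
    exact ⟨r, fun q hq => hr ⟨q, hq⟩⟩
  choose r hr using crt
  let f : X →ₗ[Λ] Y :=
    { toFun := fun x => ∑ p ∈ T, r p • φ p x
      map_add' := fun x y => by simp [Finset.sum_add_distrib]
      map_smul' := fun a x => by
        simp only [RingHom.id_apply, map_smul, Finset.smul_sum]
        exact Finset.sum_congr rfl fun _ _ => smul_comm _ _ _ }
  refine ⟨f, fun p hp => (hφ p).of_congr fun x => ?_⟩
  have : f x - φ p x = ∑ q ∈ T, (r q - (if p = q then 1 else 0)) • φ q x := by
    simp only [sub_smul, Finset.sum_sub_distrib, ite_smul, one_smul, zero_smul,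
      Finset.sum_ite_eq, hp, if_true]
    rfl
  rw [this]
  exact Submodule.sum_mem _ fun q _ => Submodule.smul_mem_smul (hr q p hp) trivial

theorem finite_maximal_containing [IsDedekindDomain R] {s : R} (hs : s ≠ 0) :
    {p : MaximalSpectrum R | s ∈ p.asIdeal}.Finite := by
  have h := (Ideal.span {s}).finite_minimalPrimes_of_isNoetherianRing R
  refine Set.Finite.of_finite_image (f := MaximalSpectrum.asIdeal) (h.subset ?_)
    (fun p _ q _ hpq => MaximalSpectrum.ext hpq)
  rintro _ ⟨p, hp, rfl⟩
  refine ⟨⟨inferInstance, (Ideal.span_singleton_le_iff_mem _).mpr hp⟩, fun q hq hqp => ?_⟩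
  have hq0 : q ≠ ⊥ := by
    rintro rfl
    exact hs (by simpa using (Ideal.span_singleton_le_iff_mem _).mp hq.2)
  have : q.IsMaximal := Ring.DimensionLEOne.maximalOfPrime hq0 hq.1
  exact (this.eq_of_le p.isMaximal.ne_top hqp).ge

end LocalLemmas

section GenusLemmas

variable {R : Type v} [CommRing R] {Λ : Type u} [Ring Λ] [Algebra R Λ]

theorem IsLocallyFree.locallyIsoAt {n : ℕ}
    {X : Type*} [AddCommGroup X] [Module R X] [Module Λ X] [IsScalarTower R Λ X]
    {Y : Type*} [AddCommGroup Y] [Module R Y] [Module Λ Y] [IsScalarTower R Λ Y]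
    (hX : IsLocallyFree R Λ n X) (hY : IsLocallyFree R Λ n Y) (p : Ideal R) [p.IsMaximal] :
    LocallyIsoAt R Λ p X Y :=
  (hX.locallyIso p).trans (hY.locallyIso p).symm

theorem isLocallyFree_self [Module.Finite R Λ] : IsLocallyFree R Λ 1 Λ where
  finite := inferInstance
  locallyIso p _ := by
    refine InvertibleAt.locallyIsoAt (f := (LinearEquiv.funUnique (Fin 1) Λ Λ).symm.toLinearMap)
      ⟨1, fun h => Ideal.IsPrime.one_notMem inferInstance h,
        (LinearEquiv.funUnique (Fin 1) Λ Λ).toLinearMap, fun x => ?_, fun x => ?_⟩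
    · rw [one_smul]
      exact (LinearEquiv.funUnique (Fin 1) Λ Λ).apply_symm_apply x
    · rw [one_smul]
      exact (LinearEquiv.funUnique (Fin 1) Λ Λ).symm_apply_apply x

/-- A locally free lattice over a torsion-free algebra is torsion-free over `R`. -/
theorem IsLocallyFree.isTorsionFree [IsDomain R] [Module.IsTorsionFree R Λ] {n : ℕ}
    {X : Type*} [AddCommGroup X] [Module R X] [Module Λ X] [IsScalarTower R Λ X]
    (hX : IsLocallyFree R Λ n X) : Module.IsTorsionFree R X := by
  rw [Module.isTorsionFree_iff_smul_eq_zero]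
  intro r x hrx
  rw [or_iff_not_imp_left]
  intro hr
  by_contra hx
  have hne : LinearMap.ker (LinearMap.toSpanSingleton R X x) ≠ ⊤ := fun h => hx (by
    have : (1 : R) ∈ LinearMap.ker (LinearMap.toSpanSingleton R X x) := h ▸ trivial
    simpa using this)
  obtain ⟨p, hp, hle⟩ := Ideal.exists_le_maximal _ hne
  obtain ⟨e, -⟩ := hX.locallyIso p
  have h0 : r • e (LocalizedModule.mkLinearMap p.primeCompl X x) = 0 := by
    rw [← LinearEquiv.coe_coe, ← LinearMap.map_smul_of_tower, ← map_smul, hrx, map_zero, map_zero]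
  rw [← algebraMap_smul (Localization p.primeCompl) r] at h0
  have h1 := (smul_eq_zero.mp h0).resolve_left (fun h => hr
    (IsLocalization.injective (Localization p.primeCompl) p.primeCompl_le_nonZeroDivisors
      (h.trans (map_zero _).symm)))
  rw [LinearEquiv.map_eq_zero_iff, LocalizedModule.mkLinearMap_apply,
    ← LocalizedModule.zero_mk 1, LocalizedModule.mk_eq] at h1
  obtain ⟨c, hc⟩ := h1
  simp only [one_smul, smul_zero] at hc
  exact c.2 (hle (by simpa [Submonoid.smul_def] using hc))

/-- Given `Y₁, Y₂, Y₃` in the principal genus, there is `Y₄` in the principal genus such that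
`Y₁ ⊕ Y₂ ≅ Y₃ ⊕ Y₄`. -/
theorem PrincipalGenus.exists_exchange [IsDedekindDomain R] [Module.Finite R Λ]
    (Y₁ Y₂ Y₃ : PrincipalGenus R Λ) :
    ∃ Y₄ : PrincipalGenus R Λ,
      Nonempty ((Y₁.carrier × Y₂.carrier) ≃ₗ[Λ] (Y₃.carrier × Y₄.carrier)) := by
  classical
  have := Y₁.isLocallyFree.finite
  have := Y₂.isLocallyFree.finite
  have := Y₃.isLocallyFree.finite
  obtain ⟨p₀, hp₀⟩ := Ideal.exists_maximal R
  obtain ⟨f₁, hf₁⟩ := exists_invertibleAt_finset {(⟨p₀, hp₀⟩ : MaximalSpectrum R)}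
    (fun p => Y₁.isLocallyFree.locallyIsoAt Y₃.isLocallyFree p.asIdeal)
  obtain ⟨s, hs, h, h1, h2⟩ := hf₁ _ (Finset.mem_singleton_self _)
  have hs0 : s ≠ 0 := fun h0 => hs (h0 ▸ Ideal.zero_mem _)
  obtain ⟨f₂, hf₂⟩ := exists_invertibleAt_finset (finite_maximal_containing hs0).toFinset
    (fun p => Y₂.isLocallyFree.locallyIsoAt Y₃.isLocallyFree p.asIdeal)
  have good : ∀ p : MaximalSpectrum R,
      InvertibleAt p.asIdeal f₁ ∨ InvertibleAt p.asIdeal f₂ := by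
    intro p
    by_cases hp : s ∈ p.asIdeal
    · exact Or.inr (hf₂ p (by simpa using hp))
    · exact Or.inl ⟨s, hp, h, h1, h2⟩
  let F : (Y₁.carrier × Y₂.carrier) →ₗ[Λ] Y₃.carrier := f₁.coprod f₂
  let I : Ideal R :=
    { carrier := {r | ∃ k : Y₃.carrier →ₗ[Λ] (Y₁.carrier × Y₂.carrier), ∀ y, F (k y) = r • y}
      add_mem' := by
        rintro a b ⟨k, hk⟩ ⟨l, hl⟩
        exact ⟨k + l, fun y => by rw [LinearMap.add_apply, map_add, hk, hl, add_smul]⟩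
      zero_mem' := ⟨0, fun y => by simp⟩
      smul_mem' := by
        rintro c a ⟨k, hk⟩
        exact ⟨c • k, fun y => by
          rw [LinearMap.smul_apply, smul_map, hk, smul_smul, smul_eq_mul]⟩ }
  have hI : I = ⊤ := by
    by_contra hne
    obtain ⟨p, hp, hIp⟩ := Ideal.exists_le_maximal I hne
    rcases good ⟨p, hp⟩ with ⟨t, ht, k, -, k2⟩ | ⟨t, ht, k, -, k2⟩
    · exact ht (hIp ⟨LinearMap.inl Λ _ _ ∘ₗ k, fun y => by simp [F, k2]⟩)
    · exact ht (hIp ⟨LinearMap.inr Λ _ _ ∘ₗ k, fun y => by simp [F, k2]⟩)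
  obtain ⟨σ, hσ⟩ : (1 : R) ∈ I := hI ▸ trivial
  simp only [one_smul] at hσ
  have hN : Module.Finite R (LinearMap.ker F) := by
    let F' : (Y₁.carrier × Y₂.carrier) →ₗ[R] Y₃.carrier :=
      { toFun := F, map_add' := map_add F, map_smul' := smul_map F }
    exact inferInstanceAs (Module.Finite R (LinearMap.ker F'))
  have hker : ∀ z : LinearMap.ker F, f₁ z.1.1 + f₂ z.1.2 = 0 := fun z => z.2
  refine ⟨{ carrier := LinearMap.ker F, isLocallyFree := ⟨hN, fun p _ => ?_⟩ }, ⟨?_⟩⟩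
  · rcases good ⟨p, ‹_›⟩ with ⟨t, ht, k, k1, k2⟩ | ⟨t, ht, k, k1, k2⟩
    · refine (InvertibleAt.locallyIsoAt
        (f := LinearMap.snd Λ Y₁.carrier Y₂.carrier ∘ₗ (LinearMap.ker F).subtype)
        ⟨t, ht, LinearMap.codRestrict _ ((-(k ∘ₗ f₂)).prod (t • LinearMap.id)) (fun y => ?_),
          fun z => ?_, fun y => ?_⟩).trans (Y₂.isLocallyFree.locallyIso p)
      · simp [F, k2]
      · apply Subtype.ext
        have : f₂ z.1.2 = - f₁ z.1.1 := by rw [eq_neg_iff_add_eq_zero, add_comm]; exact hker z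
        apply Prod.ext
        · simp [this, k1]
        · simp
      · simp
    · refine (InvertibleAt.locallyIsoAt
        (f := LinearMap.fst Λ Y₁.carrier Y₂.carrier ∘ₗ (LinearMap.ker F).subtype)
        ⟨t, ht, LinearMap.codRestrict _ ((t • LinearMap.id).prod (-(k ∘ₗ f₁))) (fun y => ?_),
          fun z => ?_, fun y => ?_⟩).trans (Y₁.isLocallyFree.locallyIso p)
      · simp [F, k2]
      · apply Subtype.ext
        have : f₁ z.1.1 = - f₂ z.1.2 := by rw [eq_neg_iff_add_eq_zero]; exact hker z
        apply Prod.ext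
        · simp
        · simp [this, k1]
      · simp
  · exact LinearEquiv.ofLinearMap
      (F.prod (LinearMap.codRestrict _ (LinearMap.id - σ ∘ₗ F) (fun z => by simp [hσ])))
      (σ.coprod (LinearMap.ker F).subtype)
      (by
        refine LinearMap.ext fun z => ?_
        have hz : F z.2.1 = 0 := z.2.2
        apply Prod.ext
        · simp [hσ, hz]
        · apply Subtype.ext
          simp [hσ, hz])
      (by
        refine LinearMap.ext fun z => ?_
        simp)

end GenusLemmas

section IsoClasses

variable (Λ : Type u) [Ring Λ]

/-- Isomorphism classes of left `Λ`-modules, used below only to compute with direct sums. -/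
def IsoClass : Type (u + 1) :=
  Quotient (⟨fun X Y => Nonempty (X ≃ₗ[Λ] Y), fun X => ⟨LinearEquiv.refl Λ X⟩,
    fun ⟨e⟩ => ⟨e.symm⟩, fun ⟨e⟩ ⟨f⟩ => ⟨e.trans f⟩⟩ : Setoid (ModuleCat.{u} Λ))

/-- The isomorphism class of a module. -/
def isoClass (X : Type u) [AddCommGroup X] [Module Λ X] : IsoClass Λ :=
  Quotient.mk _ (ModuleCat.of Λ X)

theorem isoClass_eq_iff {X : Type u} [AddCommGroup X] [Module Λ X]
    {Y : Type u} [AddCommGroup Y] [Module Λ Y] :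
    isoClass Λ X = isoClass Λ Y ↔ Nonempty (X ≃ₗ[Λ] Y) :=
  Quotient.eq

instance : Zero (IsoClass Λ) := ⟨isoClass Λ PUnit⟩

/-- Direct sum of isomorphism classes. -/
instance : Add (IsoClass Λ) where
  add := Quotient.map₂ (fun X Y => ModuleCat.of Λ (X × Y))
    (fun _ _ ⟨e⟩ _ _ ⟨f⟩ => ⟨LinearEquiv.prodCongr e f⟩)

instance : AddCommMonoid (IsoClass Λ) where
  add_assoc := by
    rintro ⟨X⟩ ⟨Y⟩ ⟨Z⟩
    exact Quotient.sound ⟨LinearEquiv.prodAssoc Λ X Y Z⟩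
  zero_add := by
    rintro ⟨X⟩
    exact Quotient.sound ⟨LinearEquiv.uniqueProd⟩
  add_zero := by
    rintro ⟨X⟩
    exact Quotient.sound ⟨LinearEquiv.prodUnique⟩
  add_comm := by
    rintro ⟨X⟩ ⟨Y⟩
    exact Quotient.sound ⟨LinearEquiv.prodComm Λ X Y⟩
  nsmul := nsmulRec

theorem isoClass_prod (X : Type u) [AddCommGroup X] [Module Λ X]
    (Y : Type u) [AddCommGroup Y] [Module Λ Y] :
    isoClass Λ (X × Y) = isoClass Λ X + isoClass Λ Y := rfl

theorem isoClass_pi (m : ℕ) : isoClass Λ (Fin m → Λ) = m • isoClass Λ Λ := by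
  induction m with
  | zero =>
    rw [zero_smul]
    exact (isoClass_eq_iff Λ).mpr ⟨(0 : (Fin 0 → Λ) ≃ₗ[Λ] PUnit.{u + 1})⟩
  | succ m ih =>
    rw [succ_nsmul', ← ih, ← isoClass_prod]
    exact (isoClass_eq_iff Λ).mpr ⟨(Fin.consLinearEquiv Λ (fun _ : Fin (m + 1) => Λ)).symm⟩

theorem stablyIso_iff {X : Type u} [AddCommGroup X] [Module Λ X]
    {Y : Type u} [AddCommGroup Y] [Module Λ Y] :
    StablyIso Λ X Y ↔
      ∃ m : ℕ, isoClass Λ X + m • isoClass Λ Λ = isoClass Λ Y + m • isoClass Λ Λ := by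
  simp only [← isoClass_pi, ← isoClass_prod, isoClass_eq_iff]
  rfl

end IsoClasses

section ClassGroup

variable (R : Type v) [CommRing R] (Λ : Type u) [Ring Λ] [Algebra R Λ]

/-- Stable isomorphism on the principal genus. -/
instance PrincipalGenus.stableSetoid : Setoid (PrincipalGenus R Λ) where
  r X Y := StablyIso Λ X.carrier Y.carrier
  iseqv :=
    { refl := fun X => ⟨0, ⟨LinearEquiv.refl Λ _⟩⟩
      symm := fun ⟨m, ⟨e⟩⟩ => ⟨m, ⟨e.symm⟩⟩
      trans := by
        intro X Y Z h h'
        rw [stablyIso_iff] at h h' ⊢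
        obtain ⟨m, hm⟩ := h
        obtain ⟨n, hn⟩ := h'
        refine ⟨m + n, ?_⟩
        rw [add_smul, ← add_assoc, hm, add_right_comm, hn, add_right_comm, add_assoc] }

/-- The locally free class group `Cl(Λ)`: stable isomorphism classes of locally free left
`Λ`-lattices of rank `1`. -/
def LocallyFreeClassGroup : Type (max v (u + 1)) :=
  Quotient (PrincipalGenus.stableSetoid R Λ)

variable {R Λ}

/-- The stable isomorphism class `[X]_st` in `Cl(Λ)` of a locally free lattice of rank `1`. -/
def LocallyFreeClassGroup.mk
    (X : Type u) [AddCommGroup X] [Module R X] [Module Λ X] [IsScalarTower R Λ X]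
    (hX : IsLocallyFree R Λ 1 X) : LocallyFreeClassGroup R Λ :=
  Quotient.mk _ { carrier := X, isLocallyFree := hX }

theorem PrincipalGenus.sound {X Y : PrincipalGenus R Λ} (m : ℕ)
    (h : m • isoClass Λ Λ + isoClass Λ X.carrier = m • isoClass Λ Λ + isoClass Λ Y.carrier) :
    (Quotient.mk _ X : LocallyFreeClassGroup R Λ) = Quotient.mk _ Y :=
  Quotient.sound ((stablyIso_iff Λ).mpr ⟨m, by rw [add_comm, h, add_comm]⟩)

variable [IsDedekindDomain R] [Module.Finite R Λ]

/-- `Λ` as a member of its principal genus. -/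
def PrincipalGenus.self : PrincipalGenus R Λ where
  carrier := Λ
  isLocallyFree := isLocallyFree_self

/-- Given `X₁, X₂` in the principal genus, some `X₃` in it with `X₁ ⊕ X₂ ≅ Λ ⊕ X₃`. -/
noncomputable def PrincipalGenus.sum (X₁ X₂ : PrincipalGenus R Λ) : PrincipalGenus R Λ :=
  (PrincipalGenus.exists_exchange X₁ X₂ PrincipalGenus.self).choose

theorem PrincipalGenus.isoClass_sum (X₁ X₂ : PrincipalGenus R Λ) :
    isoClass Λ X₁.carrier + isoClass Λ X₂.carrier =
      isoClass Λ Λ + isoClass Λ (X₁.sum X₂).carrier :=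
  (isoClass_eq_iff Λ).mpr
    (PrincipalGenus.exists_exchange X₁ X₂ PrincipalGenus.self).choose_spec

/-- Given `X` in the principal genus, some `X'` in it with `Λ ⊕ Λ ≅ X ⊕ X'`. -/
noncomputable def PrincipalGenus.inverse (X : PrincipalGenus R Λ) : PrincipalGenus R Λ :=
  (PrincipalGenus.exists_exchange PrincipalGenus.self PrincipalGenus.self X).choose

theorem PrincipalGenus.isoClass_inverse (X : PrincipalGenus R Λ) :
    isoClass Λ Λ + isoClass Λ Λ = isoClass Λ X.carrier + isoClass Λ X.inverse.carrier :=
  (isoClass_eq_iff Λ).mpr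
    (PrincipalGenus.exists_exchange PrincipalGenus.self PrincipalGenus.self X).choose_spec

/-- The addition on `Cl(Λ)`: `[X₁] + [X₂] = [X₃]` whenever `X₁ ⊕ X₂ ≅ Λ ⊕ X₃`, see
`LocallyFreeClassGroup.mk_add_mk`. -/
noncomputable instance : Add (LocallyFreeClassGroup R Λ) where
  add := Quotient.map₂ PrincipalGenus.sum (by
    intro X X' hX Y Y' hY
    obtain ⟨m, hm⟩ := (stablyIso_iff Λ).mp hX
    obtain ⟨n, hn⟩ := (stablyIso_iff Λ).mp hY
    refine (stablyIso_iff Λ).mpr ⟨m + n + 1, ?_⟩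
    have h := PrincipalGenus.isoClass_sum X Y
    have h' := PrincipalGenus.isoClass_sum X' Y'
    calc isoClass Λ (X.sum Y).carrier + (m + n + 1) • isoClass Λ Λ
        = (isoClass Λ Λ + isoClass Λ (X.sum Y).carrier) + (m + n) • isoClass Λ Λ := by
          rw [add_smul (m + n) 1, one_smul]; abel
      _ = (isoClass Λ X.carrier + m • isoClass Λ Λ) +
            (isoClass Λ Y.carrier + n • isoClass Λ Λ) := by
          rw [← h, add_smul]; abel
      _ = (isoClass Λ Λ + isoClass Λ (X'.sum Y').carrier) + (m + n) • isoClass Λ Λ := by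
          rw [hm, hn, ← h', add_smul]; abel
      _ = isoClass Λ (X'.sum Y').carrier + (m + n + 1) • isoClass Λ Λ := by
          rw [add_smul (m + n) 1, one_smul]; abel)

instance : Zero (LocallyFreeClassGroup R Λ) where
  zero := Quotient.mk _ PrincipalGenus.self

noncomputable instance : Neg (LocallyFreeClassGroup R Λ) where
  neg := Quotient.map PrincipalGenus.inverse (by
    intro X Y hXY
    obtain ⟨m, hm⟩ := (stablyIso_iff Λ).mp hXY
    refine (stablyIso_iff Λ).mpr ⟨m + 2, ?_⟩
    have h := PrincipalGenus.isoClass_inverse X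
    have h' := PrincipalGenus.isoClass_inverse Y
    calc isoClass Λ X.inverse.carrier + (m + 2) • isoClass Λ Λ
        = isoClass Λ X.inverse.carrier + (isoClass Λ Λ + isoClass Λ Λ) + m • isoClass Λ Λ := by
          rw [add_smul m 2, two_smul]; abel
      _ = isoClass Λ X.inverse.carrier +
            (isoClass Λ Y.carrier + m • isoClass Λ Λ) + isoClass Λ Y.inverse.carrier := by
          rw [h']; abel
      _ = (isoClass Λ X.carrier + isoClass Λ X.inverse.carrier) +
            m • isoClass Λ Λ + isoClass Λ Y.inverse.carrier := by
          rw [← hm]; abel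
      _ = isoClass Λ Y.inverse.carrier + (m + 2) • isoClass Λ Λ := by
          rw [← h, add_smul m 2, two_smul]; abel)

noncomputable instance : AddCommGroup (LocallyFreeClassGroup R Λ) where
  add_assoc := by
    rintro ⟨X⟩ ⟨Y⟩ ⟨Z⟩
    refine PrincipalGenus.sound 2 ?_
    rw [two_smul, add_assoc, ← PrincipalGenus.isoClass_sum, ← add_assoc,
      ← PrincipalGenus.isoClass_sum, add_assoc (isoClass Λ Λ), ← PrincipalGenus.isoClass_sum,
      add_left_comm, ← PrincipalGenus.isoClass_sum, add_assoc]
  zero_add := by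
    rintro ⟨X⟩
    refine PrincipalGenus.sound 1 ?_
    rw [one_smul, ← PrincipalGenus.isoClass_sum]
    rfl
  add_zero := by
    rintro ⟨X⟩
    refine PrincipalGenus.sound 1 ?_
    rw [one_smul, ← PrincipalGenus.isoClass_sum, add_comm]
    rfl
  add_comm := by
    rintro ⟨X⟩ ⟨Y⟩
    refine PrincipalGenus.sound 1 ?_
    rw [one_smul, ← PrincipalGenus.isoClass_sum, ← PrincipalGenus.isoClass_sum, add_comm]
  neg_add_cancel := by
    rintro ⟨X⟩
    refine PrincipalGenus.sound 1 ?_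
    rw [one_smul, ← PrincipalGenus.isoClass_sum, add_comm, ← PrincipalGenus.isoClass_inverse]
    rfl
  nsmul := nsmulRec
  zsmul := zsmulRec

/-- `[X₁] + [X₂] = [X₃]` whenever `X₁ ⊕ X₂ ≅ Λ ⊕ X₃`. -/
theorem LocallyFreeClassGroup.mk_add_mk
    {X₁ : Type u} [AddCommGroup X₁] [Module R X₁] [Module Λ X₁] [IsScalarTower R Λ X₁]
    {X₂ : Type u} [AddCommGroup X₂] [Module R X₂] [Module Λ X₂] [IsScalarTower R Λ X₂]
    {X₃ : Type u} [AddCommGroup X₃] [Module R X₃] [Module Λ X₃] [IsScalarTower R Λ X₃]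
    (h₁ : IsLocallyFree R Λ 1 X₁) (h₂ : IsLocallyFree R Λ 1 X₂) (h₃ : IsLocallyFree R Λ 1 X₃)
    (e : (X₁ × X₂) ≃ₗ[Λ] (Λ × X₃)) :
    (mk X₁ h₁ + mk X₂ h₂ : LocallyFreeClassGroup R Λ) = mk X₃ h₃ := by
  refine PrincipalGenus.sound 1 ?_
  rw [one_smul, ← PrincipalGenus.isoClass_sum]
  exact (isoClass_eq_iff Λ).mpr ⟨e⟩

end ClassGroup

section BaseChange

variable {R : Type v} [CommRing R] {Λ : Type u} [Ring Λ] [Algebra R Λ]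
variable {Γ : Type u} [Ring Γ] [Algebra R Γ]

/-- The extension of scalars `Γ ⊗_Λ X` of a left `Λ`-module `X` along `f : Λ → Γ`: the quotient of
`Γ ⊗_R X` by the relations `a f(b) ⊗ x = a ⊗ b x`. -/
abbrev BaseChange (f : Λ →ₐ[R] Γ)
    (X : Type u) [AddCommGroup X] [Module R X] [Module Λ X] [IsScalarTower R Λ X] : Type u :=
  (Γ ⊗[R] X) ⧸ Submodule.span Γ
    {z : Γ ⊗[R] X | ∃ (a : Γ) (b : Λ) (x : X), z = (a * f b) ⊗ₜ[R] x - a ⊗ₜ[R] (b • x)}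

end BaseChange

/-- A fibre product of `R`-algebras
`Λ → Λ₁` (the map `π₁`), `Λ → Λ₂` (the map `π₂`), `Λ₁ → Λbar` (the map `g₁`) and
`Λ₂ → Λbar` (the map `g₂`). -/
structure FibreProduct (R : Type v) [CommRing R] (Λ Λ₁ Λ₂ : Type u) (Λbar : Type w)
    [Ring Λ] [Ring Λ₁] [Ring Λ₂] [Ring Λbar]
    [Algebra R Λ] [Algebra R Λ₁] [Algebra R Λ₂] [Algebra R Λbar] where
  π₁ : Λ →ₐ[R] Λ₁
  π₂ : Λ →ₐ[R] Λ₂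
  g₁ : Λ₁ →ₐ[R] Λbar
  g₂ : Λ₂ →ₐ[R] Λbar
  comm : ∀ x, g₁ (π₁ x) = g₂ (π₂ x)
  existsUnique : ∀ x₁ x₂, g₁ x₁ = g₂ x₂ → ∃! x, π₁ x = x₁ ∧ π₂ x = x₂

namespace FibreProduct

variable {R : Type v} [CommRing R] {Λ Λ₁ Λ₂ : Type u} {Λbar : Type w}
  [Ring Λ] [Ring Λ₁] [Ring Λ₂] [Ring Λbar]
  [Algebra R Λ] [Algebra R Λ₁] [Algebra R Λ₂] [Algebra R Λbar]

/-- The direct sum `Λ₁ ⊕ Λ₂`, as a left `Λ`-module through `π₁` and `π₂`. -/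
def Ambient (_S : FibreProduct R Λ Λ₁ Λ₂ Λbar) : Type u := Λ₁ × Λ₂

instance (S : FibreProduct R Λ Λ₁ Λ₂ Λbar) : AddCommGroup S.Ambient :=
  inferInstanceAs (AddCommGroup (Λ₁ × Λ₂))

instance (S : FibreProduct R Λ Λ₁ Λ₂ Λbar) : Module R S.Ambient :=
  inferInstanceAs (Module R (Λ₁ × Λ₂))

instance (S : FibreProduct R Λ Λ₁ Λ₂ Λbar) : Module Λ S.Ambient :=
  Module.compHom (Λ₁ × Λ₂) (S.π₁.prod S.π₂).toRingHom

theorem smul_def (S : FibreProduct R Λ Λ₁ Λ₂ Λbar) (a : Λ) (x : S.Ambient) :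
    a • x = ((S.π₁ a * x.1, S.π₂ a * x.2) : Λ₁ × Λ₂) := rfl

instance (S : FibreProduct R Λ Λ₁ Λ₂ Λbar) : IsScalarTower R Λ S.Ambient where
  smul_assoc r a x := by
    simp only [smul_def, map_smul, smul_mul_assoc]
    rfl

/-- `M(u) = {(x₁, x₂) ∈ Λ₁ ⊕ Λ₂ | g₁(x₁) u = g₂(x₂)}`, a left `Λ`-module. -/
def M (S : FibreProduct R Λ Λ₁ Λ₂ Λbar) (u : Λbarˣ) : Submodule Λ S.Ambient where
  carrier := {x | S.g₁ x.1 * u = S.g₂ x.2}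
  add_mem' {x y} hx hy := by
    change S.g₁ (x.1 + y.1) * u = S.g₂ (x.2 + y.2)
    rw [map_add, map_add, add_mul, hx, hy]
  zero_mem' := by
    change S.g₁ 0 * u = S.g₂ 0
    rw [map_zero, map_zero, zero_mul]
  smul_mem' a x hx := by
    change S.g₁ (S.π₁ a * x.1) * u = S.g₂ (S.π₂ a * x.2)
    rw [map_mul, map_mul, mul_assoc, hx, S.comm]

/-- `W = {w₁ w₂ | wᵢ ∈ gᵢ(Λᵢˣ)}`, a set of units of `Λbar`. -/
def W (S : FibreProduct R Λ Λ₁ Λ₂ Λbar) : Set Λbarˣ :=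
  {w | ∃ (a : Λ₁ˣ) (b : Λ₂ˣ),
    w = Units.map (S.g₁ : Λ₁ →* Λbar) a * Units.map (S.g₂ : Λ₂ →* Λbar) b}

end FibreProduct

end Orders

namespace Orders

/-! ### Finite rings: lifting units, and stable range one -/

section FiniteRings

/-! The argument is Milnor patching over a finite base, combined with the Jordan–Zassenhaus theorem.
Since the element 1 of `Λbar` is torsion, one nonzero `r : R` kills `Λbar`. As some `gᵢ` is
surjective, `Λbar` is finitely generated over `R`, and it is finite because `R` modulo `r` is.

A projective `Λ`-module that becomes free of rank n over `Λ₁` and `Λ₂` is glued from free modules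
along a matrix in GL_n(`Λbar`) (`exists_isoClass_eq_matrixGlue`), and changing bases multiplies this
matrix by matrices from `Λ₁` on the left and from `Λ₂` on the right. A finite ring has stable range
one (`exists_isUnit_add_mul`), so elementary operations reduce the matrix to diag(u, 1, …, 1), and
elementary matrices lift along the surjective `gᵢ`. The module is therefore M(u) plus a free module,
which gives exactness at Cl(`Λ`). Whitehead's identity for diag(u, u⁻¹) gives M(u) ⊕ M(v) ≅ `Λ` ⊕
M(u v), so ∂ is additive.

Local freeness of M(u) and surjectivity onto the class groups of the factors use pairs of maps
inverse to each other up to a scalar s ≡ 1 mod `r` (`CoprimePair`). Such pairs with a common s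
patch; at a prime containing s the element `r` is invertible, and there the gluing condition
disappears.

M(u) is free exactly when u lies in `W` (`isoClass_M_eq_of_mem_W`, `mem_W_of_isoClass_eq`) and
stably free exactly when u lies in ker ∂. Hence `W` is contained in ker ∂, with equality if `Λ` has
SFC. In matrix form SFC says that right invertible rectangular matrices can be completed. Such
matrices over a factor lift to `Λ` after an elementary change (`hasMatrixSFC_fst`). Conversely,
completions over the two factors differ over `Λbar` by a block triangular matrix whose only
obstruction is a unit in ker ∂; if this is `W`, the completions can be made to agree
(`hasMatrixSFC`).

Finiteness of the class groups comes from `finitelyManyLattices`. As `R` need not be finitely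
generated over ℤ, it is applied to a finitely generated subring of the order. With everything
finite, equality of `W` and ker ∂ is equality of cardinalities, and the exact sequence computes the
latter. -/

theorem exists_pow_isIdempotentElem {M : Type*} [Monoid M] [Finite M] (x : M) :
    ∃ k : ℕ, IsIdempotentElem (x ^ (k + 1)) := by
  obtain ⟨i, j, hij, h⟩ : ∃ i j : ℕ, i < j ∧ x ^ (i + 1) = x ^ (j + 1) := by
    obtain ⟨i, j, hne, h⟩ := Finite.exists_ne_map_eq_of_infinite fun n : ℕ => x ^ (n + 1)
    rcases lt_or_gt_of_ne hne with hlt | hlt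
    · exact ⟨i, j, hlt, h⟩
    · exact ⟨j, i, hlt, h.symm⟩
  obtain ⟨p, rfl⟩ := Nat.exists_eq_add_of_lt hij
  have step : ∀ n m : ℕ, x ^ (i + 1 + n + (p + 1) * m) = x ^ (i + 1 + n) := by
    intro n m
    induction m with
    | zero => rfl
    | succ m ih =>
      have : i + 1 + n + (p + 1) * (m + 1) = (i + p + 1 + 1) + (n + (p + 1) * m) := by ring
      rw [this, pow_add, ← h, ← pow_add, ← add_assoc, ih]
  -- The powers have period p + 1 from exponent i + 1 on. The exponent (p + 1)(i + 1) is a multiple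
  -- of the period beyond that point, so doubling it changes nothing.
  refine ⟨(p + 1) * (i + 1) - 1, ?_⟩
  have hpos : 1 ≤ (p + 1) * (i + 1) := Nat.mul_pos (by omega) (by omega)
  have hge : i + 1 ≤ (p + 1) * (i + 1) := Nat.le_mul_of_pos_left _ (by omega)
  obtain ⟨n, hn⟩ := Nat.exists_eq_add_of_le hge
  have := step n (i + 1)
  rw [Nat.sub_add_cancel hpos, IsIdempotentElem, ← pow_add]
  rw [← hn] at this
  exact this

/-- Units lift along surjections of finite rings. -/
theorem exists_unit_lift {B C : Type*} [Ring B] [Finite B] [Ring C] (φ : B →+* C)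
    (hφ : Function.Surjective φ) (c : Cˣ) : ∃ b : Bˣ, φ b = c := by
  obtain ⟨b, hb⟩ := hφ c
  obtain ⟨k, hk⟩ := exists_pow_isIdempotentElem b
  -- The image is an idempotent and a unit, hence 1.
  have he : φ (b ^ (k + 1)) = 1 := by
    have h1 : IsIdempotentElem (c ^ (k + 1)) := by
      have := hk.map φ
      rw [map_pow, hb] at this
      exact Units.ext (by simpa using this.eq)
    rw [map_pow, hb, ← Units.val_pow_eq_pow_val]
    have := mul_eq_left.mp h1
    rw [this, Units.val_one]
  set e := b ^ (k + 1) with hedef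
  have hbe : b * e = e * b := by rw [hedef, ← pow_succ, ← pow_succ']
  have hbke : b ^ k * e = e * b ^ k := by rw [hedef, ← pow_add, ← pow_add, add_comm]
  have hee : e * e = e := hk
  have h1 : b * b ^ k = e := by rw [hedef, pow_succ']
  have h2 : b ^ k * b = e := by rw [hedef, pow_succ]
  -- In the corner cut out by e the element b is invertible, since b ^ k inverts it up to e. Adding
  -- 1 - e gives a unit of the whole ring without changing the image, because e maps to 1.
  refine ⟨⟨b * e + (1 - e), b ^ k * e + (1 - e), ?_, ?_⟩, ?_⟩
  · have : (b * e + (1 - e)) * (b ^ k * e + (1 - e)) =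
        b * (e * b ^ k) * e + b * (e - e * e) + (b ^ k * e - e * b ^ k * e) +
          (1 - e - e + e * e) := by noncomm_ring
    rw [this, ← hbke, mul_assoc (b ^ k), hee, ← mul_assoc, h1, hee, hee]
    simp
  · have : (b ^ k * e + (1 - e)) * (b * e + (1 - e)) =
        b ^ k * (e * b) * e + b ^ k * (e - e * e) + (b * e - e * b * e) +
          (1 - e - e + e * e) := by noncomm_ring
    rw [this, ← hbe, mul_assoc b, hee, ← mul_assoc, h2, hee, hee]
    simp
  · simp [he, hb]

/-- Von Neumann regularity: the left ideal of a is generated by an idempotent w a, and right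
multiplication by this idempotent fixes a. -/
theorem exists_mul_mul_eq_self {B : Type*} [Ring B] [IsSemisimpleRing B] (a : B) :
    ∃ w, a * w * a = a := by
  obtain ⟨g, hg, h⟩ := IsSemisimpleRing.ideal_eq_span_idempotent (Ideal.span {a})
  have h1 : g ∈ Ideal.span {a} := h ▸ Ideal.subset_span rfl
  have h2 : a ∈ Ideal.span {g} := h ▸ Ideal.subset_span rfl
  obtain ⟨w, rfl⟩ := Ideal.mem_span_singleton'.mp h1
  obtain ⟨c, hc⟩ := Ideal.mem_span_singleton'.mp h2
  refine ⟨w, ?_⟩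
  rw [mul_assoc]
  nth_rw 1 [← hc]
  rw [mul_assoc, hg.eq, hc]

/-- Take t for which the right ideal generated by a' = a + b t is as large as possible. If w is a
quasi-inverse of a', maximality forces (1 - a' w) B (1 - w a') = 0, and a counting argument then
forces w a' = 1. -/
theorem exists_isUnit_add_mul_of_isSemisimpleRing {B : Type*} [Ring B] [Finite B]
    [IsSemisimpleRing B] {a b x y : B} (h : a * x + b * y = 1) : ∃ t, IsUnit (a + b * t) := by
  classical
  obtain ⟨t, ht⟩ := Finite.exists_max fun t : B => Nat.card (Set.range fun z => (a + b * t) * z)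
  refine ⟨t, ?_⟩
  set a' := a + b * t with ha'
  obtain ⟨w, hw⟩ := exists_mul_mul_eq_self a'
  have h' : a' * x + b * (y - t * x) = 1 := by rw [ha', ← h]; noncomm_ring
  clear_value a'
  -- Adding z (1 - w a') to t gives a'' with a'' w a' = a', so the right ideal can only grow. By
  -- maximality it stays the same, hence it contains b z (1 - w a') and is killed by 1 - a' w.
  have key : ∀ z, (1 - a' * w) * (b * z * (1 - w * a')) = 0 := by
    intro z
    have hle := ht (t + z * (1 - w * a'))
    have hnew : a + b * (t + z * (1 - w * a')) = a' + b * z * (1 - w * a') := by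
      rw [ha']; noncomm_ring
    simp only [hnew] at hle
    set a'' := a' + b * z * (1 - w * a') with ha''
    have hae : a'' * (w * a') = a' := by
      have : a'' * (w * a') = a' * w * a' + b * z * (w * a' - w * (a' * w * a')) := by
        rw [ha'']; noncomm_ring
      rw [this, hw]; simp
    have hsub : (Set.range fun z => a' * z) ⊆ Set.range fun z => a'' * z := by
      rintro _ ⟨c, rfl⟩
      exact ⟨w * a' * c, by simp only [← mul_assoc] at hae ⊢; rw [hae]⟩
    have heq := Set.eq_of_subset_of_ncard_le hsub (by simpa [Set.ncard] using hle)
    have hmem : a'' * (1 - w * a') ∈ Set.range fun z => a' * z := heq ▸ ⟨_, rfl⟩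
    obtain ⟨c, hc⟩ := hmem
    have h3 : a'' * (1 - w * a') = b * z * (1 - w * a') := by
      rw [mul_sub, hae, mul_one, ha'']; abel
    rw [← h3, ← hc]
    have : (1 - a' * w) * (a' * c) = (a' - a' * w * a') * c := by noncomm_ring
    simp only [this, hw, sub_self, zero_mul]
  have key2 : ∀ z, (1 - a' * w) * (z * (1 - w * a')) = 0 := by
    intro z
    have : z = a' * (x * z) + b * ((y - t * x) * z) := by
      rw [← mul_assoc, ← mul_assoc, ← add_mul, h', one_mul]
    rw [this, add_mul, mul_add, key, add_zero]
    have : (1 - a' * w) * (a' * (x * z) * (1 - w * a')) =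
      (a' - a' * w * a') * (x * z * (1 - w * a')) := by noncomm_ring
    rw [this, hw, sub_self, zero_mul]
  let s : Set B := Set.range fun z => z * (1 - w * a')
  let F : s → s := fun z => ⟨w * z.1, by
    obtain ⟨_, c, rfl⟩ := z
    exact ⟨w * c, by simp only [mul_assoc]⟩⟩
  -- On the left ideal B (1 - w a'), multiplication by a' w is the identity, so left multiplication
  -- by w is injective there, hence surjective by finiteness.
  have hF : Function.Injective F := by
    rintro ⟨_, c, rfl⟩ ⟨_, d, rfl⟩ hcd
    have hcd' : w * (c * (1 - w * a')) = w * (d * (1 - w * a')) := congrArg Subtype.val hcd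
    have e1 := key2 c
    have e2 := key2 d
    apply Subtype.ext
    rw [sub_mul, one_mul, sub_eq_zero] at e1 e2
    change c * (1 - w * a') = d * (1 - w * a')
    rw [e1, e2, mul_assoc, mul_assoc, hcd']
  obtain ⟨⟨_, c, rfl⟩, hc⟩ := Finite.surjective_of_injective hF ⟨1 - w * a', 1, one_mul _⟩
  have hc' : w * (c * (1 - w * a')) = 1 - w * a' := congrArg Subtype.val hc
  have h4 : (w * a') * (1 - w * a') = 1 - w * a' := by
    have e1 := key2 c
    rw [sub_mul, one_mul, sub_eq_zero] at e1
    calc (w * a') * (1 - w * a') = w * (a' * w * (c * (1 - w * a'))) := by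
          rw [mul_assoc a', hc', mul_assoc]
      _ = 1 - w * a' := by rw [← e1, hc']
  have h5 : (w * a') * (1 - w * a') = 0 := by
    have : (w * a') * (1 - w * a') = w * (a' - a' * w * a') := by noncomm_ring
    rw [this, hw, sub_self, mul_zero]
  have h6 : w * a' = 1 := by rw [h5] at h4; exact (sub_eq_zero.mp h4.symm).symm
  exact IsUnit.of_mul_eq_one w (mul_eq_one_comm.mp h6)

/-- A finite ring has stable range one. -/
theorem exists_isUnit_add_mul {B : Type*} [Ring B] [Finite B] {a b x y : B}
    (h : a * x + b * y = 1) : ∃ t, IsUnit (a + b * t) := by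
  have : IsSemiprimaryRing B := inferInstance
  have := IsSemiprimaryRing.isSemisimpleRing (R := B)
  let q := Ideal.Quotient.mk (Ring.jacobson B)
  have hq : Function.Surjective q := Ideal.Quotient.mk_surjective
  have : Finite (B ⧸ Ring.jacobson B) := Finite.of_surjective _ hq
  obtain ⟨t', ht'⟩ := exists_isUnit_add_mul_of_isSemisimpleRing (a := q a) (b := q b)
    (x := q x) (y := q y) (by rw [← map_mul, ← map_mul, ← map_add, h, map_one])
  obtain ⟨t, rfl⟩ := hq t'
  refine ⟨t, ?_⟩
  rw [← map_mul, ← map_add] at ht'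
  -- An idempotent power of a + b t is 1 modulo the radical; its complement is an idempotent in a
  -- nilpotent ideal, hence zero.
  obtain ⟨k, hk⟩ := exists_pow_isIdempotentElem (a + b * t)
  have h1 : q ((a + b * t) ^ (k + 1)) = 1 := by
    rw [map_pow]
    have h2 := hk.map q
    rw [map_pow] at h2
    exact (ht'.pow (k + 1)).mul_eq_left.mp h2
  have h2 : 1 - (a + b * t) ^ (k + 1) ∈ Ring.jacobson B := by
    rw [← Ideal.Quotient.eq_zero_iff_mem]
    change q _ = 0
    rw [map_sub, h1, map_one, sub_self]
  obtain ⟨n, hn⟩ := IsSemiprimaryRing.isNilpotent (R := B)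
  have h3 : (1 - (a + b * t) ^ (k + 1)) ^ (n + 1) = 0 := by
    have := Ideal.pow_mem_pow h2 n
    rw [hn] at this
    rw [pow_succ, Ideal.mem_bot.mp this, zero_mul]
  rw [hk.one_sub.pow_succ_eq] at h3
  have h4 := (sub_eq_zero.mp h3).symm
  exact (isUnit_pow_succ_iff (n := k)).mp (h4 ▸ isUnit_one)

end FiniteRings

end Orders

namespace Orders

/-! ### Elementary matrices and diagonal reduction over a finite ring -/

section ElementaryMatrices

open Matrix

variable {ι κ : Type*} [Fintype ι] [DecidableEq ι] [Fintype κ] [DecidableEq κ]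
variable {B : Type*} [Ring B]

theorem vecMulVec_mul_vecMulVec_eq_zero {ι : Type*} [Fintype ι] {x y x' : ι → B} {y' : ι → B}
    (h : ∀ i, y i = 0 ∨ x' i = 0) : vecMulVec x y * vecMulVec x' y' = 0 := by
  ext i j
  rw [Matrix.mul_apply, Matrix.zero_apply]
  refine Finset.sum_eq_zero fun k _ => ?_
  rcases h k with h | h <;> simp [vecMulVec_apply, h]

/-- The unipotent matrix `1 + xᵀ y`, for vectors `x`, `y` with disjoint supports. -/
def transvectionUnit (x y : ι → B) (h : ∀ i, x i = 0 ∨ y i = 0) : (Matrix ι ι B)ˣ where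
  val := 1 + vecMulVec x y
  inv := 1 - vecMulVec x y
  val_inv := by
    rw [add_mul, one_mul, mul_sub, mul_one,
      vecMulVec_mul_vecMulVec_eq_zero fun i => (h i).symm]
    abel
  inv_val := by
    rw [sub_mul, one_mul, mul_add, mul_one,
      vecMulVec_mul_vecMulVec_eq_zero fun i => (h i).symm]
    abel

theorem vecMul_transvectionUnit (x y : ι → B) (h : ∀ i, x i = 0 ∨ y i = 0) (r : ι → B) :
    r ᵥ* (transvectionUnit x y h : Matrix ι ι B) = r + (r ⬝ᵥ x) • y := by
  change r ᵥ* (1 + vecMulVec x y) = _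
  rw [vecMul_add, vecMul_one, vecMul_vecMulVec]

variable (ι B) in
/-- The group generated by the unipotent matrices `1 + xᵀ y`. -/
def elementarySubgroup : Subgroup (Matrix ι ι B)ˣ :=
  Subgroup.closure {u | ∃ x y h, u = transvectionUnit x y h}

theorem transvectionUnit_mem (x y : ι → B) (h : ∀ i, x i = 0 ∨ y i = 0) :
    transvectionUnit x y h ∈ elementarySubgroup ι B :=
  Subgroup.subset_closure ⟨x, y, h, rfl⟩

/-- The map on invertible matrices induced by a ring homomorphism. -/
abbrev unitsMap {C : Type*} [Ring C] (ι : Type*) [Fintype ι] [DecidableEq ι] (φ : C →+* B) :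
    (Matrix ι ι C)ˣ →* (Matrix ι ι B)ˣ :=
  Units.map (φ.mapMatrix (m := ι)).toMonoidHom

/-- Invertible matrices need not lift along a surjection, but generators of the form 1 + xᵀ y do: it
suffices to lift x and y. -/
theorem elementarySubgroup_le_range {C : Type*} [Ring C] (φ : C →+* B)
    (hφ : Function.Surjective φ) : elementarySubgroup ι B ≤ (unitsMap ι φ).range := by
  classical
  refine (Subgroup.closure_le _).mpr ?_
  rintro _ ⟨x, y, h, rfl⟩
  choose s hs using hφ
  -- Sending 0 to 0 keeps the supports of the lifted vectors disjoint.
  let l : B → C := fun b => if b = 0 then 0 else s b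
  have hl : ∀ b, φ (l b) = b := fun b => by
    by_cases hb : b = 0 <;> simp [l, hb, hs]
  refine ⟨transvectionUnit (fun i => l (x i)) (fun i => l (y i)) fun i => ?_, ?_⟩
  · rcases h i with h | h <;> simp [l, h]
  · ext i j
    simp [transvectionUnit, Matrix.one_apply, vecMulVec_apply, hl, apply_ite φ]

/-- Stable range one makes the entry at j a unit; the spare index i₀ then serves to turn it into 1
by elementary operations alone, after which the row is cleared. Every operation used is 1 + xᵀ y
with x supported in t, so rows vanishing on t are untouched, which allows treating the rows of a
matrix one at a time. -/
theorem exists_elementary_row_reduction [Finite B] {r v : ι → B} {t : Set ι} {i₀ j : ι} (hi₀ : i₀ ∈ t)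
    (hj : j ∈ t) (hne : i₀ ≠ j) (hv : ∀ i ∉ t, v i = 0) (hrv : r ⬝ᵥ v = 1) :
    ∃ ε ∈ elementarySubgroup ι B, r ᵥ* (ε : Matrix ι ι B) = Pi.single j 1 ∧
      ∀ r' : ι → B, (∀ i ∈ t, r' i = 0) → r' ᵥ* (ε : Matrix ι ι B) = r' := by
  have h0 : ∀ (r' x : ι → B), (∀ i ∈ t, r' i = 0) → (∀ i ∉ t, x i = 0) → r' ⬝ᵥ x = 0 := by
    intro r' x h1 h2
    refine Finset.sum_eq_zero fun i _ => ?_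
    by_cases hi : i ∈ t
    · rw [h1 i hi, zero_mul]
    · rw [h2 i hi, mul_zero]
  have hsingle : ∀ (k : ι) (c : B), k ∈ t → ∀ i ∉ t, (Pi.single k c : ι → B) i = 0 := by
    intro k c hk i hi
    have : i ≠ k := by rintro rfl; exact hi hk
    rw [Pi.single_apply, if_neg this]
  -- The relation r · v = 1 is split into its term at j and the sum b of the remaining terms, which
  -- gets coefficient 1.
  obtain ⟨s, hs⟩ := exists_isUnit_add_mul (a := r j) (b := r ⬝ᵥ Function.update v j 0)
    (x := v j) (y := 1) (by
      rw [mul_one, ← hrv, dotProduct, dotProduct, ← Finset.add_sum_erase _ _ (Finset.mem_univ j),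
        ← Finset.add_sum_erase _ _ (Finset.mem_univ j)]
      simp only [Function.update_self, mul_zero, zero_add]
      congr 1
      refine Finset.sum_congr rfl fun i hi => ?_
      rw [Function.update_of_ne (Finset.ne_of_mem_erase hi)])
  obtain ⟨w, hw⟩ := hs
  let x₁ : ι → B := fun i => Function.update v j 0 i * s
  have hx₁ : ∀ i ∉ t, x₁ i = 0 := by
    intro i hi
    by_cases hij : i = j
    · exact absurd (hij ▸ hj) hi
    · simp [x₁, Function.update_of_ne hij, hv i hi]
  let ε₁ := transvectionUnit x₁ (Pi.single j 1) (fun i => by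
    by_cases hij : i = j
    · left; simp [x₁, hij]
    · right; exact Pi.single_eq_of_ne hij 1)
  let r₁ := r ᵥ* (ε₁ : Matrix ι ι B)
  have hr₁ : r₁ j = w := by
    simp only [r₁, ε₁, vecMul_transvectionUnit, Pi.add_apply, Pi.smul_apply, Pi.single_eq_same,
      smul_eq_mul, mul_one, hw]
    congr 1
    simp only [x₁, dotProduct, Finset.sum_mul, mul_assoc]
  -- The entry at j is the unit w, so adding w · w⁻¹ (1 - r₁ i₀) to the entry at i₀ makes that entry
  -- 1.
  let ε₂ := transvectionUnit (Pi.single j (((w⁻¹ : Bˣ) : B) * (1 - r₁ i₀))) (Pi.single i₀ (1 : B))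
    (fun i => by
      by_cases hij : i = j
      · right; exact Pi.single_eq_of_ne (hij ▸ hne.symm) 1
      · left; exact Pi.single_eq_of_ne hij _)
  let r₂ := r₁ ᵥ* (ε₂ : Matrix ι ι B)
  have hr₂ : r₂ i₀ = 1 := by
    simp [r₂, ε₂, vecMul_transvectionUnit, hr₁]
  let ε₃ := transvectionUnit (Pi.single i₀ (1 - r₂ j)) (Pi.single j (1 : B))
    (fun i => by
      by_cases hij : i = j
      · left; exact Pi.single_eq_of_ne (hij ▸ hne.symm) _
      · right; exact Pi.single_eq_of_ne hij _)
  let r₃ := r₂ ᵥ* (ε₃ : Matrix ι ι B)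
  have hr₃ : r₃ j = 1 := by
    simp [r₃, ε₃, vecMul_transvectionUnit, hr₂]
  let ε₄ := transvectionUnit (Pi.single j (1 : B)) (Function.update (-r₃) j 0)
    (fun i => by
      by_cases hij : i = j
      · right; simp [hij]
      · left; exact Pi.single_eq_of_ne hij _)
  refine ⟨ε₁ * ε₂ * ε₃ * ε₄, mul_mem (mul_mem (mul_mem (transvectionUnit_mem _ _ _)
    (transvectionUnit_mem _ _ _)) (transvectionUnit_mem _ _ _)) (transvectionUnit_mem _ _ _),
    ?_, fun r' hr' => ?_⟩
  · simp only [Units.val_mul, ← vecMul_vecMul]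
    change r₃ ᵥ* (ε₄ : Matrix ι ι B) = _
    ext i
    by_cases hij : i = j
    · subst hij
      simp [ε₄, vecMul_transvectionUnit, hr₃]
    · simp [ε₄, vecMul_transvectionUnit, hr₃, hij]
  · simp only [Units.val_mul, ← vecMul_vecMul]
    simp only [ε₁, ε₂, ε₃, ε₄, vecMul_transvectionUnit]
    rw [h0 r' _ hr' hx₁, zero_smul, add_zero, h0 r' _ hr' (hsingle _ _ hj), zero_smul, add_zero,
      h0 r' _ hr' (hsingle _ _ hi₀), zero_smul, add_zero, h0 r' _ hr' (hsingle _ _ hj),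
      zero_smul, add_zero]

/-- A right invertible matrix with more columns than rows over a finite ring can be brought to
the form `(0 | 1)` by elementary column operations. -/
theorem exists_mul_elementary_eq_fromCols [Finite B] [Nonempty ι] {U : Matrix κ (ι ⊕ κ) B}
    {V : Matrix (ι ⊕ κ) κ B} (hUV : U * V = 1) :
    ∃ ε ∈ elementarySubgroup (ι ⊕ κ) B, U * (ε : Matrix (ι ⊕ κ) (ι ⊕ κ) B) = fromCols 0 1 := by
  suffices h : ∀ s : Finset κ, ∃ ε ∈ elementarySubgroup (ι ⊕ κ) B, ∀ i ∈ s,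
      (U * (ε : Matrix (ι ⊕ κ) (ι ⊕ κ) B)) i = Pi.single (Sum.inr i) 1 by
    obtain ⟨ε, hε, h⟩ := h Finset.univ
    refine ⟨ε, hε, ?_⟩
    ext i j
    rw [h i (Finset.mem_univ i)]
    rcases j with j | j
    · simp
    · by_cases hij : i = j
      · subst hij; simp
      · rw [fromCols_apply_inr, Matrix.one_apply_ne hij]
        exact Pi.single_eq_of_ne (fun h => hij (Sum.inr_injective h).symm) _
  intro s
  induction s using Finset.induction_on with
  | empty => exact ⟨1, one_mem _, by simp⟩
  | insert k s hk ih =>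
    obtain ⟨ε, hε, h⟩ := ih
    let V' := ((ε⁻¹ : (Matrix (ι ⊕ κ) (ι ⊕ κ) B)ˣ) : Matrix (ι ⊕ κ) (ι ⊕ κ) B) * V
    have hV' : U * (ε : Matrix (ι ⊕ κ) (ι ⊕ κ) B) * V' = 1 := by
      rw [Matrix.mul_assoc, ← Matrix.mul_assoc (ε : Matrix (ι ⊕ κ) (ι ⊕ κ) B), Units.mul_inv,
        Matrix.one_mul, hUV]
    have hrow : ∀ i l, (U * (ε : Matrix (ι ⊕ κ) (ι ⊕ κ) B)) i ⬝ᵥ (fun c => V' c l) =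
        (1 : Matrix κ κ B) i l := fun i l => by
      rw [← hV']; rfl
    -- Here t consists of the columns not yet used as pivots. The rows already treated are unit
    -- vectors at the other columns, so they vanish on t, and the relation with V' = ε⁻¹ V forces
    -- the column of V' for the new row to vanish off t.
    obtain ⟨ε', hε', h1, h2⟩ := exists_elementary_row_reduction
      (r := (U * (ε : Matrix (ι ⊕ κ) (ι ⊕ κ) B)) k) (v := fun c => V' c k)
      (t := {c | ∀ i ∈ s, c ≠ Sum.inr i}) (i₀ := Sum.inl (Classical.arbitrary ι))
      (j := Sum.inr k) (by simp) (by
        intro i hi hki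
        exact hk (Sum.inr_injective hki ▸ hi)) (by simp) (by
        intro c hc
        simp only [Set.mem_ofPred_eq, not_forall, not_not] at hc
        obtain ⟨i, hi, rfl⟩ := hc
        have := hrow i k
        rw [h i hi, single_one_dotProduct, Matrix.one_apply_ne (by rintro rfl; exact hk hi)] at this
        exact this) (by rw [hrow, Matrix.one_apply_eq])
    refine ⟨ε * ε', mul_mem hε hε', fun i hi => ?_⟩
    have hassoc : (U * ((ε * ε' : (Matrix (ι ⊕ κ) (ι ⊕ κ) B)ˣ) : Matrix (ι ⊕ κ) (ι ⊕ κ) B)) i =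
        (U * (ε : Matrix (ι ⊕ κ) (ι ⊕ κ) B)) i ᵥ* (ε' : Matrix (ι ⊕ κ) (ι ⊕ κ) B) := by
      rw [Units.val_mul, ← Matrix.mul_assoc]; rfl
    rw [hassoc]
    rcases Finset.mem_insert.mp hi with rfl | hi
    · exact h1
    · rw [h2 _ ?_, h i hi]
      intro c hc
      rw [h i hi]
      exact Pi.single_eq_of_ne (hc i hi) _

/-- The block diagonal matrix of two invertible matrices. -/
def blockUnit (a : (Matrix ι ι B)ˣ) (b : (Matrix κ κ B)ˣ) : (Matrix (ι ⊕ κ) (ι ⊕ κ) B)ˣ where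
  val := fromBlocks a 0 0 b
  inv := fromBlocks ↑a⁻¹ 0 0 ↑b⁻¹
  val_inv := by simp [fromBlocks_multiply]
  inv_val := by simp [fromBlocks_multiply]

theorem blockUnit_mul (a a' : (Matrix ι ι B)ˣ) (b b' : (Matrix κ κ B)ˣ) :
    blockUnit a b * blockUnit a' b' = blockUnit (a * a') (b * b') :=
  Units.ext (by simp [blockUnit, fromBlocks_multiply])

theorem blockUnit_one : blockUnit (1 : (Matrix ι ι B)ˣ) (1 : (Matrix κ κ B)ˣ) = 1 :=
  Units.ext (by simp [blockUnit])

theorem blockUnit_inv (a : (Matrix ι ι B)ˣ) (b : (Matrix κ κ B)ˣ) :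
    (blockUnit a b)⁻¹ = blockUnit a⁻¹ b⁻¹ := rfl

theorem unitsMap_blockUnit {C : Type*} [Ring C] (φ : C →+* B)
    (a : (Matrix ι ι C)ˣ) (b : (Matrix κ κ C)ˣ) :
    unitsMap (ι ⊕ κ) φ (blockUnit a b) = blockUnit (unitsMap ι φ a) (unitsMap κ φ b) :=
  Units.ext (by simp [blockUnit, fromBlocks_map])

/-- A unit as an invertible matrix of size one. -/
def scalarUnit : Bˣ →* (Matrix Unit Unit B)ˣ := Units.map (Matrix.scalar Unit).toMonoidHom

theorem unitsMap_scalarUnit {C : Type*} [Ring C] (φ : C →+* B) (c : Cˣ) :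
    unitsMap Unit φ (scalarUnit c) = scalarUnit (Units.map φ.toMonoidHom c) :=
  Units.ext (by simp [scalarUnit])

/-- The diagonal matrix with diagonal `(u, 1, …, 1)`. -/
def diagOne (κ : Type*) [Fintype κ] [DecidableEq κ] (u : Bˣ) :
    (Matrix (Unit ⊕ κ) (Unit ⊕ κ) B)ˣ :=
  blockUnit (scalarUnit u) 1

/-- Once the lower rows are (0 | 1), the inverse has zeros below its corner entry, so the two corner
entries are mutually inverse; one further transvection clears the first row. -/
theorem exists_mul_elementary_eq_diagOne [Finite B] (a : (Matrix (Unit ⊕ κ) (Unit ⊕ κ) B)ˣ) :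
    ∃ ε ∈ elementarySubgroup (Unit ⊕ κ) B, ∃ u : Bˣ, a * ε = diagOne κ u := by
  obtain ⟨ε, hε, h⟩ := exists_mul_elementary_eq_fromCols
    (U := (a : Matrix (Unit ⊕ κ) (Unit ⊕ κ) B).submatrix Sum.inr id)
    (V := ((a⁻¹ : (Matrix (Unit ⊕ κ) (Unit ⊕ κ) B)ˣ) :
      Matrix (Unit ⊕ κ) (Unit ⊕ κ) B).submatrix id Sum.inr) (by
      rw [← submatrix_mul _ _ _ _ _ Function.bijective_id, Units.mul_inv]
      ext i j
      simp [Matrix.one_apply])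
  let b := a * ε
  have hb : ∀ i, (b : Matrix (Unit ⊕ κ) (Unit ⊕ κ) B) (Sum.inr i) = Pi.single (Sum.inr i) 1 := by
    intro i
    have := congrFun h i
    ext j
    have h2 : (b : Matrix (Unit ⊕ κ) (Unit ⊕ κ) B) (Sum.inr i) j =
      (fromCols 0 1 : Matrix κ (Unit ⊕ κ) B) i j := congrFun this j
    rw [h2]
    rcases j with j | j
    · simp
    · rw [fromCols_apply_inr, Matrix.one_apply, Pi.single_apply]
      simp [eq_comm]
  set c : Matrix (Unit ⊕ κ) (Unit ⊕ κ) B := ↑b⁻¹ with hcdef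
  have hbc : (b : Matrix (Unit ⊕ κ) (Unit ⊕ κ) B) * c = 1 := Units.mul_inv b
  have hcb : c * (b : Matrix (Unit ⊕ κ) (Unit ⊕ κ) B) = 1 := Units.inv_mul b
  have hc : ∀ i, c (Sum.inr i) (Sum.inl ()) = 0 := by
    intro i
    have := congrFun (congrFun hbc (Sum.inr i)) (Sum.inl ())
    rw [Matrix.mul_apply_eq_vecMul, hb, single_one_vecMul] at this
    simpa [Matrix.one_apply] using this
  have h1 := congrFun (congrFun hbc (Sum.inl ())) (Sum.inl ())
  have h2 := congrFun (congrFun hcb (Sum.inl ())) (Sum.inl ())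
  simp only [Matrix.mul_apply, Fintype.sum_sum_type, hc, Finset.univ_unique,
    Finset.sum_singleton, Matrix.one_apply_eq, mul_zero, Finset.sum_const_zero, add_zero] at h1
  simp only [Matrix.mul_apply, Fintype.sum_sum_type, hb, Finset.univ_unique,
    Finset.sum_singleton, Matrix.one_apply_eq] at h2
  let u : Bˣ := ⟨(b : Matrix (Unit ⊕ κ) (Unit ⊕ κ) B) (Sum.inl ()) (Sum.inl ()),
    c (Sum.inl ()) (Sum.inl ()), h1, by simpa using h2⟩
  let y : Unit ⊕ κ → B :=
    Sum.elim 0 fun k => -(b : Matrix (Unit ⊕ κ) (Unit ⊕ κ) B) (Sum.inl ()) (Sum.inr k)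
  let τ := transvectionUnit (Pi.single (Sum.inl ()) ((u⁻¹ : Bˣ) : B)) y (by
    rintro (i | i)
    · right; rfl
    · left; simp)
  refine ⟨ε * τ, mul_mem hε (transvectionUnit_mem _ _ _), u, ?_⟩
  rw [← mul_assoc]
  refine Units.ext (Matrix.ext fun i j => ?_)
  have h3 : ∀ i, ((a * ε * τ : (Matrix (Unit ⊕ κ) (Unit ⊕ κ) B)ˣ) :
      Matrix (Unit ⊕ κ) (Unit ⊕ κ) B) i =
      (b : Matrix (Unit ⊕ κ) (Unit ⊕ κ) B) i ᵥ* (τ : Matrix (Unit ⊕ κ) (Unit ⊕ κ) B) :=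
    fun i => rfl
  rw [h3, vecMul_transvectionUnit]
  rcases i with ⟨⟩ | i
  · have hu : (b : Matrix (Unit ⊕ κ) (Unit ⊕ κ) B) (Sum.inl ()) (Sum.inl ()) = u := rfl
    rcases j with ⟨⟩ | j
    · simp [y, diagOne, blockUnit, scalarUnit, hu]
    · simp [y, diagOne, blockUnit, hu]
  · rw [hb]
    rcases j with ⟨⟩ | j
    · simp [diagOne, blockUnit]
    · simp [diagOne, blockUnit, Matrix.one_apply, Pi.single_apply, eq_comm]

/-- Whitehead's identity diag(u, u⁻¹) = w(u) w(-1), where w(c) = (0 c; -c⁻¹ 0) is a product of three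
transvections. -/
theorem blockUnit_scalarUnit_inv_mem (u : Bˣ) :
    blockUnit (scalarUnit u) (scalarUnit u⁻¹) ∈ elementarySubgroup (Unit ⊕ Unit) B := by
  let p (c : B) := transvectionUnit (Sum.elim (fun _ => c) 0 : Unit ⊕ Unit → B)
    (Sum.elim 0 (fun _ => 1)) (by rintro (i | i) <;> simp)
  let q (c : B) := transvectionUnit (Sum.elim 0 (fun _ => c) : Unit ⊕ Unit → B)
    (Sum.elim (fun _ => 1) 0) (by rintro (i | i) <;> simp)
  have hp : ∀ c, (p c : Matrix (Unit ⊕ Unit) (Unit ⊕ Unit) B) =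
      fromBlocks (scalar Unit 1) (scalar Unit c) (scalar Unit 0) (scalar Unit 1) := by
    intro c
    ext (i | i) (j | j) <;> simp [p, transvectionUnit, vecMulVec_apply]
  have hq : ∀ c, (q c : Matrix (Unit ⊕ Unit) (Unit ⊕ Unit) B) =
      fromBlocks (scalar Unit 1) (scalar Unit 0) (scalar Unit c) (scalar Unit 1) := by
    intro c
    ext (i | i) (j | j) <;> simp [q, transvectionUnit, vecMulVec_apply]
  have : blockUnit (scalarUnit u) (scalarUnit u⁻¹) =
      p u * q (-(u⁻¹ : Bˣ)) * p u * (p (-1) * q 1 * p (-1)) := by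
    refine Units.ext ?_
    simp only [Units.val_mul, hp, hq, fromBlocks_multiply, ← map_mul, ← map_add]
    have h0 : (0 : Matrix Unit Unit B) = scalar Unit 0 := (map_zero _).symm
    change fromBlocks (scalar Unit (u : B)) 0 0 (scalar Unit ((u⁻¹ : Bˣ) : B)) = _
    rw [h0]
    congr 2 <;> simp
  rw [this]
  exact mul_mem (mul_mem (mul_mem (transvectionUnit_mem _ _ _) (transvectionUnit_mem _ _ _))
    (transvectionUnit_mem _ _ _)) (mul_mem (mul_mem (transvectionUnit_mem _ _ _)
    (transvectionUnit_mem _ _ _)) (transvectionUnit_mem _ _ _))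

/-- Over a finite ring which is the target of two ring homomorphisms, one of them surjective,
invertible matrices are diagonal up to invertible matrices from the two sources. -/
theorem exists_eq_unitsMap_mul_diagOne_mul [Finite B] {B₁ B₂ : Type*} [Ring B₁] [Ring B₂]
    (φ₁ : B₁ →+* B) (φ₂ : B₂ →+* B)
    (h : Function.Surjective φ₁ ∨ Function.Surjective φ₂)
    (a : (Matrix (Unit ⊕ κ) (Unit ⊕ κ) B)ˣ) :
    ∃ (α : (Matrix (Unit ⊕ κ) (Unit ⊕ κ) B₁)ˣ) (β : (Matrix (Unit ⊕ κ) (Unit ⊕ κ) B₂)ˣ)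
      (u : Bˣ), a = unitsMap _ φ₁ α * diagOne κ u * unitsMap _ φ₂ β := by
  rcases h with h | h
  -- The reduction multiplies on the right, whereas matrices from the first source stand on the
  -- left; hence the inverse of a is reduced.
  · obtain ⟨ε, hε, u, hu⟩ := exists_mul_elementary_eq_diagOne a⁻¹
    obtain ⟨α, rfl⟩ := elementarySubgroup_le_range φ₁ h hε
    refine ⟨α, 1, u⁻¹, ?_⟩
    rw [map_one, mul_one]
    have : diagOne κ u⁻¹ = (diagOne κ u)⁻¹ := by
      rw [diagOne, diagOne, blockUnit_inv, inv_one, map_inv]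
    rw [this, ← hu]
    group
  · obtain ⟨ε, hε, u, hu⟩ := exists_mul_elementary_eq_diagOne a
    obtain ⟨β, rfl⟩ := elementarySubgroup_le_range φ₂ h hε
    refine ⟨1, β⁻¹, u, ?_⟩
    rw [map_one, one_mul, ← hu, map_inv]
    group

end ElementaryMatrices

end Orders

namespace Orders

/-! ### Extension of scalars and the induced map of class groups -/

section BaseChangeFunctor

variable {R : Type v} [CommRing R] {Λ : Type u} [Ring Λ] [Algebra R Λ]
variable {Γ : Type u} [Ring Γ] [Algebra R Γ] (f : Λ →ₐ[R] Γ)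
variable {X : Type u} [AddCommGroup X] [Module R X] [Module Λ X] [IsScalarTower R Λ X]
variable {Y : Type u} [AddCommGroup Y] [Module R Y] [Module Λ Y] [IsScalarTower R Λ Y]
variable {Z : Type u} [AddCommGroup Z] [Module R Z] [Module Λ Z] [IsScalarTower R Λ Z]
variable {N : Type*} [AddCommGroup N] [Module R N] [Module Γ N] [IsScalarTower R Γ N]

namespace BaseChange

variable (X) in
/-- The canonical map `X → Γ ⊗_Λ X`, `x ↦ 1 ⊗ x`. -/
def of : X →+ BaseChange f X where
  toFun x := Submodule.Quotient.mk ((1 : Γ) ⊗ₜ[R] x)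
  map_zero' := by rw [TensorProduct.tmul_zero, Submodule.Quotient.mk_zero]
  map_add' x y := by rw [TensorProduct.tmul_add, Submodule.Quotient.mk_add]

theorem smul_of (a : Γ) (x : X) :
    a • of f X x = Submodule.Quotient.mk (a ⊗ₜ[R] x) := by
  change a • (Submodule.Quotient.mk ((1 : Γ) ⊗ₜ[R] x) : BaseChange f X) = _
  rw [← Submodule.Quotient.mk_smul, TensorProduct.smul_tmul', smul_eq_mul, mul_one]

theorem of_smul (b : Λ) (x : X) : of f X (b • x) = f b • of f X x := by
  rw [smul_of, eq_comm]
  change _ = Submodule.Quotient.mk ((1 : Γ) ⊗ₜ[R] (b • x))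
  rw [Submodule.Quotient.eq]
  refine Submodule.subset_span ⟨1, b, x, ?_⟩
  rw [one_mul]

variable {f} in
theorem induction_on {P : BaseChange f X → Prop} (z : BaseChange f X) (h0 : P 0)
    (h : ∀ (a : Γ) (x : X), P (a • of f X x)) (hadd : ∀ z z', P z → P z' → P (z + z')) : P z := by
  obtain ⟨t, rfl⟩ := Submodule.Quotient.mk_surjective _ z
  induction t using TensorProduct.induction_on with
  | zero => exact h0
  | tmul a x => rw [← smul_of]; exact h a x
  | add s t hs ht => rw [Submodule.Quotient.mk_add]; exact hadd _ _ hs ht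

variable {f} in
theorem hom_ext {N : Type*} [AddCommGroup N] [Module Γ N] {g h : BaseChange f X →ₗ[Γ] N}
    (H : ∀ x, g (of f X x) = h (of f X x)) : g = h := by
  refine LinearMap.ext fun z => ?_
  induction z using induction_on with
  | h0 => rw [map_zero, map_zero]
  | h a x => rw [map_smul, map_smul, H]
  | hadd z z' hz hz' => rw [map_add, map_add, hz, hz']

/-- The universal property of extension of scalars. -/
def lift (φ : X →+ N) (hφ : ∀ (b : Λ) x, φ (b • x) = f b • φ x) : BaseChange f X →ₗ[Γ] N :=
  Submodule.liftQ _ (TensorProduct.AlgebraTensorModule.lift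
    (LinearMap.toSpanSingleton Γ (X →ₗ[R] N)
      { toFun := φ
        map_add' := map_add φ
        map_smul' := fun r x => by
          rw [← algebraMap_smul Λ r x, hφ, AlgHom.commutes, algebraMap_smul, RingHom.id_apply] }))
    (by
      rw [Submodule.span_le]
      rintro _ ⟨a, b, x, rfl⟩
      simp [hφ, mul_smul])

@[simp]
theorem lift_of (φ : X →+ N) (hφ : ∀ (b : Λ) x, φ (b • x) = f b • φ x) (x : X) :
    lift f φ hφ (of f X x) = φ x := by
  change Submodule.liftQ _ _ _ (Submodule.Quotient.mk ((1 : Γ) ⊗ₜ[R] x)) = _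
  rw [Submodule.liftQ_apply]
  simp

/-- Functoriality of extension of scalars. -/
def map (h : X →ₗ[Λ] Y) : BaseChange f X →ₗ[Γ] BaseChange f Y :=
  lift f ((of f Y).comp h.toAddMonoidHom) fun b x => by
    simp [of_smul]

@[simp]
theorem map_of (h : X →ₗ[Λ] Y) (x : X) : map f h (of f X x) = of f Y (h x) :=
  lift_of f _ _ x

theorem map_comp (g : Y →ₗ[Λ] Z) (h : X →ₗ[Λ] Y) : map f (g ∘ₗ h) = map f g ∘ₗ map f h :=
  hom_ext fun x => by simp

theorem map_id : map f (LinearMap.id : X →ₗ[Λ] X) = LinearMap.id :=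
  hom_ext fun x => by simp

theorem of_base_smul (r : R) (x : X) : of f X (r • x) = r • of f X x := by
  rw [← algebraMap_smul Λ r x, of_smul, AlgHom.commutes, algebraMap_smul]

theorem map_apply_of_forall_eq_smul {h : X →ₗ[Λ] X} {s : R} (hs : ∀ x, h x = s • x)
    (z : BaseChange f X) : map f h z = s • z := by
  induction z using induction_on with
  | h0 => rw [map_zero, smul_zero]
  | h a x => rw [map_smul, map_of, hs, of_base_smul, smul_comm]
  | hadd z z' hz hz' => rw [map_add, hz, hz', smul_add]

/-- Extension of scalars of an isomorphism. -/
def congr (e : X ≃ₗ[Λ] Y) : BaseChange f X ≃ₗ[Γ] BaseChange f Y :=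
  LinearEquiv.ofLinearMap (map f e.toLinearMap) (map f e.symm.toLinearMap)
    (by rw [← map_comp]; exact hom_ext fun x => by simp)
    (by rw [← map_comp]; exact hom_ext fun x => by simp)

variable (X Y) in
/-- Extension of scalars commutes with direct sums. -/
def prodEquiv : BaseChange f (X × Y) ≃ₗ[Γ] BaseChange f X × BaseChange f Y :=
  LinearEquiv.ofLinearMap
    ((map f (LinearMap.fst Λ X Y)).prod (map f (LinearMap.snd Λ X Y)))
    ((map f (LinearMap.inl Λ X Y)).coprod (map f (LinearMap.inr Λ X Y)))
    (by
      refine LinearMap.prod_ext (hom_ext fun x => ?_) (hom_ext fun x => ?_) <;> simp)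
    (hom_ext fun x => by simp [← map_add])

/-- Extension of scalars of a free module. -/
def piEquiv (ι : Type) [Fintype ι] [DecidableEq ι] : BaseChange f (ι → Λ) ≃ₗ[Γ] (ι → Γ) :=
  LinearEquiv.ofLinearMap
    (lift f (f.toRingHom.toAddMonoidHom.compLeft ι) fun b x => by
      ext i
      simp)
    (Fintype.linearCombination Γ fun i => of f (ι → Λ) (Pi.single i 1))
    (by
      refine LinearMap.pi_ext' fun i => LinearMap.ext_ring ?_
      ext j
      simp [Fintype.linearCombination_apply, Pi.single_apply, apply_ite f])
    (hom_ext fun x => by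
      simp only [LinearMap.comp_apply, lift_of, Fintype.linearCombination_apply, LinearMap.id_apply]
      change ∑ i, f (x i) • _ = _
      simp only [← of_smul, ← map_sum]
      congr 1
      ext j
      simp [Finset.sum_apply, Pi.single_apply])

@[simp]
theorem piEquiv_of (ι : Type) [Fintype ι] [DecidableEq ι] (x : ι → Λ) (i : ι) :
    piEquiv f ι (of f (ι → Λ) x) i = f (x i) := by
  exact congrFun (lift_of f (N := ι → Γ) (f.toRingHom.toAddMonoidHom.compLeft ι)
    (fun b x => by ext i; simp) x) i

/-- Extension of scalars of the ring itself. -/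
def selfEquiv : BaseChange f Λ ≃ₗ[Γ] Γ :=
  LinearEquiv.ofLinearMap
    (lift f f.toRingHom.toAddMonoidHom fun b x => by simp)
    (LinearMap.toSpanSingleton Γ _ (of f Λ 1))
    (LinearMap.ext_ring (by simp))
    (hom_ext fun x => by
      simp only [LinearMap.comp_apply, lift_of]
      change f x • of f Λ 1 = of f Λ x
      rw [← of_smul, smul_eq_mul, mul_one])

end BaseChange

theorem InvertibleAt.of_equiv {Γ : Type*} [Ring Γ] [Algebra R Γ] {X Y : Type*}
    [AddCommGroup X] [Module R X] [Module Γ X] [IsScalarTower R Γ X]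
    [AddCommGroup Y] [Module R Y] [Module Γ Y] [IsScalarTower R Γ Y]
    (p : Ideal R) [p.IsPrime] (e : X ≃ₗ[Γ] Y) : InvertibleAt p e.toLinearMap :=
  ⟨1, fun h => Ideal.IsPrime.one_notMem inferInstance h, e.symm.toLinearMap, fun x => by simp,
    fun y => by simp⟩

variable {f} in
theorem InvertibleAt.baseChange {p : Ideal R} {h : X →ₗ[Λ] Y} (hh : InvertibleAt p h) :
    InvertibleAt p (BaseChange.map f h) := by
  obtain ⟨s, hs, k, h1, h2⟩ := hh
  refine ⟨s, hs, BaseChange.map f k, fun z => ?_, fun z => ?_⟩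
  · rw [← LinearMap.comp_apply, ← BaseChange.map_comp]
    exact BaseChange.map_apply_of_forall_eq_smul f (fun x => by simp [h1]) z
  · rw [← LinearMap.comp_apply, ← BaseChange.map_comp]
    exact BaseChange.map_apply_of_forall_eq_smul f (fun x => by simp [h2]) z

/-- A local isomorphism is replaced by a global map invertible up to a scalar outside p.
Functoriality preserves such maps, so localisation never has to be commuted with extension of
scalars. -/
theorem IsLocallyFree.baseChange [IsNoetherianRing R] [Module.Finite R Λ] [Module.Finite R Γ]
    {n : ℕ} (hX : IsLocallyFree R Λ n X) : IsLocallyFree R Γ n (BaseChange f X) where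
  finite := by
    have := hX.finite
    infer_instance
  locallyIso p _ := by
    have := hX.finite
    obtain ⟨h, hh⟩ := (hX.locallyIso p).exists_invertibleAt
    exact ((InvertibleAt.of_equiv p (BaseChange.piEquiv f (Fin n))).comp
      hh.baseChange).locallyIsoAt

variable [IsDedekindDomain R] [Module.Finite R Λ] [Module.Finite R Γ]

/-- The homomorphism of class groups induced by extension of scalars. -/
noncomputable def classGroupMap : LocallyFreeClassGroup R Λ →+ LocallyFreeClassGroup R Γ where
  toFun := Quotient.map
    (fun X => { carrier := BaseChange f X.carrier, isLocallyFree := X.isLocallyFree.baseChange f })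
    (by
      rintro X Y ⟨m, ⟨e⟩⟩
      exact ⟨m, ⟨((LinearEquiv.refl Γ _).prodCongr (BaseChange.piEquiv f (Fin m)).symm).trans <|
        (BaseChange.prodEquiv f X.carrier (Fin m → Λ)).symm.trans <| (BaseChange.congr f e).trans <|
        (BaseChange.prodEquiv f Y.carrier (Fin m → Λ)).trans <|
        (LinearEquiv.refl Γ _).prodCongr (BaseChange.piEquiv f (Fin m))⟩⟩)
  map_zero' := by
    refine PrincipalGenus.sound 0 ?_
    rw [zero_smul, zero_add, zero_add]
    exact (isoClass_eq_iff Γ).mpr ⟨BaseChange.selfEquiv f⟩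
  map_add' := by
    rintro ⟨X⟩ ⟨Y⟩
    obtain ⟨e⟩ := (isoClass_eq_iff Λ).mp (PrincipalGenus.isoClass_sum X Y)
    exact (LocallyFreeClassGroup.mk_add_mk (X.isLocallyFree.baseChange f)
      (Y.isLocallyFree.baseChange f) ((X.sum Y).isLocallyFree.baseChange f)
      ((BaseChange.prodEquiv f X.carrier Y.carrier).symm.trans <| (BaseChange.congr f e).trans <|
        (BaseChange.prodEquiv f Λ (X.sum Y).carrier).trans <|
        (BaseChange.selfEquiv f).prodCongr (LinearEquiv.refl Γ _))).symm

end BaseChangeFunctor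

end Orders

namespace Orders

/-! ### Maps inverse to each other up to a scalar congruent to 1 -/

section CoprimePairs

variable {R : Type v} [CommRing R] {Λ : Type u} [Ring Λ] [Algebra R Λ]
variable {X : Type*} [AddCommGroup X] [Module R X] [Module Λ X] [IsScalarTower R Λ X]
variable {Y : Type*} [AddCommGroup Y] [Module R Y] [Module Λ Y] [IsScalarTower R Λ Y]

/-- Homomorphisms in opposite directions which are inverse to each other up to a nonzero scalar
`s ≡ 1 mod r`. -/
structure CoprimePair (r : R) (f : X →ₗ[Λ] Y) (h : Y →ₗ[Λ] X) (s : R) : Prop where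
  ne_zero : s ≠ 0
  dvd_sub_one : r ∣ s - 1
  left : ∀ x, h (f x) = s • x
  right : ∀ y, f (h y) = s • y

theorem CoprimePair.injective {Λ X Y : Type*} [Ring Λ] [AddCommGroup X] [Module R X] [Module Λ X]
    [AddCommGroup Y] [Module R Y] [Module Λ Y] [IsDomain R] [Module.IsTorsionFree R X] {r : R} {f : X →ₗ[Λ] Y}
    {h : Y →ₗ[Λ] X} {s : R} (H : CoprimePair r f h s) : Function.Injective f := by
  rw [injective_iff_map_eq_zero]
  intro x hx
  have := H.left x
  rw [hx, map_zero, eq_comm, smul_eq_zero] at this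
  exact this.resolve_left H.ne_zero

theorem CoprimePair.symm {Λ X Y : Type*} [Ring Λ] [AddCommGroup X] [Module R X] [Module Λ X]
    [AddCommGroup Y] [Module R Y] [Module Λ Y] {r : R} {f : X →ₗ[Λ] Y} {h : Y →ₗ[Λ] X} {s : R}
    (H : CoprimePair r f h s) : CoprimePair r h f s :=
  ⟨H.ne_zero, H.dvd_sub_one, H.right, H.left⟩

/-- Rescaling serves to give two pairs, one over each factor of the fibre product, the same scalar.
-/
theorem CoprimePair.smul [IsDomain R] {r : R} {f : X →ₗ[Λ] Y} {h : Y →ₗ[Λ] X} {s t : R}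
    (H : CoprimePair r f h s) (ht : t ≠ 0) (hrt : r ∣ t - 1) :
    CoprimePair r f (t • h) (t * s) := by
  refine ⟨mul_ne_zero ht H.ne_zero, ?_, fun x => ?_, fun y => ?_⟩
  · have : t * s - 1 = t * (s - 1) + (t - 1) := by ring
    rw [this]
    exact dvd_add (H.dvd_sub_one.mul_left t) hrt
  · rw [LinearMap.smul_apply, H.left, mul_smul]
  · rw [LinearMap.smul_apply, smul_map, H.right, mul_smul]

theorem CoprimePair.baseChange {Λ Γ : Type u} [Ring Λ] [Algebra R Λ] [Ring Γ] [Algebra R Γ]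
    {X : Type u} [AddCommGroup X] [Module R X] [Module Λ X] [IsScalarTower R Λ X]
    {Y : Type u} [AddCommGroup Y] [Module R Y] [Module Λ Y] [IsScalarTower R Λ Y]
    (φ : Λ →ₐ[R] Γ) {r : R} {f : X →ₗ[Λ] Y}
    {h : Y →ₗ[Λ] X} {s : R} (H : CoprimePair r f h s) :
    CoprimePair r (BaseChange.map φ f) (BaseChange.map φ h) s := by
  refine ⟨H.ne_zero, H.dvd_sub_one, fun z => ?_, fun z => ?_⟩
  · rw [← LinearMap.comp_apply, ← BaseChange.map_comp]
    exact BaseChange.map_apply_of_forall_eq_smul φ (fun x => by simp [H.left]) z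
  · rw [← LinearMap.comp_apply, ← BaseChange.map_comp]
    exact BaseChange.map_apply_of_forall_eq_smul φ (fun x => by simp [H.right]) z

/-- A homomorphism invertible at all maximal ideals containing `r`, and at one further maximal
ideal, is part of a coprime pair. -/
theorem exists_coprimePair_of_invertibleAt {r : R} {f : X →ₗ[Λ] Y}
    (hf : ∀ p : MaximalSpectrum R, r ∈ p.asIdeal → InvertibleAt p.asIdeal f)
    (p₀ : MaximalSpectrum R) (hp₀ : InvertibleAt p₀.asIdeal f) :
    ∃ h s, CoprimePair r f h s := by
  let I : Ideal R :=
    { carrier := {s | ∃ h : Y →ₗ[Λ] X, (∀ x, h (f x) = s • x) ∧ ∀ y, f (h y) = s • y}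
      add_mem' := by
        rintro a b ⟨k, hk, hk'⟩ ⟨l, hl, hl'⟩
        exact ⟨k + l, fun x => by rw [LinearMap.add_apply, hk, hl, add_smul],
          fun y => by rw [LinearMap.add_apply, map_add, hk', hl', add_smul]⟩
      zero_mem' := ⟨0, fun x => by simp, fun y => by simp⟩
      smul_mem' := by
        rintro c a ⟨k, hk, hk'⟩
        exact ⟨c • k, fun x => by rw [LinearMap.smul_apply, hk, smul_smul, smul_eq_mul],
          fun y => by rw [LinearMap.smul_apply, smul_map, hk', smul_smul, smul_eq_mul]⟩ }
  -- I is the ideal of scalars up to which f has an inverse. It is not contained in any maximal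
  -- ideal containing r, so it contains an element congruent to 1 modulo r.
  have hI : I ⊔ Ideal.span {r} = ⊤ := by
    by_contra hne
    obtain ⟨p, hp, hle⟩ := Ideal.exists_le_maximal _ hne
    obtain ⟨s, hs, h, h1, h2⟩ := hf ⟨p, hp⟩ (hle (Ideal.mem_sup_right
      (Ideal.mem_span_singleton_self r)))
    exact hs (hle (Ideal.mem_sup_left ⟨h, h1, h2⟩))
  obtain ⟨s, hs, t, ht, hst⟩ := Submodule.mem_sup.mp (hI ▸ trivial : (1 : R) ∈ I ⊔ Ideal.span {r})
  rw [Ideal.mem_span_singleton] at ht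
  have hdvd : r ∣ s - 1 := by
    rw [← hst, sub_add_cancel_left]
    exact ht.neg_right
  -- If the element found is 0, then r is a unit and the congruence is void; the further maximal
  -- ideal supplies a nonzero scalar.
  by_cases h0 : s = 0
  · obtain ⟨s₀, hs₀, h, h1, h2⟩ := hp₀
    refine ⟨h, s₀, fun h => hs₀ (h ▸ Ideal.zero_mem _), ?_, h1, h2⟩
    rw [h0, zero_add] at hst
    exact (isUnit_of_dvd_one (hst ▸ ht)).dvd
  · obtain ⟨h, h1, h2⟩ := hs
    exact ⟨h, s, h0, hdvd, h1, h2⟩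

theorem exists_coprimePair [IsDedekindDomain R] [Module.Finite R Λ] [Module.Finite R X]
    [Module.Finite R Y] {r : R} (hr : r ≠ 0)
    (H : ∀ p : MaximalSpectrum R, LocallyIsoAt R Λ p.asIdeal X Y) :
    ∃ (f : X →ₗ[Λ] Y) (h : Y →ₗ[Λ] X) (s : R), CoprimePair r f h s := by
  classical
  obtain ⟨p₀, hp₀⟩ := Ideal.exists_maximal R
  obtain ⟨f, hf⟩ := exists_invertibleAt_finset
    (insert ⟨p₀, hp₀⟩ (finite_maximal_containing hr).toFinset) H
  obtain ⟨h, s, hs⟩ := exists_coprimePair_of_invertibleAt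
    (fun p hp => hf p (Finset.mem_insert_of_mem (by simpa using hp))) ⟨p₀, hp₀⟩
    (hf _ (Finset.mem_insert_self _ _))
  exact ⟨f, h, s, hs⟩

/-- A homomorphism with an inverse modulo `r` is invertible at the primes containing `r`. -/
theorem invertibleAt_of_inverse_mod [Module.Finite R X] [Module.Finite R Y] {r : R}
    {f : X →ₗ[Λ] Y} {h : Y →ₗ[Λ] X} (h1 : ∀ x, ∃ x', h (f x) = x + r • x')
    (h2 : ∀ y, ∃ y', f (h y) = y + r • y') {p : Ideal R} [p.IsPrime] (hp : r ∈ p) :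
    InvertibleAt p f := by
  obtain ⟨t, ht, k, k1, -⟩ := exists_inverse_of_congr p (f ∘ₗ h) 1 (Ideal.IsPrime.one_notMem ‹_›)
    (fun y => by
      obtain ⟨y', hy'⟩ := h2 y
      rw [one_smul, LinearMap.comp_apply, hy', add_sub_cancel_left]
      exact Submodule.smul_mem_smul hp trivial)
  obtain ⟨t', ht', k', -, k2⟩ := exists_inverse_of_congr p (h ∘ₗ f) 1
    (Ideal.IsPrime.one_notMem ‹_›) (fun x => by
      obtain ⟨x', hx'⟩ := h1 x
      rw [one_smul, LinearMap.comp_apply, hx', add_sub_cancel_left]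
      exact Submodule.smul_mem_smul hp trivial)
  have e1 : ∀ y, f (h (k y)) = t • y := k1
  have e2 : ∀ x, k' (h (f x)) = t' • x := k2
  refine ⟨t * t', fun hst => (Ideal.IsPrime.mem_or_mem ‹_› hst).elim ht ht', t' • (h ∘ₗ k),
    fun x => ?_, fun y => ?_⟩
  · rw [LinearMap.smul_apply, LinearMap.comp_apply, ← e2, e1, smul_map, smul_map, e2, smul_smul]
  · rw [LinearMap.smul_apply, LinearMap.comp_apply, smul_map, e1, smul_smul, mul_comm]

end CoprimePairs

/-! ### Patching modules over the fibre product -/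

section Patching

variable {R : Type v} [CommRing R] {Λ Λ₁ Λ₂ : Type u} {Λbar : Type w}
  [Ring Λ] [Ring Λ₁] [Ring Λ₂] [Ring Λbar]
  [Algebra R Λ] [Algebra R Λ₁] [Algebra R Λ₂] [Algebra R Λbar]

/-- The fibre product with the two factors exchanged. -/
def FibreProduct.swap (S : FibreProduct R Λ Λ₁ Λ₂ Λbar) : FibreProduct R Λ Λ₂ Λ₁ Λbar where
  π₁ := S.π₂
  π₂ := S.π₁
  g₁ := S.g₂
  g₂ := S.g₁
  comm x := (S.comm x).symm
  existsUnique x₁ x₂ h := by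
    obtain ⟨x, hx, huniq⟩ := S.existsUnique x₂ x₁ h.symm
    exact ⟨x, hx.symm, fun y hy => huniq y hy.symm⟩

theorem FibreProduct.ext_of (S : FibreProduct R Λ Λ₁ Λ₂ Λbar) {x y : Λ} (h₁ : S.π₁ x = S.π₁ y)
    (h₂ : S.π₂ x = S.π₂ y) : x = y :=
  (S.existsUnique (S.π₁ y) (S.π₂ y) (S.comm y)).unique ⟨h₁, h₂⟩ ⟨rfl, rfl⟩

section Basic

variable {X : Type*} [AddCommGroup X] [Module Λ X] {X' : Type*} [AddCommGroup X'] [Module Λ X']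
variable {X₁ : Type*} [AddCommGroup X₁] [Module Λ₁ X₁]
  {X₁' : Type*} [AddCommGroup X₁'] [Module Λ₁ X₁']
variable {X₂ : Type*} [AddCommGroup X₂] [Module Λ₂ X₂]
  {X₂' : Type*} [AddCommGroup X₂'] [Module Λ₂ X₂']
variable {T T' : Type*}

/-- `X` is the pullback of the modules `X₁` and `X₂` along the maps `k₁`, `k₂`. -/
structure IsPatched (S : FibreProduct R Λ Λ₁ Λ₂ Λbar) (p₁ : X →+ X₁) (p₂ : X →+ X₂)
    (k₁ : X₁ → T) (k₂ : X₂ → T) : Prop where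
  map_smul₁ : ∀ (a : Λ) x, p₁ (a • x) = S.π₁ a • p₁ x
  map_smul₂ : ∀ (a : Λ) x, p₂ (a • x) = S.π₂ a • p₂ x
  eq_zero : ∀ x, p₁ x = 0 → p₂ x = 0 → x = 0
  exists_iff : ∀ x₁ x₂, k₁ x₁ = k₂ x₂ ↔ ∃ x, p₁ x = x₁ ∧ p₂ x = x₂

namespace IsPatched

variable {S : FibreProduct R Λ Λ₁ Λ₂ Λbar} {p₁ : X →+ X₁} {p₂ : X →+ X₂}
  {k₁ : X₁ → T} {k₂ : X₂ → T}

theorem swap (H : IsPatched S p₁ p₂ k₁ k₂) : IsPatched S.swap p₂ p₁ k₂ k₁ where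
  map_smul₁ := H.map_smul₂
  map_smul₂ := H.map_smul₁
  eq_zero x h h' := H.eq_zero x h' h
  exists_iff x₁ x₂ := by
    rw [eq_comm, H.exists_iff]
    simp only [and_comm]

theorem ext (H : IsPatched S p₁ p₂ k₁ k₂) {x y : X} (h₁ : p₁ x = p₁ y) (h₂ : p₂ x = p₂ y) :
    x = y :=
  sub_eq_zero.mp (H.eq_zero _ (by rw [map_sub, h₁, sub_self]) (by rw [map_sub, h₂, sub_self]))

/-- The universal property of the pullback. -/
theorem exists_lift (H : IsPatched S p₁ p₂ k₁ k₂) {Y : Type*} [AddCommGroup Y] [Module Λ Y]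
    (q₁ : Y →+ X₁) (q₂ : Y →+ X₂) (hq₁ : ∀ (a : Λ) y, q₁ (a • y) = S.π₁ a • q₁ y)
    (hq₂ : ∀ (a : Λ) y, q₂ (a • y) = S.π₂ a • q₂ y) (hq : ∀ y, k₁ (q₁ y) = k₂ (q₂ y)) :
    ∃ l : Y →ₗ[Λ] X, ∀ y, p₁ (l y) = q₁ y ∧ p₂ (l y) = q₂ y := by
  choose l hl using fun y => (H.exists_iff _ _).mp (hq y)
  refine ⟨{ toFun := l, map_add' := fun x y => H.ext ?_ ?_, map_smul' := fun a x => H.ext ?_ ?_ },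
    hl⟩
  · rw [map_add, (hl _).1, (hl _).1, (hl _).1, map_add]
  · rw [map_add, (hl _).2, (hl _).2, (hl _).2, map_add]
  · rw [RingHom.id_apply, H.map_smul₁, (hl _).1, (hl _).1, hq₁]
  · rw [RingHom.id_apply, H.map_smul₂, (hl _).2, (hl _).2, hq₂]

/-- Isomorphisms between the constituents which respect the gluing conditions induce an
isomorphism of pullbacks. -/
theorem nonempty_equiv (H : IsPatched S p₁ p₂ k₁ k₂) {p₁' : X' →+ X₁'} {p₂' : X' →+ X₂'}
    {k₁' : X₁' → T'} {k₂' : X₂' → T'} (H' : IsPatched S p₁' p₂' k₁' k₂')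
    (e₁ : X₁ ≃ₗ[Λ₁] X₁') (e₂ : X₂ ≃ₗ[Λ₂] X₂')
    (he : ∀ x₁ x₂, k₁ x₁ = k₂ x₂ ↔ k₁' (e₁ x₁) = k₂' (e₂ x₂)) : Nonempty (X ≃ₗ[Λ] X') := by
  obtain ⟨l, hl⟩ := H'.exists_lift (e₁.toLinearMap.toAddMonoidHom.comp p₁)
    (e₂.toLinearMap.toAddMonoidHom.comp p₂) (fun a y => by simp [H.map_smul₁])
    (fun a y => by simp [H.map_smul₂]) (fun y => (he _ _).mp ((H.exists_iff _ _).mpr ⟨y, rfl, rfl⟩))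
  obtain ⟨m, hm⟩ := H.exists_lift (e₁.symm.toLinearMap.toAddMonoidHom.comp p₁')
    (e₂.symm.toLinearMap.toAddMonoidHom.comp p₂') (fun a y => by simp [H'.map_smul₁])
    (fun a y => by simp [H'.map_smul₂]) (fun y => (he _ _).mpr (by
      simpa using (H'.exists_iff _ _).mpr ⟨y, rfl, rfl⟩))
  refine ⟨LinearEquiv.ofLinearMap l m (LinearMap.ext fun x => H'.ext ?_ ?_)
    (LinearMap.ext fun x => H.ext ?_ ?_)⟩
  · simp [(hl _).1, (hm _).1]
  · simp [(hl _).2, (hm _).2]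
  · simp [(hl _).1, (hm _).1]
  · simp [(hl _).2, (hm _).2]

theorem self (S : FibreProduct R Λ Λ₁ Λ₂ Λbar) :
    IsPatched S S.π₁.toRingHom.toAddMonoidHom S.π₂.toRingHom.toAddMonoidHom S.g₁ S.g₂ where
  map_smul₁ a x := map_mul S.π₁ a x
  map_smul₂ a x := map_mul S.π₂ a x
  eq_zero x h₁ h₂ := S.ext_of (h₁.trans (map_zero _).symm) (h₂.trans (map_zero _).symm)
  exists_iff x₁ x₂ := by
    constructor
    · exact fun h => (S.existsUnique x₁ x₂ h).exists
    · rintro ⟨x, rfl, rfl⟩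
      exact S.comm x

theorem prod (H : IsPatched S p₁ p₂ k₁ k₂) {p₁' : X' →+ X₁'} {p₂' : X' →+ X₂'}
    {k₁' : X₁' → T'} {k₂' : X₂' → T'} (H' : IsPatched S p₁' p₂' k₁' k₂') :
    IsPatched S (p₁.prodMap p₁') (p₂.prodMap p₂') (Prod.map k₁ k₁') (Prod.map k₂ k₂') where
  map_smul₁ a x := Prod.ext (H.map_smul₁ a x.1) (H'.map_smul₁ a x.2)
  map_smul₂ a x := Prod.ext (H.map_smul₂ a x.1) (H'.map_smul₂ a x.2)
  eq_zero x h h' := Prod.ext (H.eq_zero _ (congrArg Prod.fst h) (congrArg Prod.fst h'))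
    (H'.eq_zero _ (congrArg Prod.snd h) (congrArg Prod.snd h'))
  exists_iff x₁ x₂ := by
    rw [Prod.ext_iff]
    simp only [Prod.map_fst, Prod.map_snd, H.exists_iff, H'.exists_iff]
    constructor
    · rintro ⟨⟨x, h₁, h₂⟩, y, h₃, h₄⟩
      exact ⟨(x, y), Prod.ext h₁ h₃, Prod.ext h₂ h₄⟩
    · rintro ⟨⟨x, y⟩, rfl, rfl⟩
      exact ⟨⟨x, rfl, rfl⟩, y, rfl, rfl⟩

theorem pi (S : FibreProduct R Λ Λ₁ Λ₂ Λbar) (ι : Type*) :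
    IsPatched S (S.π₁.toRingHom.toAddMonoidHom.compLeft ι)
      (S.π₂.toRingHom.toAddMonoidHom.compLeft ι) (fun x i => S.g₁ (x i))
      (fun x i => S.g₂ (x i)) where
  map_smul₁ a x := funext fun i => map_mul S.π₁ a (x i)
  map_smul₂ a x := funext fun i => map_mul S.π₂ a (x i)
  eq_zero x h h' := funext fun i => (IsPatched.self S).eq_zero _ (congrFun h i) (congrFun h' i)
  exists_iff x₁ x₂ := by
    constructor
    · intro h
      choose x hx using fun i => ((IsPatched.self S).exists_iff _ _).mp (congrFun h i)
      exact ⟨x, funext fun i => (hx i).1, funext fun i => (hx i).2⟩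
    · rintro ⟨x, rfl, rfl⟩
      exact funext fun i => S.comm (x i)

end IsPatched

end Basic

variable {X : Type*} [AddCommGroup X] [Module R X] [Module Λ X] [IsScalarTower R Λ X]
variable {X₁ : Type*} [AddCommGroup X₁] [Module R X₁] [Module Λ₁ X₁] [IsScalarTower R Λ₁ X₁]
variable {X₂ : Type*} [AddCommGroup X₂] [Module R X₂] [Module Λ₂ X₂] [IsScalarTower R Λ₂ X₂]
variable {S : FibreProduct R Λ Λ₁ Λ₂ Λbar} {p₁ : X →+ X₁} {p₂ : X →+ X₂}
  {T : Type*} {k₁ : X₁ → T} {k₂ : X₂ → T}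

namespace IsPatched

theorem map_base_smul₁ {X₂ : Type*} [AddCommGroup X₂] [Module Λ₂ X₂] {p₂ : X →+ X₂} {k₂ : X₂ → T}
    (H : IsPatched S p₁ p₂ k₁ k₂) (r : R) (x : X) : p₁ (r • x) = r • p₁ x := by
  rw [← algebraMap_smul Λ r x, H.map_smul₁, AlgHom.commutes, algebraMap_smul]

theorem map_base_smul₂ {X₁ : Type*} [AddCommGroup X₁] [Module Λ₁ X₁] {p₁ : X →+ X₁} {k₁ : X₁ → T}
    (H : IsPatched S p₁ p₂ k₁ k₂) (r : R) (x : X) : p₂ (r • x) = r • p₂ x :=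
  H.swap.map_base_smul₁ r x

theorem finite [IsNoetherianRing R] [Module.Finite R X₁] [Module.Finite R X₂]
    (H : IsPatched S p₁ p₂ k₁ k₂) : Module.Finite R X := by
  let F : X →ₗ[R] X₁ × X₂ :=
    { toFun := fun x => (p₁ x, p₂ x)
      map_add' := fun x y => by simp
      map_smul' := fun r x => by simp [H.map_base_smul₁, H.map_base_smul₂] }
  exact Module.Finite.of_injective F fun x y h => H.ext (congrArg Prod.fst h) (congrArg Prod.snd h)

variable {r s : R} {f₁ : Λ₁ →ₗ[Λ₁] X₁} {h₁ : X₁ →ₗ[Λ₁] Λ₁} {f₂ : Λ₂ →ₗ[Λ₂] X₂}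
  {h₂ : X₂ →ₗ[Λ₂] Λ₂}

/-- The gluing maps factor through h₁ and h₂, and both composites hᵢ fᵢ are multiplication by the
same s. The two pairs therefore respect the gluing conditions and patch componentwise. -/
theorem exists_coprimePair (H : IsPatched S p₁ p₂ (fun x => S.g₁ (h₁ x)) (fun x => S.g₂ (h₂ x)))
    (H₁ : CoprimePair r f₁ h₁ s) (H₂ : CoprimePair r f₂ h₂ s) :
    ∃ (f : Λ →ₗ[Λ] X) (h : X →ₗ[Λ] Λ), CoprimePair r f h s ∧
      (∀ a, p₁ (f a) = f₁ (S.π₁ a)) ∧ (∀ a, p₂ (f a) = f₂ (S.π₂ a)) := by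
  obtain ⟨f, hf⟩ := H.exists_lift
    (f₁.toAddMonoidHom.comp S.π₁.toRingHom.toAddMonoidHom)
    (f₂.toAddMonoidHom.comp S.π₂.toRingHom.toAddMonoidHom)
    (fun a y => by
      change f₁ (S.π₁ (a * y)) = S.π₁ a • f₁ (S.π₁ y)
      rw [map_mul, ← smul_eq_mul, map_smul])
    (fun a y => by
      change f₂ (S.π₂ (a * y)) = S.π₂ a • f₂ (S.π₂ y)
      rw [map_mul, ← smul_eq_mul, map_smul])
    (fun y => by
      change S.g₁ (h₁ (f₁ (S.π₁ y))) = S.g₂ (h₂ (f₂ (S.π₂ y)))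
      rw [H₁.left, H₂.left, map_smul, map_smul, S.comm])
  obtain ⟨h, hh⟩ := (IsPatched.self S).exists_lift
    (h₁.toAddMonoidHom.comp p₁) (h₂.toAddMonoidHom.comp p₂)
    (fun a y => by simp [H.map_smul₁]) (fun a y => by simp [H.map_smul₂])
    (fun y => (H.exists_iff _ _).mpr ⟨y, rfl, rfl⟩)
  have hf1 : ∀ a, p₁ (f a) = f₁ (S.π₁ a) := fun a => (hf a).1
  have hf2 : ∀ a, p₂ (f a) = f₂ (S.π₂ a) := fun a => (hf a).2
  have hh1 : ∀ a, S.π₁ (h a) = h₁ (p₁ a) := fun a => (hh a).1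
  have hh2 : ∀ a, S.π₂ (h a) = h₂ (p₂ a) := fun a => (hh a).2
  refine ⟨f, h, ⟨H₁.ne_zero, H₁.dvd_sub_one, fun x => S.ext_of ?_ ?_, fun y => H.ext ?_ ?_⟩,
    hf1, hf2⟩
  · rw [hh1, hf1, H₁.left, map_smul]
  · rw [hh2, hf2, H₂.left, map_smul]
  · rw [hf1, hh1, H₁.right, H.map_base_smul₁]
  · rw [hf2, hh2, H₂.right, H.map_base_smul₂]

/-- At a prime not containing s the patched pair is a local isomorphism with Λ. A prime containing s
does not contain r, because r divides s - 1; there, r times arbitrary local isomorphisms of the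
components patch, since r kills Λbar. -/
theorem isLocallyFree [IsDedekindDomain R] [Module.Finite R Λ] [Module.Finite R Λ₁]
    [Module.Finite R Λ₂]
    (H : IsPatched S p₁ p₂ (fun x => S.g₁ (h₁ x)) (fun x => S.g₂ (h₂ x)))
    (hr : ∀ z : Λbar, r • z = 0)
    (H₁ : CoprimePair r f₁ h₁ s) (H₂ : CoprimePair r f₂ h₂ s)
    (hX₁ : IsLocallyFree R Λ₁ 1 X₁) (hX₂ : IsLocallyFree R Λ₂ 1 X₂) :
    IsLocallyFree R Λ 1 X where
  finite := by
    have := hX₁.finite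
    have := hX₂.finite
    exact H.finite
  locallyIso p hp := by
    have := hX₁.finite
    have := hX₂.finite
    suffices h : ∃ f : Λ →ₗ[Λ] X, InvertibleAt p f by
      obtain ⟨f, hf⟩ := h
      exact hf.locallyIsoAt.symm.trans (isLocallyFree_self.locallyIso p)
    by_cases hs : s ∈ p
    · have hrp : r ∉ p := by
        intro hrp
        refine hp.ne_top ((Ideal.eq_top_iff_one p).mpr ?_)
        have : (1 : R) = s - (s - 1) := by ring
        rw [this]
        exact sub_mem hs (Ideal.mem_of_dvd p H₁.dvd_sub_one hrp)
      obtain ⟨e₁, s₁, hs₁, l₁, a₁, b₁⟩ :=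
        (isLocallyFree_self.locallyIsoAt hX₁ p).exists_invertibleAt
      obtain ⟨e₂, s₂, hs₂, l₂, a₂, b₂⟩ :=
        (isLocallyFree_self.locallyIsoAt hX₂ p).exists_invertibleAt
      obtain ⟨f, hf⟩ := H.exists_lift
        ((r • e₁).toAddMonoidHom.comp S.π₁.toRingHom.toAddMonoidHom)
        ((r • e₂).toAddMonoidHom.comp S.π₂.toRingHom.toAddMonoidHom)
        (fun a y => by
          change (r • e₁) (S.π₁ (a * y)) = S.π₁ a • (r • e₁) (S.π₁ y)
          rw [map_mul, ← smul_eq_mul, map_smul])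
        (fun a y => by
          change (r • e₂) (S.π₂ (a * y)) = S.π₂ a • (r • e₂) (S.π₂ y)
          rw [map_mul, ← smul_eq_mul, map_smul])
        (fun y => by
          change S.g₁ (h₁ (r • e₁ (S.π₁ y))) = S.g₂ (h₂ (r • e₂ (S.π₂ y)))
          rw [smul_map, smul_map, map_smul, map_smul, hr, hr])
      -- The crossed factors s₂ and s₁ bring both components to the common scalar r * r * s₁ * s₂.
      obtain ⟨h, hh⟩ := (IsPatched.self S).exists_lift
        (((r * s₂) • l₁).toAddMonoidHom.comp p₁) (((r * s₁) • l₂).toAddMonoidHom.comp p₂)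
        (fun a y => by
          change ((r * s₂) • l₁) (p₁ (a • y)) = S.π₁ a • ((r * s₂) • l₁) (p₁ y)
          rw [H.map_smul₁, map_smul])
        (fun a y => by
          change ((r * s₁) • l₂) (p₂ (a • y)) = S.π₂ a • ((r * s₁) • l₂) (p₂ y)
          rw [H.map_smul₂, map_smul])
        (fun y => by
          change S.g₁ ((r * s₂) • l₁ (p₁ y)) = S.g₂ ((r * s₁) • l₂ (p₂ y))
          rw [map_smul, map_smul, mul_smul, mul_smul, hr, hr])
      have hf1 : ∀ a, p₁ (f a) = r • e₁ (S.π₁ a) := fun a => (hf a).1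
      have hf2 : ∀ a, p₂ (f a) = r • e₂ (S.π₂ a) := fun a => (hf a).2
      have hh1 : ∀ a, S.π₁ (h a) = (r * s₂) • l₁ (p₁ a) := fun a => (hh a).1
      have hh2 : ∀ a, S.π₂ (h a) = (r * s₁) • l₂ (p₂ a) := fun a => (hh a).2
      have hpr : p.IsPrime := hp.isPrime
      refine ⟨f, r * r * s₁ * s₂, ?_, h, fun x => S.ext_of ?_ ?_, fun y => H.ext ?_ ?_⟩
      · simp only [hpr.mul_mem_iff_mem_or_mem, hrp, hs₁, hs₂, or_self, not_false_eq_true]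
      · rw [hh1, hf1, smul_map, a₁, map_smul, smul_smul, smul_smul]
        congr 1; ring
      · rw [hh2, hf2, smul_map, a₂, map_smul, smul_smul, smul_smul]
        congr 1; ring
      · have : e₁ ((r * s₂) • l₁ (p₁ y)) = (r * s₂) • e₁ (l₁ (p₁ y)) := by
          rw [← algebraMap_smul Λ₁, map_smul, algebraMap_smul]
        rw [hf1, hh1, this, b₁, H.map_base_smul₁, smul_smul, smul_smul]
        congr 1; ring
      · have : e₂ ((r * s₁) • l₂ (p₂ y)) = (r * s₁) • e₂ (l₂ (p₂ y)) := by
          rw [← algebraMap_smul Λ₂, map_smul, algebraMap_smul]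
        rw [hf2, hh2, this, b₂, H.map_base_smul₂, smul_smul, smul_smul]
        congr 1; ring
    · obtain ⟨f, h, hfh, -⟩ := H.exists_coprimePair H₁ H₂
      exact ⟨f, s, hs, h, hfh.left, hfh.right⟩

theorem nonempty_baseChange_equiv [IsDedekindDomain R] [Module.Finite R Λ] [Module.Finite R Λ₁]
    [Module.IsTorsionFree R Λ₁] {X : Type u} [AddCommGroup X] [Module R X] [Module Λ X]
    [IsScalarTower R Λ X] {p₁ : X →+ X₁} {p₂ : X →+ X₂}
    (H : IsPatched S p₁ p₂ (fun x => S.g₁ (h₁ x)) (fun x => S.g₂ (h₂ x)))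
    (hr : ∀ z : Λbar, r • z = 0)
    (H₁ : CoprimePair r f₁ h₁ s) (H₂ : CoprimePair r f₂ h₂ s)
    (hX : IsLocallyFree R Λ 1 X) (hX₁ : IsLocallyFree R Λ₁ 1 X₁) :
    Nonempty (BaseChange S.π₁ X ≃ₗ[Λ₁] X₁) := by
  let F : BaseChange S.π₁ X →ₗ[Λ₁] X₁ := BaseChange.lift S.π₁ p₁ H.map_smul₁
  have hF : ∀ x, F (BaseChange.of S.π₁ X x) = p₁ x := BaseChange.lift_of S.π₁ p₁ H.map_smul₁
  obtain ⟨f, h, hfh, hf1, -⟩ := H.exists_coprimePair H₁ H₂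
  have hsurj : Function.Surjective F := by
    intro x
    obtain ⟨c, hc⟩ := H₁.dvd_sub_one
    -- The pair (r x, 0) satisfies the gluing condition since r kills Λbar.
    obtain ⟨y, hy, -⟩ := (H.exists_iff (r • x) 0).mp (by
      rw [smul_map, map_smul, hr, map_zero, map_zero])
    refine ⟨h₁ x • BaseChange.of S.π₁ X (f 1) - c • BaseChange.of S.π₁ X y, ?_⟩
    rw [map_sub, map_smul, smul_map F, hF, hF, hf1, hy, map_one, ← map_smul, smul_eq_mul, mul_one,
      H₁.right, smul_smul, mul_comm, ← hc, ← sub_smul]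
    simp
  have hBC := hX.baseChange S.π₁
  have := hBC.isTorsionFree
  have := hX₁.finite
  let toR {Y Z : Type _} [AddCommGroup Y] [Module R Y] [Module Λ₁ Y] [IsScalarTower R Λ₁ Y]
    [AddCommGroup Z] [Module R Z] [Module Λ₁ Z] [IsScalarTower R Λ₁ Z] (g : Y →ₗ[Λ₁] Z) :
    Y →ₗ[R] Z := { toFun := g, map_add' := map_add g, map_smul' := smul_map g }
  have hinj : Function.Injective F := by
    refine IsNoetherian.injective_of_surjective_of_injective (R := R)
      (toR (f₁ ∘ₗ (BaseChange.selfEquiv S.π₁).toLinearMap ∘ₗ BaseChange.map S.π₁ h))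
      (toR F) ?_ hsurj
    exact H₁.injective.comp ((BaseChange.selfEquiv S.π₁).injective.comp
      (hfh.symm.baseChange S.π₁).injective)
  exact ⟨LinearEquiv.ofBijective F ⟨hinj, hsurj⟩⟩

end IsPatched

end Patching

end Orders

namespace Orders

/-! ### Gluing free modules along invertible matrices -/

section MatrixGluing

open Matrix

variable {R : Type v} [CommRing R] {Λ Λ₁ Λ₂ : Type u} {Λbar : Type w}
  [Ring Λ] [Ring Λ₁] [Ring Λ₂] [Ring Λbar]
  [Algebra R Λ] [Algebra R Λ₁] [Algebra R Λ₂] [Algebra R Λbar]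
variable {ι κ : Type} [Fintype ι] [DecidableEq ι] [Fintype κ] [DecidableEq κ]

namespace FibreProduct

variable (S : FibreProduct R Λ Λ₁ Λ₂ Λbar)

/-- The module `{(x₁, x₂) ∈ Λ₁^ι ⊕ Λ₂^ι | g₁(x₁) a = g₂(x₂)}` glued along an invertible
matrix `a`. -/
def matrixGlue (a : (Matrix ι ι Λbar)ˣ) : Submodule Λ (ι → S.Ambient) where
  carrier := {x | (fun i => S.g₁ (x i).1) ᵥ* (a : Matrix ι ι Λbar) = fun i => S.g₂ (x i).2}
  add_mem' {x y} hx hy := by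
    change (fun i => S.g₁ ((x i).1 + (y i).1)) ᵥ* (a : Matrix ι ι Λbar) =
      fun i => S.g₂ ((x i).2 + (y i).2)
    simp only [map_add]
    change ((fun i => S.g₁ (x i).1) + fun i => S.g₁ (y i).1) ᵥ* (a : Matrix ι ι Λbar) = _
    rw [add_vecMul, hx, hy]
    rfl
  zero_mem' := by
    change (fun i : ι => S.g₁ 0) ᵥ* (a : Matrix ι ι Λbar) = fun i => S.g₂ 0
    simp only [map_zero]
    exact zero_vecMul _
  smul_mem' c x hx := by
    change (fun i => S.g₁ (S.π₁ c * (x i).1)) ᵥ* (a : Matrix ι ι Λbar) =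
      fun i => S.g₂ (S.π₂ c * (x i).2)
    simp only [map_mul]
    change (S.g₁ (S.π₁ c) • fun i => S.g₁ (x i).1) ᵥ* (a : Matrix ι ι Λbar) = _
    rw [smul_vecMul, hx, S.comm]
    rfl

/-- The two projections of `S.Ambient`. -/
def ambientFst : S.Ambient →+ Λ₁ := AddMonoidHom.fst Λ₁ Λ₂

/-- The two projections of `S.Ambient`. -/
def ambientSnd : S.Ambient →+ Λ₂ := AddMonoidHom.snd Λ₁ Λ₂

theorem isPatched_matrixGlue (a : (Matrix ι ι Λbar)ˣ) :
    IsPatched S ((S.ambientFst.compLeft ι).comp (S.matrixGlue a).subtype.toAddMonoidHom)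
      ((S.ambientSnd.compLeft ι).comp (S.matrixGlue a).subtype.toAddMonoidHom)
      (fun x => (fun i => S.g₁ (x i)) ᵥ* (a : Matrix ι ι Λbar)) (fun x i => S.g₂ (x i)) where
  map_smul₁ _ _ := rfl
  map_smul₂ _ _ := rfl
  eq_zero x h h' := Subtype.ext (funext fun i => Prod.ext (congrFun h i) (congrFun h' i))
  exists_iff x₁ x₂ := by
    constructor
    · intro h
      exact ⟨⟨fun i => ((x₁ i, x₂ i) : Λ₁ × Λ₂), h⟩, rfl, rfl⟩
    · rintro ⟨x, rfl, rfl⟩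
      exact x.2

theorem isPatched_M (u : Λbarˣ) :
    IsPatched S (S.ambientFst.comp (S.M u).subtype.toAddMonoidHom)
      (S.ambientSnd.comp (S.M u).subtype.toAddMonoidHom)
      (fun x => S.g₁ x * u) (fun x => S.g₂ x) where
  map_smul₁ _ _ := rfl
  map_smul₂ _ _ := rfl
  eq_zero x h h' := Subtype.ext (Prod.ext h h')
  exists_iff x₁ x₂ := by
    constructor
    · intro h
      exact ⟨⟨((x₁, x₂) : Λ₁ × Λ₂), h⟩, rfl, rfl⟩
    · rintro ⟨x, rfl, rfl⟩
      exact x.2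

/-- The automorphism `x ↦ x α` of a free module given by an invertible matrix. -/
def vecMulEquiv {B : Type*} [Ring B] (α : (Matrix ι ι B)ˣ) : (ι → B) ≃ₗ[B] (ι → B) :=
  LinearEquiv.ofLinearMap (vecMulLinear (α : Matrix ι ι B)) (vecMulLinear (↑α⁻¹ : Matrix ι ι B))
    (LinearMap.ext fun x => by simp)
    (LinearMap.ext fun x => by simp)

theorem map_vecMul {ι κ : Type*} [Fintype ι] {B C : Type*} [Ring B] [Ring C] (φ : B →+* C) (x : ι → B) (α : Matrix ι κ B) :
    (fun i => φ ((x ᵥ* α) i)) = (fun i => φ (x i)) ᵥ* α.map φ :=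
  funext fun i => RingHom.map_vecMul φ α x i

/-- A change of bases: x₁ ↦ x₁ α and x₂ ↦ x₂ β carry one gluing condition to the other. Thus only
the double coset of the gluing matrix matters. -/
theorem isoClass_matrixGlue_congr {a a' : (Matrix ι ι Λbar)ˣ} (α : (Matrix ι ι Λ₁)ˣ)
    (β : (Matrix ι ι Λ₂)ˣ)
    (h : unitsMap ι S.g₁.toRingHom α * a' = a * unitsMap ι S.g₂.toRingHom β) :
    isoClass Λ (S.matrixGlue a) = isoClass Λ (S.matrixGlue a') := by
  refine (isoClass_eq_iff Λ).mpr ((S.isPatched_matrixGlue a).nonempty_equiv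
    (S.isPatched_matrixGlue a') (vecMulEquiv α) (vecMulEquiv β) fun x₁ x₂ => ?_)
  change _ ↔ (fun i => S.g₁.toRingHom ((x₁ ᵥ* (α : Matrix ι ι Λ₁)) i)) ᵥ* (a' : Matrix ι ι Λbar) =
    fun i => S.g₂.toRingHom ((x₂ ᵥ* (β : Matrix ι ι Λ₂)) i)
  rw [map_vecMul, map_vecMul, vecMul_vecMul]
  have h' : (α : Matrix ι ι Λ₁).map S.g₁.toRingHom * (a' : Matrix ι ι Λbar) =
      (a : Matrix ι ι Λbar) * (β : Matrix ι ι Λ₂).map S.g₂.toRingHom := congrArg Units.val h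
  rw [h', ← vecMul_vecMul]
  constructor
  · exact fun h => congrArg (· ᵥ* (β : Matrix ι ι Λ₂).map S.g₂.toRingHom) h
  · exact fun h => (vecMulEquiv (unitsMap ι S.g₂.toRingHom β)).injective h

theorem isoClass_matrixGlue_one :
    isoClass Λ (S.matrixGlue (1 : (Matrix ι ι Λbar)ˣ)) = isoClass Λ (ι → Λ) := by
  refine (isoClass_eq_iff Λ).mpr ((S.isPatched_matrixGlue 1).nonempty_equiv
    (IsPatched.pi S ι) (LinearEquiv.refl _ _) (LinearEquiv.refl _ _) fun x₁ x₂ => ?_)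
  simp

theorem isoClass_matrixGlue_blockUnit (a : (Matrix ι ι Λbar)ˣ) (b : (Matrix κ κ Λbar)ˣ) :
    isoClass Λ (S.matrixGlue (blockUnit a b)) =
      isoClass Λ (S.matrixGlue a) + isoClass Λ (S.matrixGlue b) := by
  rw [← isoClass_prod]
  refine (isoClass_eq_iff Λ).mpr ((S.isPatched_matrixGlue _).nonempty_equiv
    ((S.isPatched_matrixGlue a).prod (S.isPatched_matrixGlue b))
    (LinearEquiv.sumArrowLequivProdArrow ι κ Λ₁ Λ₁) (LinearEquiv.sumArrowLequivProdArrow ι κ Λ₂ Λ₂)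
    fun x₁ x₂ => ?_)
  change (fun i => S.g₁ (x₁ i)) ᵥ* fromBlocks (a : Matrix ι ι Λbar) 0 0 (b : Matrix κ κ Λbar) = _ ↔
    (((fun i => S.g₁ (x₁ (Sum.inl i))) ᵥ* (a : Matrix ι ι Λbar),
      (fun i => S.g₁ (x₁ (Sum.inr i))) ᵥ* (b : Matrix κ κ Λbar)) : (ι → Λbar) × (κ → Λbar)) =
      (fun i => S.g₂ (x₂ (Sum.inl i)), fun i => S.g₂ (x₂ (Sum.inr i)))
  rw [vecMul_fromBlocks, vecMul_zero, vecMul_zero, add_zero, zero_add, Prod.ext_iff]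
  constructor
  · intro h
    exact ⟨funext fun i => congrFun h (Sum.inl i), funext fun i => congrFun h (Sum.inr i)⟩
  · rintro ⟨h, h'⟩
    refine funext fun i => ?_
    rcases i with i | i
    · exact congrFun h i
    · exact congrFun h' i

theorem isoClass_matrixGlue_scalarUnit (u : Λbarˣ) :
    isoClass Λ (S.matrixGlue (scalarUnit u)) = isoClass Λ (S.M u) := by
  refine (isoClass_eq_iff Λ).mpr ((S.isPatched_matrixGlue _).nonempty_equiv
    (S.isPatched_M u) (LinearEquiv.funUnique Unit Λ₁ Λ₁) (LinearEquiv.funUnique Unit Λ₂ Λ₂)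
    fun x₁ x₂ => ?_)
  rw [funext_iff, Unique.forall_iff]
  simp [scalarUnit, vecMul_diagonal]

theorem isoClass_matrixGlue_diagOne (m : ℕ) (u : Λbarˣ) :
    isoClass Λ (S.matrixGlue (diagOne (Fin m) u)) = isoClass Λ (S.M u) + m • isoClass Λ Λ := by
  rw [diagOne, isoClass_matrixGlue_blockUnit, isoClass_matrixGlue_scalarUnit,
    isoClass_matrixGlue_one, isoClass_pi]

theorem isoClass_M_one : isoClass Λ (S.M 1) = isoClass Λ Λ := by
  refine (isoClass_eq_iff Λ).mpr ((S.isPatched_M 1).nonempty_equiv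
    (IsPatched.self S) (LinearEquiv.refl _ _) (LinearEquiv.refl _ _) fun x₁ x₂ => ?_)
  simp

/-- `M(u) ⊕ M(v) ≅ Λ ⊕ M(u v)`. -/
theorem isoClass_M_add_M (hsurj : Function.Surjective S.g₁ ∨ Function.Surjective S.g₂)
    (u v : Λbarˣ) :
    isoClass Λ (S.M u) + isoClass Λ (S.M v) = isoClass Λ Λ + isoClass Λ (S.M (u * v)) := by
  have key : isoClass Λ (S.matrixGlue (blockUnit (scalarUnit (u * v)) (scalarUnit 1))) =
      isoClass Λ Λ + isoClass Λ (S.M (u * v)) := by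
    rw [isoClass_matrixGlue_blockUnit, isoClass_matrixGlue_scalarUnit,
      isoClass_matrixGlue_scalarUnit, isoClass_M_one, add_comm]
  rw [← key]
  rcases hsurj with h | h
  -- The summands are exchanged because the liftable matrix acts on the left here: diag(u, u⁻¹)
  -- diag(v, u) = diag(u v, 1).
  · rw [add_comm, ← isoClass_matrixGlue_scalarUnit, ← isoClass_matrixGlue_scalarUnit,
      ← isoClass_matrixGlue_blockUnit]
    obtain ⟨α, hα⟩ := elementarySubgroup_le_range S.g₁.toRingHom h (blockUnit_scalarUnit_inv_mem u)
    refine (S.isoClass_matrixGlue_congr α 1 ?_).symm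
    rw [hα, map_one (unitsMap _ _), mul_one, blockUnit_mul, ← map_mul, ← map_mul, inv_mul_cancel]
  -- Here the liftable matrix acts on the right: diag(u, v) diag(v, v⁻¹) = diag(u v, 1).
  · rw [← isoClass_matrixGlue_scalarUnit, ← isoClass_matrixGlue_scalarUnit,
      ← isoClass_matrixGlue_blockUnit]
    obtain ⟨β, hβ⟩ := elementarySubgroup_le_range S.g₂.toRingHom h (blockUnit_scalarUnit_inv_mem v)
    refine S.isoClass_matrixGlue_congr 1 β ?_
    rw [hβ, map_one (unitsMap _ _), one_mul, blockUnit_mul, ← map_mul, ← map_mul, mul_inv_cancel]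

/-- A glued module is the direct sum of some `M(u)` and a free module. -/
theorem exists_isoClass_matrixGlue_eq [Finite Λbar]
    (hsurj : Function.Surjective S.g₁ ∨ Function.Surjective S.g₂) (m : ℕ)
    (a : (Matrix (Unit ⊕ Fin m) (Unit ⊕ Fin m) Λbar)ˣ) :
    ∃ u : Λbarˣ, isoClass Λ (S.matrixGlue a) = isoClass Λ (S.M u) + m • isoClass Λ Λ := by
  obtain ⟨α, β, u, h⟩ := exists_eq_unitsMap_mul_diagOne_mul S.g₁.toRingHom S.g₂.toRingHom hsurj a
  refine ⟨u, ?_⟩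
  rw [← isoClass_matrixGlue_diagOne]
  refine S.isoClass_matrixGlue_congr α β⁻¹ ?_
  rw [h, map_inv]
  group

theorem isoClass_M_eq_of_mem_W {u : Λbarˣ} (hu : u ∈ S.W) :
    isoClass Λ (S.M u) = isoClass Λ Λ := by
  obtain ⟨a, b, rfl⟩ := hu
  rw [← isoClass_matrixGlue_scalarUnit, ← S.isoClass_M_one, ← isoClass_matrixGlue_scalarUnit]
  refine S.isoClass_matrixGlue_congr (scalarUnit a) (scalarUnit b⁻¹) ?_
  rw [unitsMap_scalarUnit, unitsMap_scalarUnit, ← map_mul, ← map_mul, map_inv]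
  congr 1
  exact (mul_one _).trans (eq_mul_inv_of_mul_eq rfl)

end FibreProduct

/-- The matrices of a projective module which becomes free after extension of scalars. -/
theorem BaseChange.exists_matrices {Γ : Type u} [Ring Γ] [Algebra R Γ] (f : Λ →ₐ[R] Γ)
    {Z : Type u} [AddCommGroup Z] [Module R Z] [Module Λ Z] [IsScalarTower R Λ Z]
    (i : Z →ₗ[Λ] (κ → Λ)) (p : (κ → Λ) →ₗ[Λ] Z) (hpi : p ∘ₗ i = LinearMap.id)
    (e : BaseChange f Z ≃ₗ[Γ] (ι → Γ)) :
    ∃ (E : Matrix ι κ Γ) (F : Matrix κ ι Γ), E * F = 1 ∧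
      F * E = (LinearMap.toMatrixRight' (i ∘ₗ p)).map f ∧
      (∀ z, e (BaseChange.of f Z z) ᵥ* E = fun k => f (i z k)) ∧
      ∀ x, (fun k => f (x k)) ᵥ* F = e (BaseChange.of f Z (p x)) := by
  let I : (ι → Γ) →ₗ[Γ] (κ → Γ) :=
    (BaseChange.piEquiv f κ).toLinearMap ∘ₗ BaseChange.map f i ∘ₗ e.symm.toLinearMap
  let P : (κ → Γ) →ₗ[Γ] (ι → Γ) :=
    e.toLinearMap ∘ₗ BaseChange.map f p ∘ₗ (BaseChange.piEquiv f κ).symm.toLinearMap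
  have hI : ∀ x, x ᵥ* LinearMap.toMatrixRight' I = I x := fun x =>
    LinearMap.congr_fun (LinearMap.toMatrixRight'.symm_apply_apply I) x
  have hP : ∀ x, x ᵥ* LinearMap.toMatrixRight' P = P x := fun x =>
    LinearMap.congr_fun (LinearMap.toMatrixRight'.symm_apply_apply P) x
  have hof : ∀ x : κ → Λ, (fun k => f (x k)) =
      BaseChange.piEquiv f κ (BaseChange.of f (κ → Λ) x) := fun x =>
    funext fun k => (BaseChange.piEquiv_of f κ x k).symm
  refine ⟨LinearMap.toMatrixRight' I, LinearMap.toMatrixRight' P, ?_, ?_, fun z => ?_,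
    fun x => ?_⟩
  · rw [← LinearMap.toMatrixRight'_comp]
    have : P ∘ₗ I = LinearMap.id := by
      refine LinearMap.ext fun x => ?_
      have h1 : BaseChange.map f p (BaseChange.map f i (e.symm x)) = e.symm x := by
        rw [← LinearMap.comp_apply, ← BaseChange.map_comp, hpi, BaseChange.map_id,
          LinearMap.id_apply]
      simp [P, I, h1]
    rw [this, LinearMap.toMatrixRight'_id]
  · rw [← LinearMap.toMatrixRight'_comp]
    ext k l
    have h1 : (Pi.single k 1 : κ → Γ) =
        BaseChange.piEquiv f κ (BaseChange.of f (κ → Λ) (Pi.single k 1)) := by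
      rw [← hof]
      ext l
      simp [Pi.single_apply, apply_ite f]
    change (I ∘ₗ P) (Pi.single k 1) l = f (i (p (Pi.single k 1)) l)
    rw [h1]
    simp [P, I]
  · rw [hI, hof]
    simp [I]
  · rw [hP, hof]
    simp [P]

/-- A projective module which becomes free over `Λ₁` and `Λ₂` is glued along a matrix. -/
theorem exists_isoClass_eq_matrixGlue (S : FibreProduct R Λ Λ₁ Λ₂ Λbar)
    {Z : Type u} [AddCommGroup Z] [Module R Z] [Module Λ Z] [IsScalarTower R Λ Z]
    (i : Z →ₗ[Λ] (κ → Λ)) (p : (κ → Λ) →ₗ[Λ] Z) (hpi : p ∘ₗ i = LinearMap.id)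
    (e₁ : BaseChange S.π₁ Z ≃ₗ[Λ₁] (ι → Λ₁)) (e₂ : BaseChange S.π₂ Z ≃ₗ[Λ₂] (ι → Λ₂)) :
    ∃ a : (Matrix ι ι Λbar)ˣ, isoClass Λ Z = isoClass Λ (S.matrixGlue a) := by
  obtain ⟨E₁, F₁, h₁, h₁', hE₁, hF₁⟩ := BaseChange.exists_matrices S.π₁ i p hpi e₁
  obtain ⟨E₂, F₂, h₂, h₂', hE₂, hF₂⟩ := BaseChange.exists_matrices S.π₂ i p hpi e₂
  -- Both products are the image over Λbar of the idempotent matrix of i ∘ p. This makes E₁ F₂ an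
  -- invertible transition matrix with inverse E₂ F₁.
  have hFE : F₁.map S.g₁ * E₁.map S.g₁ = F₂.map S.g₂ * E₂.map S.g₂ := by
    rw [← Matrix.map_mul, ← Matrix.map_mul, h₁', h₂']
    ext k l
    simp [S.comm]
  have hEF₁ : E₁.map S.g₁ * F₁.map S.g₁ = 1 := by
    rw [← Matrix.map_mul, h₁, Matrix.map_one _ (map_zero _) (map_one _)]
  have hEF₂ : E₂.map S.g₂ * F₂.map S.g₂ = 1 := by
    rw [← Matrix.map_mul, h₂, Matrix.map_one _ (map_zero _) (map_one _)]
  let a : (Matrix ι ι Λbar)ˣ :=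
    { val := E₁.map S.g₁ * F₂.map S.g₂
      inv := E₂.map S.g₂ * F₁.map S.g₁
      val_inv := by
        rw [Matrix.mul_assoc, ← Matrix.mul_assoc (F₂.map S.g₂), ← hFE, Matrix.mul_assoc, hEF₁,
          Matrix.mul_one, hEF₁]
      inv_val := by
        rw [Matrix.mul_assoc, ← Matrix.mul_assoc (F₁.map S.g₁), hFE, Matrix.mul_assoc, hEF₂,
          Matrix.mul_one, hEF₂] }
  have hg₁ : ∀ {μ ν : Type} [Fintype μ] (x : μ → Λ₁) (M : Matrix μ ν Λ₁),
      (fun j => S.g₁ ((x ᵥ* M) j)) = (fun j => S.g₁ (x j)) ᵥ* M.map S.g₁ :=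
    fun x M => FibreProduct.map_vecMul S.g₁.toRingHom x M
  have hg₂ : ∀ {μ ν : Type} [Fintype μ] (x : μ → Λ₂) (M : Matrix μ ν Λ₂),
      (fun j => S.g₂ ((x ᵥ* M) j)) = (fun j => S.g₂ (x j)) ᵥ* M.map S.g₂ :=
    fun x M => FibreProduct.map_vecMul S.g₂.toRingHom x M
  have H : IsPatched S (e₁.toLinearMap.toAddMonoidHom.comp (BaseChange.of S.π₁ Z))
      (e₂.toLinearMap.toAddMonoidHom.comp (BaseChange.of S.π₂ Z))
      (fun x => (fun j => S.g₁ (x j)) ᵥ* (a : Matrix ι ι Λbar)) (fun x j => S.g₂ (x j)) := by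
    refine ⟨fun b z => ?_, fun b z => ?_, fun z hz₁ hz₂ => ?_, fun y₁ y₂ => ⟨fun hy => ?_, ?_⟩⟩
    · simp [BaseChange.of_smul]
    · simp [BaseChange.of_smul]
    · have hz₁' : e₁ (BaseChange.of S.π₁ Z z) = 0 := hz₁
      have hz₂' : e₂ (BaseChange.of S.π₂ Z z) = 0 := hz₂
      have e1 := hE₁ z
      have e2 := hE₂ z
      rw [hz₁', zero_vecMul] at e1
      rw [hz₂', zero_vecMul] at e2
      have : i z = 0 := (IsPatched.pi S κ).eq_zero _ e1.symm e2.symm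
      rw [← LinearMap.id_apply (R := Λ) z, ← hpi, LinearMap.comp_apply, this, map_zero]
    -- A glued pair becomes, inside the ambient free modules, a pair agreeing over Λbar; it comes
    -- from a vector over Λ, which p projects back to Z.
    · have hy' : (fun j => S.g₁ ((y₁ ᵥ* E₁) j)) = fun j => S.g₂ ((y₂ ᵥ* E₂) j) := by
        rw [hg₁, hg₂, ← hy, vecMul_vecMul]
        change _ = _ ᵥ* (E₁.map S.g₁ * F₂.map S.g₂ * _)
        rw [Matrix.mul_assoc, ← hFE, ← Matrix.mul_assoc, hEF₁, Matrix.one_mul]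
      obtain ⟨x, hx₁, hx₂⟩ := ((IsPatched.pi S κ).exists_iff _ _).mp hy'
      have hx₁' : (fun k => S.π₁ (x k)) = y₁ ᵥ* E₁ := hx₁
      have hx₂' : (fun k => S.π₂ (x k)) = y₂ ᵥ* E₂ := hx₂
      refine ⟨p x, ?_, ?_⟩
      · change e₁ (BaseChange.of S.π₁ Z (p x)) = y₁
        rw [← hF₁, hx₁', vecMul_vecMul, h₁, vecMul_one]
      · change e₂ (BaseChange.of S.π₂ Z (p x)) = y₂
        rw [← hF₂, hx₂', vecMul_vecMul, h₂, vecMul_one]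
    · rintro ⟨z, rfl, rfl⟩
      have e1 := hg₁ (e₁ (BaseChange.of S.π₁ Z z)) E₁
      have e2 := hg₂ (e₂ (BaseChange.of S.π₂ Z z)) E₂
      rw [hE₁] at e1
      rw [hE₂] at e2
      simp only [S.comm] at e1
      have e3 := congrArg (· ᵥ* F₂.map S.g₂) (e1.symm.trans e2)
      simp only [vecMul_vecMul, hEF₂, vecMul_one] at e3
      exact e3
  exact ⟨a, (isoClass_eq_iff Λ).mpr (H.nonempty_equiv (S.isPatched_matrixGlue a)
    (LinearEquiv.refl _ _) (LinearEquiv.refl _ _) fun _ _ => Iff.rfl)⟩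

end MatrixGluing

end Orders

namespace Orders

/-! ### Finite torsion modules and lifting units modulo `r` -/

theorem finite_of_forall_smul_eq_zero {R M : Type*} [CommRing R] [AddCommGroup M] [Module R M]
    [Module.Finite R M] {r : R} [Finite (R ⧸ Ideal.span {r})] (h : ∀ x : M, r • x = 0) :
    Finite M := by
  have htors : Module.IsTorsionBySet R M (Ideal.span {r} : Ideal R) := by
    rw [Module.isTorsionBySet_span_singleton_iff]
    exact fun x => h x
  let _ := htors.module
  have : IsScalarTower R (R ⧸ Ideal.span {r}) M := htors.isScalarTower
  have : Module.Finite (R ⧸ Ideal.span {r}) M := Module.Finite.of_restrictScalars_finite R _ M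
  exact Module.finite_of_finite (R ⧸ Ideal.span {r})

section UnitLifting

variable {R : Type v} [CommRing R] {Λ : Type u} {Λbar : Type w} [Ring Λ] [Ring Λbar]
  [Algebra R Λ] [Algebra R Λbar]

/-- Units of `Λbar` lift to elements of `Λ` which are invertible modulo `r`. -/
theorem exists_lift_invertible_mod [Module.Finite R Λ] {r : R} [Finite (R ⧸ Ideal.span {r})]
    (hr : ∀ z : Λbar, r • z = 0) {g : Λ →ₐ[R] Λbar} (hg : Function.Surjective g) (u : Λbarˣ) :
    ∃ z z' : Λ, g z = u ∧ (∃ c, z * z' = 1 + r • c) ∧ ∃ c, z' * z = 1 + r • c := by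
  let I : Ideal Λ :=
    { carrier := {x | ∃ c, x = r • c}
      add_mem' := by
        rintro _ _ ⟨c, rfl⟩ ⟨d, rfl⟩
        exact ⟨c + d, (smul_add r c d).symm⟩
      zero_mem' := ⟨0, (smul_zero r).symm⟩
      smul_mem' := by
        rintro a _ ⟨c, rfl⟩
        exact ⟨a * c, by rw [smul_eq_mul, mul_smul_comm]⟩ }
  have : I.IsTwoSided := ⟨by
    rintro _ b ⟨c, rfl⟩
    exact ⟨c * b, by rw [smul_mul_assoc]⟩⟩
  have hI : ∀ x, Ideal.Quotient.mk I x = 1 → ∃ c, x = 1 + r • c := by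
    intro x hx
    rw [← map_one (Ideal.Quotient.mk I), Ideal.Quotient.eq] at hx
    obtain ⟨c, hc⟩ := hx
    exact ⟨c, by rw [← hc]; abel⟩
  have : Finite (Λ ⧸ I) := by
    have : Module.Finite R (Λ ⧸ I) :=
      Module.Finite.of_surjective ((Submodule.mkQ I).restrictScalars R) (Submodule.mkQ_surjective I)
    refine finite_of_forall_smul_eq_zero (R := R) (r := r) fun x => ?_
    obtain ⟨x, rfl⟩ := Submodule.mkQ_surjective I x
    have : Submodule.mkQ I (r • x) = 0 := (Submodule.Quotient.mk_eq_zero I).mpr ⟨x, rfl⟩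
    exact this
  let gbar : Λ ⧸ I →+* Λbar := Ideal.Quotient.lift I g.toRingHom (by
    rintro _ ⟨c, rfl⟩
    exact (map_smul g r c).trans (hr _))
  -- As r kills Λbar, the map g factors through the finite ring Λ / rΛ, along which units lift.
  obtain ⟨b, hb⟩ := exists_unit_lift gbar
    (Ideal.Quotient.lift_surjective_of_surjective I _ hg) u
  obtain ⟨z, hz⟩ := Ideal.Quotient.mk_surjective (b : Λ ⧸ I)
  obtain ⟨z', hz'⟩ := Ideal.Quotient.mk_surjective ((b⁻¹ : (Λ ⧸ I)ˣ) : Λ ⧸ I)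
  refine ⟨z, z', ?_, hI _ ?_, hI _ ?_⟩
  · rw [← hb, ← hz]
    rfl
  · rw [map_mul, hz, hz', Units.mul_inv]
  · rw [map_mul, hz, hz', Units.inv_mul]

/-- Right multiplication by a lift of u is invertible at all maximal ideals containing r, hence part
of a coprime pair. This puts the condition defining M(u) into the form g₁ (h₁ x₁) = g₂ (h₂ x₂)
required for patching. If r is a unit there is no such maximal ideal, but then Λbar is zero. -/
theorem exists_coprimePair_of_unit [IsDedekindDomain R] [Module.Finite R Λ] {r : R}
    [Finite (R ⧸ Ideal.span {r})] (hr : ∀ z : Λbar, r • z = 0) {g : Λ →ₐ[R] Λbar}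
    (hg : Function.Surjective g) (u : Λbarˣ) :
    ∃ (f h : Λ →ₗ[Λ] Λ) (s : R), CoprimePair r f h s ∧ ∀ x, g (h x) = g x * u := by
  by_cases hunit : IsUnit r
  · have hsub : Subsingleton Λbar := ⟨fun x y => by
      rw [← hunit.smul_left_cancel, hr, hr]⟩
    exact ⟨LinearMap.id, LinearMap.id, 1, ⟨one_ne_zero, by simp, by simp, by simp⟩,
      fun x => Subsingleton.elim _ _⟩
  · obtain ⟨z, z', hz, ⟨c, hc⟩, ⟨d, hd⟩⟩ := exists_lift_invertible_mod hr hg u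
    obtain ⟨p₀, hp₀, hrp₀⟩ := exists_max_ideal_of_mem_nonunits hunit
    have hinv : ∀ p : MaximalSpectrum R, r ∈ p.asIdeal →
        InvertibleAt p.asIdeal (LinearMap.toSpanSingleton Λ Λ z) := fun p hp =>
      invertibleAt_of_inverse_mod (h := LinearMap.toSpanSingleton Λ Λ z')
        (fun x => ⟨x * c, by
          simp only [LinearMap.toSpanSingleton_apply, smul_eq_mul, mul_assoc, hc, mul_add, mul_one,
            mul_smul_comm]⟩)
        (fun x => ⟨x * d, by
          simp only [LinearMap.toSpanSingleton_apply, smul_eq_mul, mul_assoc, hd, mul_add, mul_one,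
            mul_smul_comm]⟩) hp
    obtain ⟨h, s, H⟩ := exists_coprimePair_of_invertibleAt hinv ⟨p₀, hp₀⟩ (hinv ⟨p₀, hp₀⟩ hrp₀)
    exact ⟨h, _, s, H.symm, fun x => by simp [hz]⟩

end UnitLifting

theorem LocallyFreeClassGroup.mk_eq_mk_iff {R : Type v} [CommRing R] {Λ : Type u} [Ring Λ]
    [Algebra R Λ]
    {X : Type u} [AddCommGroup X] [Module R X] [Module Λ X] [IsScalarTower R Λ X]
    {Y : Type u} [AddCommGroup Y] [Module R Y] [Module Λ Y] [IsScalarTower R Λ Y]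
    {hX : IsLocallyFree R Λ 1 X} {hY : IsLocallyFree R Λ 1 Y} :
    LocallyFreeClassGroup.mk X hX = LocallyFreeClassGroup.mk Y hY ↔
      ∃ m : ℕ, isoClass Λ X + m • isoClass Λ Λ = isoClass Λ Y + m • isoClass Λ Λ :=
  Quotient.eq.trans (stablyIso_iff Λ)

/-! ### Pullbacks of a module over each factor -/

section PairModule

variable {R : Type v} [CommRing R] {Λ Λ₁ Λ₂ : Type u} {Λbar : Type w}
  [Ring Λ] [Ring Λ₁] [Ring Λ₂] [Ring Λbar]
  [Algebra R Λ] [Algebra R Λ₁] [Algebra R Λ₂] [Algebra R Λbar]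

/-- The direct sum of a `Λ₁`-module and a `Λ₂`-module, as a `Λ`-module. -/
def PairModule (_S : FibreProduct R Λ Λ₁ Λ₂ Λbar) (X₁ X₂ : Type u) : Type u := X₁ × X₂

variable (S : FibreProduct R Λ Λ₁ Λ₂ Λbar) (X₁ X₂ : Type u) [AddCommGroup X₁] [AddCommGroup X₂]
  [Module Λ₁ X₁] [Module Λ₂ X₂]

instance : AddCommGroup (PairModule S X₁ X₂) := inferInstanceAs (AddCommGroup (X₁ × X₂))

instance [Module R X₁] [Module R X₂] : Module R (PairModule S X₁ X₂) := inferInstanceAs (Module R (X₁ × X₂))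

instance : Module Λ (PairModule S X₁ X₂) where
  smul a x := ((S.π₁ a • x.1, S.π₂ a • x.2) : X₁ × X₂)
  one_smul x := by
    change ((S.π₁ 1 • x.1, S.π₂ 1 • x.2) : X₁ × X₂) = x
    rw [map_one, map_one, one_smul, one_smul]
    rfl
  mul_smul a b x := by
    change ((S.π₁ (a * b) • x.1, S.π₂ (a * b) • x.2) : X₁ × X₂) =
      (S.π₁ a • S.π₁ b • x.1, S.π₂ a • S.π₂ b • x.2)
    rw [map_mul, map_mul, mul_smul, mul_smul]
  smul_zero a := Prod.ext (smul_zero (S.π₁ a)) (smul_zero (S.π₂ a))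
  smul_add a x y := Prod.ext (smul_add (S.π₁ a) x.1 y.1) (smul_add (S.π₂ a) x.2 y.2)
  add_smul a b x := by
    change ((S.π₁ (a + b) • x.1, S.π₂ (a + b) • x.2) : X₁ × X₂) =
      (S.π₁ a • x.1 + S.π₁ b • x.1, S.π₂ a • x.2 + S.π₂ b • x.2)
    rw [map_add, map_add, add_smul, add_smul]
  zero_smul x := by
    change ((S.π₁ 0 • x.1, S.π₂ 0 • x.2) : X₁ × X₂) = (0, 0)
    rw [map_zero, map_zero, zero_smul, zero_smul]

instance [Module R X₁] [Module R X₂] [IsScalarTower R Λ₁ X₁] [IsScalarTower R Λ₂ X₂] :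
    IsScalarTower R Λ (PairModule S X₁ X₂) where
  smul_assoc r a x := by
    change ((S.π₁ (r • a) • x.1, S.π₂ (r • a) • x.2) : X₁ × X₂) =
      (r • S.π₁ a • x.1, r • S.π₂ a • x.2)
    rw [map_smul, map_smul, smul_assoc, smul_assoc]

variable {X₁ X₂}

/-- The pullback of `X₁` and `X₂` along homomorphisms to `Λ₁` and `Λ₂`. -/
def pairGlue (h₁ : X₁ →ₗ[Λ₁] Λ₁) (h₂ : X₂ →ₗ[Λ₂] Λ₂) : Submodule Λ (PairModule S X₁ X₂) where
  carrier := {x | S.g₁ (h₁ x.1) = S.g₂ (h₂ x.2)}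
  add_mem' {x y} hx hy := by
    change S.g₁ (h₁ (x.1 + y.1)) = S.g₂ (h₂ (x.2 + y.2))
    rw [map_add, map_add, map_add, map_add, hx, hy]
  zero_mem' := by
    change S.g₁ (h₁ 0) = S.g₂ (h₂ 0)
    simp only [map_zero]
  smul_mem' a x hx := by
    change S.g₁ (h₁ (S.π₁ a • x.1)) = S.g₂ (h₂ (S.π₂ a • x.2))
    rw [map_smul h₁, map_smul h₂, smul_eq_mul, smul_eq_mul, map_mul, map_mul, hx, S.comm]

/-- The first projection of `PairModule`. -/
def pairFst : PairModule S X₁ X₂ →+ X₁ := AddMonoidHom.fst X₁ X₂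

/-- The second projection of `PairModule`. -/
def pairSnd : PairModule S X₁ X₂ →+ X₂ := AddMonoidHom.snd X₁ X₂

theorem isPatched_pairGlue (h₁ : X₁ →ₗ[Λ₁] Λ₁) (h₂ : X₂ →ₗ[Λ₂] Λ₂) :
    IsPatched S ((pairFst S).comp (pairGlue S h₁ h₂).subtype.toAddMonoidHom)
      ((pairSnd S).comp (pairGlue S h₁ h₂).subtype.toAddMonoidHom)
      (fun x => S.g₁ (h₁ x)) (fun x => S.g₂ (h₂ x)) where
  map_smul₁ _ _ := rfl
  map_smul₂ _ _ := rfl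
  eq_zero x h h' := Subtype.ext (Prod.ext h h')
  exists_iff x₁ x₂ := by
    constructor
    · intro h
      exact ⟨⟨((x₁, x₂) : X₁ × X₂), h⟩, rfl, rfl⟩
    · rintro ⟨x, rfl, rfl⟩
      exact x.2

end PairModule

/-! ### The boundary map and the exact sequence -/

section ExactSequence

variable {R : Type v} [CommRing R] {Λ Λ₁ Λ₂ : Type u} {Λbar : Type w}
  [Ring Λ] [Ring Λ₁] [Ring Λ₂] [Ring Λbar]
  [Algebra R Λ] [Algebra R Λ₁] [Algebra R Λ₂] [Algebra R Λbar]
  [IsDedekindDomain R] [Module.Finite R Λ] [Module.Finite R Λ₁] [Module.Finite R Λ₂]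
  {r : R} [Finite (R ⧸ Ideal.span {r})]

namespace FibreProduct

variable (S : FibreProduct R Λ Λ₁ Λ₂ Λbar)

/-- The unit is absorbed into the factor whose map to Λbar is surjective, as u in the first factor
or as u⁻¹ in the second; the other factor keeps the identity, paired with multiplication by s. -/
theorem exists_isPatched_M (hr : ∀ z : Λbar, r • z = 0)
    (hsurj : Function.Surjective S.g₁ ∨ Function.Surjective S.g₂) (u : Λbarˣ) :
    ∃ (f₁ h₁ : Λ₁ →ₗ[Λ₁] Λ₁) (f₂ h₂ : Λ₂ →ₗ[Λ₂] Λ₂) (s : R),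
      CoprimePair r f₁ h₁ s ∧ CoprimePair r f₂ h₂ s ∧
      IsPatched S (S.ambientFst.comp (S.M u).subtype.toAddMonoidHom)
        (S.ambientSnd.comp (S.M u).subtype.toAddMonoidHom)
        (fun x => S.g₁ (h₁ x)) (fun x => S.g₂ (h₂ x)) := by
  have H := S.isPatched_M u
  rcases hsurj with h | h
  · obtain ⟨f, h, s, hfh, hu⟩ := exists_coprimePair_of_unit hr h u
    refine ⟨f, h, s • LinearMap.id, LinearMap.id, s, hfh, ⟨hfh.ne_zero, hfh.dvd_sub_one,
      by simp, by simp⟩, H.map_smul₁, H.map_smul₂, H.eq_zero, fun x₁ x₂ => ?_⟩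
    rw [hu, ← H.exists_iff]
    rfl
  · obtain ⟨f, h, s, hfh, hu⟩ := exists_coprimePair_of_unit hr h u⁻¹
    refine ⟨s • LinearMap.id, LinearMap.id, f, h, s, ⟨hfh.ne_zero, hfh.dvd_sub_one,
      by simp, by simp⟩, hfh, H.map_smul₁, H.map_smul₂, H.eq_zero, fun x₁ x₂ => ?_⟩
    rw [hu, ← H.exists_iff, Units.eq_mul_inv_iff_mul_eq]
    rfl

theorem isLocallyFree_M (hr : ∀ z : Λbar, r • z = 0)
    (hsurj : Function.Surjective S.g₁ ∨ Function.Surjective S.g₂) (u : Λbarˣ) :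
    IsLocallyFree R Λ 1 (S.M u) := by
  obtain ⟨f₁, h₁, f₂, h₂, s, H₁, H₂, H⟩ := S.exists_isPatched_M hr hsurj u
  exact H.isLocallyFree hr H₁ H₂ isLocallyFree_self isLocallyFree_self

/-- The homomorphism `∂ : Λbarˣ → Cl(Λ)`, `u ↦ [M(u)]`. -/
noncomputable def boundary (hr : ∀ z : Λbar, r • z = 0)
    (hsurj : Function.Surjective S.g₁ ∨ Function.Surjective S.g₂) :
    Additive Λbarˣ →+ LocallyFreeClassGroup R Λ :=
  AddMonoidHom.mk' (fun u => LocallyFreeClassGroup.mk (S.M u.toMul)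
    (S.isLocallyFree_M hr hsurj u.toMul)) (fun u v => by
      obtain ⟨e⟩ := (isoClass_eq_iff Λ).mp (S.isoClass_M_add_M hsurj u.toMul v.toMul)
      exact (LocallyFreeClassGroup.mk_add_mk _ _ _ e).symm)

end FibreProduct

theorem LocallyFreeClassGroup.mk_eq_zero_iff
    {X : Type u} [AddCommGroup X] [Module R X] [Module Λ X] [IsScalarTower R Λ X]
    {hX : IsLocallyFree R Λ 1 X} :
    LocallyFreeClassGroup.mk X hX = 0 ↔
      ∃ m : ℕ, isoClass Λ X + m • isoClass Λ Λ = isoClass Λ Λ + m • isoClass Λ Λ :=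
  LocallyFreeClassGroup.mk_eq_mk_iff (hY := isLocallyFree_self)

theorem classGroupMap_boundary (S : FibreProduct R Λ Λ₁ Λ₂ Λbar) [Module.IsTorsionFree R Λ₁]
    [Module.IsTorsionFree R Λ₂] (hr : ∀ z : Λbar, r • z = 0)
    (hsurj : Function.Surjective S.g₁ ∨ Function.Surjective S.g₂) (u : Additive Λbarˣ) :
    classGroupMap S.π₁ (S.boundary hr hsurj u) = 0 ∧
      classGroupMap S.π₂ (S.boundary hr hsurj u) = 0 := by
  obtain ⟨f₁, h₁, f₂, h₂, s, H₁, H₂, H⟩ := S.exists_isPatched_M hr hsurj u.toMul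
  have hM := S.isLocallyFree_M hr hsurj u.toMul
  constructor
  · obtain ⟨e⟩ := H.nonempty_baseChange_equiv hr H₁ H₂ hM isLocallyFree_self
    exact LocallyFreeClassGroup.mk_eq_zero_iff.mpr
      ⟨0, by rw [(isoClass_eq_iff Λ₁).mpr ⟨e⟩]⟩
  · obtain ⟨e⟩ := H.swap.nonempty_baseChange_equiv hr H₂ H₁ hM isLocallyFree_self
    exact LocallyFreeClassGroup.mk_eq_zero_iff.mpr
      ⟨0, by rw [← (isoClass_eq_iff Λ₂).mpr ⟨e⟩]; rfl⟩

/-- Representatives X₁ and X₂ are compared with Λ₁ and Λ₂ by coprime pairs rescaled to the common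
scalar s₁ s₂. The pullback of X₁ and X₂ along the resulting maps is locally free and extends to
them. -/
theorem exists_classGroupMap_eq (S : FibreProduct R Λ Λ₁ Λ₂ Λbar) [Module.IsTorsionFree R Λ₁]
    [Module.IsTorsionFree R Λ₂] (hr0 : r ≠ 0) (hr : ∀ z : Λbar, r • z = 0)
    (c₁ : LocallyFreeClassGroup R Λ₁) (c₂ : LocallyFreeClassGroup R Λ₂) :
    ∃ c : LocallyFreeClassGroup R Λ, classGroupMap S.π₁ c = c₁ ∧ classGroupMap S.π₂ c = c₂ := by
  obtain ⟨X₁⟩ := c₁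
  obtain ⟨X₂⟩ := c₂
  have hX₁ := X₁.isLocallyFree
  have hX₂ := X₂.isLocallyFree
  have := hX₁.finite
  have := hX₂.finite
  obtain ⟨f₁, h₁, s₁, H₁⟩ := exists_coprimePair hr0
    fun p => isLocallyFree_self.locallyIsoAt hX₁ p.asIdeal
  obtain ⟨f₂, h₂, s₂, H₂⟩ := exists_coprimePair hr0
    fun p => isLocallyFree_self.locallyIsoAt hX₂ p.asIdeal
  have H₁' := H₁.smul H₂.ne_zero H₂.dvd_sub_one
  have H₂' := H₂.smul H₁.ne_zero H₁.dvd_sub_one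
  rw [mul_comm] at H₂'
  have H := isPatched_pairGlue S (s₂ • h₁) (s₁ • h₂)
  have hX := H.isLocallyFree hr H₁' H₂' hX₁ hX₂
  obtain ⟨e₁⟩ := H.nonempty_baseChange_equiv hr H₁' H₂' hX hX₁
  obtain ⟨e₂⟩ := H.swap.nonempty_baseChange_equiv hr H₂' H₁' hX hX₂
  refine ⟨LocallyFreeClassGroup.mk _ hX, ?_, ?_⟩
  · exact LocallyFreeClassGroup.mk_eq_mk_iff.mpr ⟨0, by rw [(isoClass_eq_iff Λ₁).mpr ⟨e₁⟩]⟩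
  · exact LocallyFreeClassGroup.mk_eq_mk_iff.mpr ⟨0, by rw [← (isoClass_eq_iff Λ₂).mpr ⟨e₂⟩]; rfl⟩

/-- Exactness at `Cl(Λ)`. -/
theorem exists_boundary_eq (S : FibreProduct R Λ Λ₁ Λ₂ Λbar) [Finite Λbar]
    (hr : ∀ z : Λbar, r • z = 0)
    (hsurj : Function.Surjective S.g₁ ∨ Function.Surjective S.g₂) (c : LocallyFreeClassGroup R Λ)
    (h₁ : classGroupMap S.π₁ c = 0) (h₂ : classGroupMap S.π₂ c = 0) :
    ∃ u, S.boundary hr hsurj u = c := by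
  obtain ⟨X⟩ := c
  obtain ⟨m₁, hm₁⟩ := LocallyFreeClassGroup.mk_eq_zero_iff.mp h₁
  obtain ⟨m₂, hm₂⟩ := LocallyFreeClassGroup.mk_eq_zero_iff.mp h₂
  obtain ⟨e₀⟩ := (isoClass_eq_iff Λ).mp (PrincipalGenus.isoClass_inverse X)
  -- One number of free summands makes both extensions of scalars free.
  let m := m₁ + m₂
  have free : ∀ {Γ : Type u} [Ring Γ] [Algebra R Γ] (f : Λ →ₐ[R] Γ),
      isoClass Γ (BaseChange f X.carrier) + m • isoClass Γ Γ = isoClass Γ Γ + m • isoClass Γ Γ →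
      Nonempty (BaseChange f (X.carrier × (Fin m → Λ)) ≃ₗ[Γ] (Unit ⊕ Fin m → Γ)) := by
    intro Γ _ _ f h
    rw [← isoClass_pi, ← isoClass_prod, ← isoClass_prod, isoClass_eq_iff] at h
    obtain ⟨e⟩ := h
    exact ⟨(BaseChange.prodEquiv f X.carrier (Fin m → Λ)).trans <|
      ((LinearEquiv.refl Γ _).prodCongr (BaseChange.piEquiv f (Fin m))).trans <| e.trans <|
      ((LinearEquiv.funUnique Unit Γ Γ).symm.prodCongr (LinearEquiv.refl Γ _)).trans <|
      (LinearEquiv.sumArrowLequivProdArrow Unit (Fin m) Γ Γ).symm⟩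
  obtain ⟨e₁⟩ := free S.π₁ (by
    simp only [m, add_smul, ← add_assoc]
    exact congrArg (· + m₂ • isoClass Λ₁ Λ₁) hm₁)
  obtain ⟨e₂⟩ := free S.π₂ (by
    simp only [m, add_comm m₁ m₂, add_smul, ← add_assoc]
    exact congrArg (· + m₁ • isoClass Λ₂ Λ₂) hm₂)
  -- Projectivity of X ⊕ Λ^m is made explicit: since X ⊕ X' ≅ Λ², it is a direct summand of Λ^(2 +
  -- m).
  let E : (Fin 2 ⊕ Fin m → Λ) ≃ₗ[Λ] (X.carrier × X.inverse.carrier) × (Fin m → Λ) :=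
    (LinearEquiv.sumArrowLequivProdArrow (Fin 2) (Fin m) Λ Λ).trans <|
      ((LinearEquiv.finTwoArrow Λ Λ).trans e₀).prodCongr (LinearEquiv.refl Λ _)
  let i : X.carrier × (Fin m → Λ) →ₗ[Λ] (Fin 2 ⊕ Fin m → Λ) :=
    E.symm.toLinearMap ∘ₗ LinearMap.prodMap (LinearMap.inl Λ _ _) LinearMap.id
  let p : (Fin 2 ⊕ Fin m → Λ) →ₗ[Λ] X.carrier × (Fin m → Λ) :=
    LinearMap.prodMap (LinearMap.fst Λ _ _) LinearMap.id ∘ₗ E.toLinearMap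
  have hpi : p ∘ₗ i = LinearMap.id := LinearMap.ext fun x => by simp [p, i]
  obtain ⟨a, ha⟩ := exists_isoClass_eq_matrixGlue S i p hpi e₁ e₂
  obtain ⟨u, hu⟩ := S.exists_isoClass_matrixGlue_eq hsurj m a
  refine ⟨Additive.ofMul u, ?_⟩
  refine LocallyFreeClassGroup.mk_eq_mk_iff.mpr ⟨m, ?_⟩
  change isoClass Λ (S.M u) + m • isoClass Λ Λ = isoClass Λ X.carrier + m • isoClass Λ Λ
  rw [← hu, ← ha, isoClass_prod, isoClass_pi]

end ExactSequence

end Orders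

namespace Orders

/-! ### Stably free cancellation as completion of matrices -/

section MatrixSFC

open Matrix

/-- The matrix of an automorphism of a free module. -/
def unitOfEquiv {ι B : Type*} [Fintype ι] [DecidableEq ι] [Ring B] (T : (ι → B) ≃ₗ[B] (ι → B)) :
    (Matrix ι ι B)ˣ where
  val := LinearMap.toMatrixRight' T.toLinearMap
  inv := LinearMap.toMatrixRight' T.symm.toLinearMap
  val_inv := by
    rw [← LinearMap.toMatrixRight'_comp]
    simp
  inv_val := by
    rw [← LinearMap.toMatrixRight'_comp]
    simp

theorem vecMul_unitOfEquiv {ι B : Type*} [Fintype ι] [DecidableEq ι] [Ring B]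
    (T : (ι → B) ≃ₗ[B] (ι → B)) (x : ι → B) : x ᵥ* (unitOfEquiv T : Matrix ι ι B) = T x :=
  LinearMap.congr_fun (LinearMap.toMatrixRight'.symm_apply_apply T.toLinearMap) x

/-- An isomorphism that is the identity on P passes to the quotients by P. -/
theorem nonempty_equiv_of_prod_equiv {Λ X N P : Type*} [Ring Λ] [AddCommGroup X] [Module Λ X]
    [AddCommGroup N] [Module Λ N] [AddCommGroup P] [Module Λ P]
    (G : (X × P) ≃ₗ[Λ] (N × P)) (hG : ∀ t, G (0, t) = (0, t)) : Nonempty (X ≃ₗ[Λ] N) := by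
  have hG' : ∀ t, G.symm (0, t) = (0, t) := fun t => by
    rw [LinearEquiv.symm_apply_eq, hG]
  refine ⟨LinearEquiv.ofLinearMap
    (LinearMap.fst Λ N P ∘ₗ G.toLinearMap ∘ₗ LinearMap.inl Λ X P)
    (LinearMap.fst Λ X P ∘ₗ G.symm.toLinearMap ∘ₗ LinearMap.inl Λ N P)
    (LinearMap.ext fun y => ?_) (LinearMap.ext fun x => ?_)⟩
  · have : ((G.symm (y, 0)).1, (0 : P)) = G.symm (y, 0) - (0, (G.symm (y, 0)).2) := by
      ext <;> simp
    simp [this, hG]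
  · have : ((G (x, 0)).1, (0 : P)) = G (x, 0) - (0, (G (x, 0)).2) := by
      ext <;> simp
    simp [this, hG']

/-- Stably free cancellation in terms of matrices: right invertible matrices with more columns
than rows can be completed to invertible ones. -/
def HasMatrixSFC (Λ : Type*) [Ring Λ] : Prop :=
  ∀ (k m : ℕ) (U : Matrix (Fin m) ((Unit ⊕ Fin k) ⊕ Fin m) Λ)
    (V : Matrix ((Unit ⊕ Fin k) ⊕ Fin m) (Fin m) Λ), U * V = 1 →
    ∃ g : (Matrix ((Unit ⊕ Fin k) ⊕ Fin m) ((Unit ⊕ Fin k) ⊕ Fin m) Λ)ˣ,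
      U * g.val = fromCols 0 1

/-- The index bijection behind `Λ^(k + 1) ≅ Λ ⊕ Λ^k`. -/
def unitSumFinEquiv (k : ℕ) : Unit ⊕ Fin k ≃ Fin (k + 1) :=
  (((Equiv.ofUnique Unit (Fin 1)).sumCongr (Equiv.refl (Fin k))).trans finSumFinEquiv).trans
    (finCongr (Nat.add_comm 1 k))

/-- The index bijection behind `Λ^(m + (k + 1)) ≅ (Λ ⊕ Λ^k) ⊕ Λ^m`. -/
def finSumEquiv (k m : ℕ) : (Unit ⊕ Fin k) ⊕ Fin m ≃ Fin (m + (k + 1)) :=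
  (((unitSumFinEquiv k).sumCongr (Equiv.refl (Fin m))).trans finSumFinEquiv).trans
    (finCongr (Nat.add_comm _ _))

section Splitting

variable {ι κ : Type} [Fintype ι] [Fintype κ] [DecidableEq κ] {Λ : Type u} [Ring Λ]

/-- The splitting `Λ^ι ≅ ker V ⊕ Λ^κ` given by a right inverse `V` of `U`. -/
def kerProdEquiv {U : Matrix κ ι Λ} {V : Matrix ι κ Λ} (hUV : U * V = 1) :
    (LinearMap.ker (vecMulLinear V) × (κ → Λ)) ≃ₗ[Λ] (ι → Λ) where
  toFun z := z.1.1 + z.2 ᵥ* U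
  invFun x := (⟨x - (x ᵥ* V) ᵥ* U, by
    rw [LinearMap.mem_ker, vecMulLinear_apply, sub_vecMul, vecMul_vecMul _ U, hUV, vecMul_one,
      sub_self]⟩, x ᵥ* V)
  map_add' z z' := by
    simp only [Prod.fst_add, Prod.snd_add, Submodule.coe_add, add_vecMul]
    abel
  map_smul' c z := by
    simp only [Prod.smul_fst, Prod.smul_snd, Submodule.coe_smul, smul_vecMul, smul_add,
      RingHom.id_apply]
  left_inv z := by
    have h0 : z.1.1 ᵥ* V = 0 := z.1.2
    have h1 : (z.1.1 + z.2 ᵥ* U) ᵥ* V = z.2 := by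
      rw [add_vecMul, h0, zero_add, vecMul_vecMul, hUV, vecMul_one]
    refine Prod.ext (Subtype.ext ?_) h1
    simp only [h1, add_sub_cancel_right]
  right_inv x := sub_add_cancel _ _

theorem finite_ker_vecMulLinear {U : Matrix κ ι Λ} {V : Matrix ι κ Λ} (hUV : U * V = 1) :
    Module.Finite Λ (LinearMap.ker (vecMulLinear V)) :=
  Module.Finite.of_surjective (LinearMap.fst Λ _ (κ → Λ) ∘ₗ (kerProdEquiv hUV).symm.toLinearMap)
    (Prod.fst_surjective.comp (kerProdEquiv hUV).symm.surjective)

/-- The rows of U are a basis of a complement to the kernel of V. A basis of that kernel completes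
them to a basis of the whole free module. -/
theorem exists_completion [DecidableEq ι] {U : Matrix κ (ι ⊕ κ) Λ} {V : Matrix (ι ⊕ κ) κ Λ} (hUV : U * V = 1)
    (ψ : LinearMap.ker (vecMulLinear V) ≃ₗ[Λ] (ι → Λ)) :
    ∃ g : (Matrix (ι ⊕ κ) (ι ⊕ κ) Λ)ˣ, U * g.val = fromCols 0 1 := by
  let T := (kerProdEquiv hUV).symm.trans ((ψ.prodCongr (LinearEquiv.refl Λ _)).trans
    (LinearEquiv.sumArrowLequivProdArrow ι κ Λ Λ).symm)
  have hT : ∀ t : κ → Λ, T (t ᵥ* U) = Sum.elim (0 : ι → Λ) t := by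
    intro t
    have h2 : (kerProdEquiv hUV).symm (t ᵥ* U) = (0, t) := by
      rw [LinearEquiv.symm_apply_eq]
      exact (zero_add _).symm
    simp only [T, LinearEquiv.trans_apply, h2, LinearEquiv.prodCongr_apply, map_zero]
    rfl
  refine ⟨unitOfEquiv T, ?_⟩
  refine ext_of_single_vecMul fun l => ?_
  rw [← vecMul_vecMul, vecMul_unitOfEquiv, hT, vecMul_fromCols, vecMul_zero, vecMul_one]

end Splitting

theorem hasMatrixSFC_of_hasSFC {Λ : Type u} [Ring Λ] (h : HasSFC Λ) : HasMatrixSFC Λ := by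
  intro k m U V hUV
  obtain ⟨ψ⟩ := h (LinearMap.ker (vecMulLinear V)) (finite_ker_vecMulLinear hUV) m (k + 1)
    ⟨(kerProdEquiv hUV).trans (LinearEquiv.funCongrLeft Λ Λ (finSumEquiv k m).symm)⟩
  exact exists_completion hUV (ψ.trans (LinearEquiv.funCongrLeft Λ Λ (unitSumFinEquiv k)))

theorem hasSFC_of_hasMatrixSFC {Λ : Type u} [Ring Λ] [IsNoetherianRing Λ] (h : HasMatrixSFC Λ) :
    HasSFC Λ := by
  intro X _ _ _ m n ⟨ψ₀⟩
  cases n with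
  -- The matrix condition always has at least one extra column, so rank 0 is treated separately: a
  -- surjective endomorphism of the Noetherian module Λ^m is injective, which forces X = 0.
  | zero =>
    let F : (Fin m → Λ) →ₗ[Λ] (Fin m → Λ) := LinearMap.snd Λ X (Fin m → Λ) ∘ₗ ψ₀.symm.toLinearMap
    have hF : Function.Surjective F := fun t => ⟨ψ₀ (0, t), by simp [F]⟩
    have hF' : Function.Injective F := IsNoetherian.injective_of_surjective_endomorphism F hF
    have hsub : Subsingleton X := ⟨fun x y => by
      have : F (ψ₀ (x, 0)) = F (ψ₀ (y, 0)) := by simp [F]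
      exact congrArg Prod.fst (ψ₀.injective (hF' this))⟩
    exact ⟨0⟩
  | succ k =>
    let ι := Unit ⊕ Fin k
    let ψ : (X × (Fin m → Λ)) ≃ₗ[Λ] (ι ⊕ Fin m → Λ) :=
      ψ₀.trans (LinearEquiv.funCongrLeft Λ Λ (finSumEquiv k m))
    -- U is the inclusion of the free summand. A completion g straightens it to the standard
    -- coordinate inclusion, so that the complements correspond.
    let U := LinearMap.toMatrixRight' (ψ.toLinearMap ∘ₗ LinearMap.inr Λ X (Fin m → Λ))
    let V := LinearMap.toMatrixRight' (LinearMap.snd Λ X (Fin m → Λ) ∘ₗ ψ.symm.toLinearMap)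
    have hUV : U * V = 1 := by
      rw [← LinearMap.toMatrixRight'_comp, ← LinearMap.toMatrixRight'_id]
      congr 1
      refine LinearMap.ext fun t => ?_
      simp
    have hU : ∀ t, t ᵥ* U = ψ (0, t) := fun t =>
      LinearMap.congr_fun (LinearMap.toMatrixRight'.symm_apply_apply
        (ψ.toLinearMap ∘ₗ LinearMap.inr Λ X (Fin m → Λ))) t
    obtain ⟨g, hg⟩ := h k m U V hUV
    obtain ⟨e⟩ := nonempty_equiv_of_prod_equiv (ψ.trans ((FibreProduct.vecMulEquiv g).trans
      (LinearEquiv.sumArrowLequivProdArrow ι (Fin m) Λ Λ))) (fun t => by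
        have h1 : FibreProduct.vecMulEquiv g (ψ (0, t)) = Sum.elim (0 : ι → Λ) t := by
          rw [← hU]
          change (t ᵥ* U) ᵥ* g.val = _
          rw [vecMul_vecMul, hg, vecMul_fromCols, vecMul_zero, vecMul_one]
        simp only [LinearEquiv.trans_apply, h1]
        rfl)
    exact ⟨e.trans (LinearEquiv.funCongrLeft Λ Λ (unitSumFinEquiv k).symm)⟩

end MatrixSFC

/-! ### Cancellation passes to the factors -/

section Criterion

open Matrix

variable {R : Type v} [CommRing R] {Λ Λ₁ Λ₂ : Type u} {Λbar : Type w}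
  [Ring Λ] [Ring Λ₁] [Ring Λ₂] [Ring Λbar]
  [Algebra R Λ] [Algebra R Λ₁] [Algebra R Λ₂] [Algebra R Λbar]
  (S : FibreProduct R Λ Λ₁ Λ₂ Λbar)

namespace FibreProduct

theorem matrix_ext {ι κ : Type*} {M N : Matrix ι κ Λ} (h₁ : M.map S.π₁ = N.map S.π₁)
    (h₂ : M.map S.π₂ = N.map S.π₂) : M = N :=
  Matrix.ext fun i j => S.ext_of (congrFun (congrFun h₁ i) j) (congrFun (congrFun h₂ i) j)

theorem exists_matrix {ι κ : Type*} {M₁ : Matrix ι κ Λ₁} {M₂ : Matrix ι κ Λ₂}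
    (h : M₁.map S.g₁ = M₂.map S.g₂) : ∃ M : Matrix ι κ Λ, M.map S.π₁ = M₁ ∧ M.map S.π₂ = M₂ := by
  choose M hM using fun i j =>
    (S.existsUnique (M₁ i j) (M₂ i j) (congrFun (congrFun h i) j)).exists
  exact ⟨Matrix.of M, Matrix.ext fun i j => (hM i j).1, Matrix.ext fun i j => (hM i j).2⟩

/-- V₁ + T - V₁ U₁ T is a right inverse of U₁ for every T. If T lifts the reduction of V₂, then U₁ T
reduces to 1 and the corrected inverse reduces to the same matrix as T. -/
theorem exists_right_inverse {ι κ : Type*} [Fintype ι] [DecidableEq ι] [DecidableEq κ] [Fintype κ]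
    (hsurj : Function.Surjective S.g₁)
    {U₁ : Matrix κ ι Λ₁} {V₁ : Matrix ι κ Λ₁} {U₂ : Matrix κ ι Λ₂} {V₂ : Matrix ι κ Λ₂}
    (h₁ : U₁ * V₁ = 1) (h₂ : U₂ * V₂ = 1) (hU : U₁.map S.g₁ = U₂.map S.g₂) :
    ∃ V₁' : Matrix ι κ Λ₁, U₁ * V₁' = 1 ∧ V₁'.map S.g₁ = V₂.map S.g₂ := by
  choose l hl using hsurj
  let T : Matrix ι κ Λ₁ := V₂.map fun x => l (S.g₂ x)
  have hT : T.map S.g₁ = V₂.map S.g₂ := by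
    ext i j
    simp [T, hl]
  have hUV : U₁.map S.g₁ * V₂.map S.g₂ = 1 := by
    rw [hU, ← Matrix.map_mul, h₂, Matrix.map_one _ (map_zero _) (map_one _)]
  refine ⟨V₁ + T - V₁ * (U₁ * T), ?_, ?_⟩
  · rw [Matrix.mul_sub, Matrix.mul_add, ← Matrix.mul_assoc, h₁, Matrix.one_mul, add_sub_cancel_right]
  · rw [Matrix.map_sub _ (map_sub _), Matrix.map_add _ (map_add _), Matrix.map_mul, Matrix.map_mul,
      hT, hUV, Matrix.mul_one, add_sub_cancel_left]

/-- Over Λbar the matrix U becomes (0 | 1) after an elementary ε. If g₁ is surjective, ε is lifted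
and U ε is paired with (0 | 1) over Λ₂; if g₂ is, U itself is paired with (0 | 1) ε⁻¹. The right
inverses are made compatible too, so the pair patches to a right invertible matrix over Λ, whose
completion projects to one over Λ₁. -/
theorem hasMatrixSFC_fst [Finite Λbar]
    (hsurj : Function.Surjective S.g₁ ∨ Function.Surjective S.g₂) (h : HasMatrixSFC Λ) :
    HasMatrixSFC Λ₁ := by
  intro k m U V hUV
  obtain ⟨ε, hε, hUε⟩ := exists_mul_elementary_eq_fromCols (U := U.map S.g₁) (V := V.map S.g₁) (by
    rw [← Matrix.map_mul, hUV, Matrix.map_one _ (map_zero _) (map_one _)])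
  obtain ⟨ε₁, U₂, V₁, V₂, h₁, h₂, hU, hV⟩ :
      ∃ (ε₁ : (Matrix ((Unit ⊕ Fin k) ⊕ Fin m) ((Unit ⊕ Fin k) ⊕ Fin m) Λ₁)ˣ)
        (U₂ : Matrix (Fin m) ((Unit ⊕ Fin k) ⊕ Fin m) Λ₂)
        (V₁ : Matrix ((Unit ⊕ Fin k) ⊕ Fin m) (Fin m) Λ₁)
        (V₂ : Matrix ((Unit ⊕ Fin k) ⊕ Fin m) (Fin m) Λ₂),
        U * ε₁.val * V₁ = 1 ∧ U₂ * V₂ = 1 ∧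
        (U * ε₁.val).map S.g₁ = U₂.map S.g₂ ∧ V₁.map S.g₁ = V₂.map S.g₂ := by
    rcases hsurj with hs | hs
    · obtain ⟨ε₁, rfl⟩ := elementarySubgroup_le_range S.g₁.toRingHom hs hε
      have hUV' : U * ε₁.val * ((ε₁⁻¹).val * V) = 1 := by
        rw [Matrix.mul_assoc, ← Matrix.mul_assoc ε₁.val, Units.mul_inv,
          Matrix.one_mul, hUV]
      have h₂ : (fromCols 0 1 : Matrix (Fin m) ((Unit ⊕ Fin k) ⊕ Fin m) Λ₂) *
          (fromRows 0 1 : Matrix ((Unit ⊕ Fin k) ⊕ Fin m) (Fin m) Λ₂) = 1 := by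
        rw [fromCols_mul_fromRows]
        simp
      have hU : (U * ε₁.val).map S.g₁ =
          (fromCols 0 1 : Matrix (Fin m) ((Unit ⊕ Fin k) ⊕ Fin m) Λ₂).map S.g₂ := by
        rw [Matrix.map_mul, fromCols_map, Matrix.map_zero _ (map_zero _),
          Matrix.map_one _ (map_zero _) (map_one _)]
        exact hUε
      obtain ⟨V₁, hV₁, hV⟩ := S.exists_right_inverse hs hUV' h₂ hU
      exact ⟨ε₁, _, V₁, _, hV₁, h₂, hU, hV⟩
    · obtain ⟨ε₂, rfl⟩ := elementarySubgroup_le_range S.g₂.toRingHom hs hε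
      have h₂ : (fromCols 0 1 : Matrix (Fin m) ((Unit ⊕ Fin k) ⊕ Fin m) Λ₂) *
          (ε₂⁻¹).val * (ε₂.val *
          (fromRows 0 1 : Matrix ((Unit ⊕ Fin k) ⊕ Fin m) (Fin m) Λ₂)) = 1 := by
        rw [Matrix.mul_assoc, ← Matrix.mul_assoc (ε₂⁻¹).val,
          Units.inv_mul, Matrix.one_mul, fromCols_mul_fromRows]
        simp
      have hU : ((fromCols 0 1 : Matrix (Fin m) ((Unit ⊕ Fin k) ⊕ Fin m) Λ₂) *
          (ε₂⁻¹).val).map S.g₂ = U.map S.g₁ := by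
        rw [Matrix.map_mul, fromCols_map, Matrix.map_zero _ (map_zero _),
          Matrix.map_one _ (map_zero _) (map_one _), ← hUε, Matrix.mul_assoc]
        change U.map S.g₁ * (ε₂.val.map S.g₂ * _) = _
        rw [← Matrix.map_mul, Units.mul_inv, Matrix.map_one _ (map_zero _) (map_one _),
          Matrix.mul_one]
      obtain ⟨V₂, hV₂, hV⟩ := S.swap.exists_right_inverse hs h₂ hUV hU
      exact ⟨1, _, V, V₂, by rw [Units.val_one, Matrix.mul_one, hUV], hV₂,
        by rw [Units.val_one, Matrix.mul_one]; exact hU.symm, hV.symm⟩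
  obtain ⟨U', hU₁, hU₂⟩ := S.exists_matrix hU
  obtain ⟨V', hV₁, hV₂⟩ := S.exists_matrix hV
  obtain ⟨g, hg⟩ := h k m U' V' (S.matrix_ext
    (by rw [Matrix.map_mul, hU₁, hV₁, h₁, Matrix.map_one _ (map_zero _) (map_one _)])
    (by rw [Matrix.map_mul, hU₂, hV₂, h₂, Matrix.map_one _ (map_zero _) (map_one _)]))
  refine ⟨ε₁ * unitsMap _ S.π₁.toRingHom g, ?_⟩
  rw [Units.val_mul, ← Matrix.mul_assoc, ← hU₁]
  change U'.map S.π₁ * g.val.map S.π₁ = _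
  rw [← Matrix.map_mul, hg, fromCols_map, Matrix.map_zero _ (map_zero _),
    Matrix.map_one _ (map_zero _) (map_one _)]

end FibreProduct

end Criterion

end Orders

namespace Orders

/-! ### The stabiliser of `(0 | 1)` -/

section UpperTriangular

open Matrix

variable {ι κ B : Type*} [Fintype ι] [DecidableEq ι] [Fintype κ] [DecidableEq κ] [Ring B]

/-- The invertible block matrix `(a b; 0 1)`. -/
def upperUnit (a : (Matrix ι ι B)ˣ) (b : Matrix ι κ B) : (Matrix (ι ⊕ κ) (ι ⊕ κ) B)ˣ where
  val := fromBlocks a.val b 0 1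
  inv := fromBlocks (a⁻¹).val (-((a⁻¹).val * b)) 0 1
  val_inv := by
    rw [fromBlocks_multiply, Matrix.mul_neg, ← Matrix.mul_assoc, Units.mul_inv]
    simp
  inv_val := by
    rw [fromBlocks_multiply]
    simp

theorem upperUnit_mul (a a' : (Matrix ι ι B)ˣ) (b b' : Matrix ι κ B) :
    upperUnit a b * upperUnit a' b' = upperUnit (a * a') (a.val * b' + b) :=
  Units.ext (by simp [upperUnit, fromBlocks_multiply])

theorem upperUnit_zero (a : (Matrix ι ι B)ˣ) :
    upperUnit a (0 : Matrix ι κ B) = blockUnit a 1 :=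
  Units.ext (by simp [upperUnit, blockUnit])

theorem unitsMap_upperUnit {C : Type*} [Ring C] (φ : C →+* B) (a : (Matrix ι ι C)ˣ)
    (b : Matrix ι κ C) :
    unitsMap (ι ⊕ κ) φ (upperUnit a b) = upperUnit (unitsMap ι φ a) (b.map φ) :=
  Units.ext (by simp [upperUnit, fromBlocks_map])

theorem fromCols_mul_upperUnit (a : (Matrix ι ι B)ˣ) (b : Matrix ι κ B) :
    (fromCols 0 1 : Matrix κ (ι ⊕ κ) B) * (upperUnit a b).val = fromCols 0 1 := by
  simp [upperUnit, fromCols_mul_fromBlocks]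

theorem fromCols_mul_inv {c : (Matrix (ι ⊕ κ) (ι ⊕ κ) B)ˣ}
    (h : (fromCols 0 1 : Matrix κ (ι ⊕ κ) B) * c.val = fromCols 0 1) :
    (fromCols 0 1 : Matrix κ (ι ⊕ κ) B) * (c⁻¹).val = fromCols 0 1 := by
  conv_lhs => rw [← h]
  rw [Matrix.mul_assoc, Units.mul_inv, Matrix.mul_one]

/-- Both c and its inverse have lower rows (0 | 1), so their upper left blocks are mutually inverse.
-/
theorem exists_eq_upperUnit (c : (Matrix (ι ⊕ κ) (ι ⊕ κ) B)ˣ)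
    (h : (fromCols 0 1 : Matrix κ (ι ⊕ κ) B) * c.val = fromCols 0 1) :
    ∃ a b, c = upperUnit a b := by
  have key : ∀ d : Matrix (ι ⊕ κ) (ι ⊕ κ) B,
      (fromCols 0 1 : Matrix κ (ι ⊕ κ) B) * d = fromCols 0 1 →
      d = fromBlocks d.toBlocks₁₁ d.toBlocks₁₂ 0 1 := by
    intro d hd
    rw [← fromBlocks_toBlocks d, fromCols_mul_fromBlocks] at hd
    simp only [Matrix.zero_mul, Matrix.one_mul, zero_add] at hd
    obtain ⟨h1, h2⟩ := fromCols_inj hd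
    conv_lhs => rw [← fromBlocks_toBlocks d, h1, h2]
  have h1 := key _ h
  have h2 := key _ (fromCols_mul_inv h)
  have h3 := c.mul_inv
  have h4 := c.inv_mul
  rw [h1, h2, fromBlocks_multiply, ← fromBlocks_one, fromBlocks_inj] at h3 h4
  exact ⟨⟨c.val.toBlocks₁₁, (c⁻¹).val.toBlocks₁₁, by simpa using h3.1, by simpa using h4.1⟩, _, Units.ext h1⟩

end UpperTriangular

/-! ### Cancellation from the factors, and the units `u` with `M(u)` free -/

section CriterionConverse

open Matrix

variable {R : Type v} [CommRing R] {Λ Λ₁ Λ₂ : Type u} {Λbar : Type w}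
  [Ring Λ] [Ring Λ₁] [Ring Λ₂] [Ring Λbar]
  [Algebra R Λ] [Algebra R Λ₁] [Algebra R Λ₂] [Algebra R Λbar]
  (S : FibreProduct R Λ Λ₁ Λ₂ Λbar)

namespace FibreProduct

section

variable {ι κ : Type} [Fintype ι] [DecidableEq ι] [Fintype κ] [DecidableEq κ]

/-- The right-hand side has upper right block α D b₂ + b₁ over Λbar. So b is lifted to b₁, or (α
D)⁻¹ b to b₂, according to which map is surjective. -/
theorem exists_eq_mul_blockUnit_mul (hsurj : Function.Surjective S.g₁ ∨ Function.Surjective S.g₂)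
    (α : (Matrix ι ι Λ₁)ˣ) (D : (Matrix ι ι Λbar)ˣ) (β : (Matrix ι ι Λ₂)ˣ)
    (b : Matrix ι κ Λbar) :
    ∃ (b₁ : Matrix ι κ Λ₁) (b₂ : Matrix ι κ Λ₂),
      upperUnit (unitsMap ι S.g₁.toRingHom α * D * unitsMap ι S.g₂.toRingHom β) b =
        unitsMap _ S.g₁.toRingHom (upperUnit α b₁) * blockUnit D 1 *
          unitsMap _ S.g₂.toRingHom (upperUnit β b₂) := by
  have lift {C : Type u} [Ring C] (φ : C →+* Λbar) (hφ : Function.Surjective φ)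
      (t : Matrix ι κ Λbar) : ∃ t' : Matrix ι κ C, t'.map φ = t := by
    choose l hl using hφ
    exact ⟨t.map l, by ext; simp [hl]⟩
  rcases hsurj with hs | hs
  · obtain ⟨b₁, hb⟩ := lift S.g₁.toRingHom hs b
    refine ⟨b₁, 0, ?_⟩
    rw [unitsMap_upperUnit, unitsMap_upperUnit, ← upperUnit_zero, upperUnit_mul, upperUnit_mul, hb]
    simp [Matrix.map_zero]
  · obtain ⟨b₂, hb⟩ := lift S.g₂.toRingHom hs
      (((unitsMap ι S.g₁.toRingHom α * D)⁻¹).val * b)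
    refine ⟨0, b₂, ?_⟩
    rw [unitsMap_upperUnit, unitsMap_upperUnit, ← upperUnit_zero, upperUnit_mul, upperUnit_mul, hb,
      ← Matrix.mul_assoc, Units.mul_inv, Matrix.one_mul, Matrix.mul_zero, zero_add,
      Matrix.map_zero _ (map_zero _), add_zero]

theorem exists_unit_of_unitsMap_eq {δ₁ : (Matrix ι ι Λ₁)ˣ} {δ₂ : (Matrix ι ι Λ₂)ˣ}
    (h : unitsMap ι S.g₁.toRingHom δ₁ = unitsMap ι S.g₂.toRingHom δ₂) :
    ∃ g : (Matrix ι ι Λ)ˣ, g.val.map S.π₁ = δ₁.val ∧ g.val.map S.π₂ = δ₂.val := by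
  obtain ⟨M, hM₁, hM₂⟩ := S.exists_matrix (congrArg Units.val h)
  obtain ⟨N, hN₁, hN₂⟩ := S.exists_matrix (M₁ := (δ₁⁻¹).val) (M₂ := (δ₂⁻¹).val)
    (congrArg (fun x => (x⁻¹).val) h)
  refine ⟨⟨M, N, S.matrix_ext ?_ ?_, S.matrix_ext ?_ ?_⟩, hM₁, hM₂⟩
  · rw [Matrix.map_mul, hM₁, hN₁, Units.mul_inv, Matrix.map_one _ (map_zero _) (map_one _)]
  · rw [Matrix.map_mul, hM₂, hN₂, Units.mul_inv, Matrix.map_one _ (map_zero _) (map_one _)]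
  · rw [Matrix.map_mul, hM₁, hN₁, Units.inv_mul, Matrix.map_one _ (map_zero _) (map_one _)]
  · rw [Matrix.map_mul, hM₂, hN₂, Units.inv_mul, Matrix.map_one _ (map_zero _) (map_one _)]

end

/-- Completions γ₁ and γ₂ over the factors differ over Λbar by a block triangular matrix. Its
diagonal block reduces to diag(u, 1, …, 1) modulo matrices from the factors, its upper right block
can be absorbed, and the condition on `W` removes u. The altered completions then agree over Λbar
and patch. -/
theorem hasMatrixSFC [Finite Λbar]
    (hsurj : Function.Surjective S.g₁ ∨ Function.Surjective S.g₂)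
    (h₁ : HasMatrixSFC Λ₁) (h₂ : HasMatrixSFC Λ₂)
    (hW : ∀ (u : Λbarˣ) (m : ℕ), isoClass Λ (S.M u) + m • isoClass Λ Λ =
      isoClass Λ Λ + m • isoClass Λ Λ → u ∈ S.W) : HasMatrixSFC Λ := by
  intro k m U V hUV
  obtain ⟨γ₁, hγ₁⟩ := h₁ k m (U.map S.π₁) (V.map S.π₁) (by
    rw [← Matrix.map_mul, hUV, Matrix.map_one _ (map_zero _) (map_one _)])
  obtain ⟨γ₂, hγ₂⟩ := h₂ k m (U.map S.π₂) (V.map S.π₂) (by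
    rw [← Matrix.map_mul, hUV, Matrix.map_one _ (map_zero _) (map_one _)])
  have hUbar : (U.map S.π₁).map S.g₁ = (U.map S.π₂).map S.g₂ := by
    ext i j
    exact S.comm _
  have hone : ∀ {B : Type u} [Ring B] (φ : B →+* Λbar),
      (fromCols 0 1 : Matrix (Fin m) ((Unit ⊕ Fin k) ⊕ Fin m) B).map φ = fromCols 0 1 := by
    intro B _ φ
    rw [fromCols_map, Matrix.map_zero _ (map_zero _), Matrix.map_one _ (map_zero _) (map_one _)]
  have hg₁ := (congrArg (fun M => M.map S.g₁) hγ₁).trans (hone S.g₁.toRingHom)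
  have hg₂ := (congrArg (fun M => M.map S.g₂) hγ₂).trans (hone S.g₂.toRingHom)
  simp only [Matrix.map_mul] at hg₁ hg₂
  obtain ⟨a, b, hc⟩ := exists_eq_upperUnit
    ((unitsMap _ S.g₁.toRingHom γ₁)⁻¹ * unitsMap _ S.g₂.toRingHom γ₂) (by
      have hinv : (fromCols 0 1 : Matrix (Fin m) ((Unit ⊕ Fin k) ⊕ Fin m) Λbar) *
          ((unitsMap _ S.g₁.toRingHom γ₁)⁻¹).val = (U.map S.π₁).map S.g₁ := by
        rw [← hg₁, Matrix.mul_assoc]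
        exact (congrArg _ (unitsMap _ S.g₁.toRingHom γ₁).mul_inv).trans (Matrix.mul_one _)
      rw [Units.val_mul, ← Matrix.mul_assoc, hinv, hUbar]
      exact hg₂)
  obtain ⟨α, β, u, ha⟩ := exists_eq_unitsMap_mul_diagOne_mul S.g₁.toRingHom S.g₂.toRingHom hsurj a
  obtain ⟨b₁, b₂, hb⟩ := S.exists_eq_mul_blockUnit_mul hsurj α (diagOne (Fin k) u) β b
  rw [ha, hb, inv_mul_eq_iff_eq_mul] at hc
  have hc' : unitsMap _ S.g₁.toRingHom (γ₁ * upperUnit α b₁) * blockUnit (diagOne (Fin k) u) 1 =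
      unitsMap _ S.g₂.toRingHom (γ₂ * (upperUnit β b₂)⁻¹) := by
    rw [map_mul, map_mul, map_inv, hc]
    group
  have hu : u ∈ S.W := by
    -- The identity above is a change of bases from gluing along the identity to gluing along
    -- diag(u, 1, …, 1), so M(u) is stably free.
    refine hW u (k + m) ?_
    have := S.isoClass_matrixGlue_congr (a := blockUnit (diagOne (Fin k) 1) 1) _ _
      (by rw [hc', diagOne, map_one, blockUnit_one, blockUnit_one, one_mul])
    rw [isoClass_matrixGlue_blockUnit, isoClass_matrixGlue_blockUnit, isoClass_matrixGlue_diagOne,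
      isoClass_matrixGlue_diagOne, isoClass_matrixGlue_one, isoClass_M_one, isoClass_pi] at this
    rw [add_smul, ← add_assoc, ← add_assoc, this]
  obtain ⟨w₁, w₂, rfl⟩ := hu
  have hD : blockUnit (diagOne (Fin k) (Units.map (S.g₁ : Λ₁ →* Λbar) w₁ *
      Units.map (S.g₂ : Λ₂ →* Λbar) w₂)) (1 : (Matrix (Fin m) (Fin m) Λbar)ˣ) =
      unitsMap _ S.g₁.toRingHom (upperUnit (diagOne (Fin k) w₁) 0) *
        unitsMap _ S.g₂.toRingHom (upperUnit (diagOne (Fin k) w₂) 0) := by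
    rw [upperUnit_zero, upperUnit_zero, unitsMap_blockUnit, unitsMap_blockUnit, blockUnit_mul,
      diagOne, diagOne, diagOne, unitsMap_blockUnit, unitsMap_blockUnit, unitsMap_scalarUnit,
      unitsMap_scalarUnit, blockUnit_mul, map_mul]
    simp only [map_one, mul_one]
    rfl
  -- The two unit factors of u are moved to their own sides. All corrections to γ₁ and γ₂ fix (0 |
  -- 1), so they remain completions.
  rw [hD, ← mul_assoc, ← map_mul, ← eq_mul_inv_iff_mul_eq, ← map_inv, ← map_mul] at hc'
  obtain ⟨g, hgl, hgr⟩ := S.exists_unit_of_unitsMap_eq hc'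
  refine ⟨g, S.matrix_ext ?_ ?_⟩
  · rw [Matrix.map_mul, hgl, Units.val_mul, Units.val_mul, ← Matrix.mul_assoc, ← Matrix.mul_assoc,
      hγ₁, fromCols_mul_upperUnit, fromCols_mul_upperUnit, fromCols_map,
      Matrix.map_zero _ (map_zero _), Matrix.map_one _ (map_zero _) (map_one _)]
  · rw [Matrix.map_mul, hgr, Units.val_mul, Units.val_mul, ← Matrix.mul_assoc, ← Matrix.mul_assoc,
      hγ₂, fromCols_mul_inv (fromCols_mul_upperUnit _ _),
      fromCols_mul_inv (fromCols_mul_upperUnit _ _), fromCols_map,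
      Matrix.map_zero _ (map_zero _), Matrix.map_one _ (map_zero _) (map_one _)]

/-- M(u) contains (z, 1) for a lift z of u⁻¹, so y₂ has a left inverse and is a unit by the
Noetherian hypothesis. Then g₁ y₁ is a unit; if z lifts its inverse, M(u) contains (1 - z y₁, 0),
whence 1 - z y₁ is a multiple c y₁ and c + z is a left inverse of y₁. -/
theorem exists_units_of_generator [IsNoetherianRing Λ₁] [IsNoetherianRing Λ₂]
    (hs : Function.Surjective S.g₁) (u : Λbarˣ) (y₁ : Λ₁) (y₂ : Λ₂) (hy : S.g₁ y₁ * u = S.g₂ y₂)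
    (hgen : ∀ x₁ x₂, S.g₁ x₁ * u = S.g₂ x₂ → ∃ c : Λ, S.π₁ c * y₁ = x₁ ∧ S.π₂ c * y₂ = x₂) :
    IsUnit y₁ ∧ IsUnit y₂ := by
  have hu₂ : IsUnit y₂ := by
    obtain ⟨z, hz⟩ := hs (u⁻¹ : Λbarˣ)
    obtain ⟨c, -, hc⟩ := hgen z 1 (by rw [hz, map_one, Units.inv_mul])
    exact IsUnit.of_mul_eq_one_right _ hc
  refine ⟨?_, hu₂⟩
  have hu₁ : IsUnit (S.g₁ y₁) := by
    have : S.g₁ y₁ = S.g₂ y₂ * (u⁻¹ : Λbarˣ) := by rw [← hy, Units.mul_inv_cancel_right]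
    rw [this]
    exact (hu₂.map S.g₂).mul (Units.isUnit _)
  obtain ⟨t, ht⟩ := hu₁
  obtain ⟨z, hz⟩ := hs (t⁻¹ : Λbarˣ)
  obtain ⟨c, hc, -⟩ := hgen (1 - z * y₁) 0 (by
    rw [map_sub, map_mul, hz, ← ht, Units.inv_mul, map_one, sub_self, zero_mul, map_zero])
  refine IsUnit.of_mul_eq_one_right (S.π₁ c + z) ?_
  rw [add_mul, hc, sub_add_cancel]

/-- The image of 1 generates M(u). Its components are units w₁ and w₂ with g₁(w₁) u = g₂(w₂), which
exhibits u as a product of the required form. -/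
theorem mem_W_of_isoClass_eq [IsNoetherianRing Λ₁] [IsNoetherianRing Λ₂]
    (hsurj : Function.Surjective S.g₁ ∨ Function.Surjective S.g₂) {u : Λbarˣ}
    (h : isoClass Λ (S.M u) = isoClass Λ Λ) : u ∈ S.W := by
  obtain ⟨e⟩ := (isoClass_eq_iff Λ).mp h.symm
  let y : Λ₁ × Λ₂ := (e 1).1
  have hy : S.g₁ y.1 * u = S.g₂ y.2 := (e 1).2
  have hgen : ∀ x₁ x₂, S.g₁ x₁ * u = S.g₂ x₂ →
      ∃ c : Λ, S.π₁ c * y.1 = x₁ ∧ S.π₂ c * y.2 = x₂ := by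
    intro x₁ x₂ hx
    let x : S.M u := ⟨((x₁, x₂) : Λ₁ × Λ₂), hx⟩
    have hx' : e.symm x • e 1 = x := by
      rw [← map_smul, smul_eq_mul, mul_one, LinearEquiv.apply_symm_apply]
    have h2 : ((S.π₁ (e.symm x) * y.1, S.π₂ (e.symm x) * y.2) : Λ₁ × Λ₂) = (x₁, x₂) :=
      congrArg Subtype.val hx'
    exact ⟨_, (Prod.ext_iff.mp h2).1, (Prod.ext_iff.mp h2).2⟩
  have hunits : IsUnit y.1 ∧ IsUnit y.2 := by
    rcases hsurj with hs | hs
    · exact S.exists_units_of_generator hs u _ _ hy hgen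
    · refine (S.swap.exists_units_of_generator hs u⁻¹ y.2 y.1 ?_ ?_).symm
      · change S.g₂ y.2 * _ = S.g₁ y.1
        rw [← hy, Units.mul_inv_cancel_right]
      · intro x₂ x₁ hx
        have hx : S.g₂ x₂ * (u⁻¹ : Λbarˣ) = S.g₁ x₁ := hx
        obtain ⟨c, h1, h2⟩ := hgen x₁ x₂ (by rw [← hx, Units.inv_mul_cancel_right])
        exact ⟨c, h2, h1⟩
  obtain ⟨⟨w₁, hw₁⟩, ⟨w₂, hw₂⟩⟩ := hunits
  refine ⟨w₁⁻¹, w₂, ?_⟩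
  rw [map_inv, eq_inv_mul_iff_mul_eq]
  refine Units.ext ?_
  change S.g₁ w₁ * u = S.g₂ w₂
  rw [hw₁, hw₂, hy]

end FibreProduct

end CriterionConverse

end Orders

namespace Orders

/-! ### The cancellation criterion and the count of the kernel -/

section CancellationCriterion

variable {R : Type v} [CommRing R] {Λ Λ₁ Λ₂ : Type u} {Λbar : Type w}
  [Ring Λ] [Ring Λ₁] [Ring Λ₂] [Ring Λbar]
  [Algebra R Λ] [Algebra R Λ₁] [Algebra R Λ₂] [Algebra R Λbar]
  [IsDedekindDomain R] [Module.Finite R Λ] [Module.Finite R Λ₁] [Module.Finite R Λ₂]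
  {r : R} [Finite (R ⧸ Ideal.span {r})]

theorem isNoetherianRing_of_finite (R : Type*) [CommRing R] [IsNoetherianRing R] (Λ : Type*)
    [Ring Λ] [Algebra R Λ] [Module.Finite R Λ] : IsNoetherianRing Λ :=
  have : IsNoetherian R Λ := isNoetherian_of_isNoetherianRing_of_finite R Λ
  isNoetherian_of_tower R this

namespace FibreProduct

variable (S : FibreProduct R Λ Λ₁ Λ₂ Λbar)

theorem boundary_eq_zero_iff (hr : ∀ z : Λbar, r • z = 0)
    (hsurj : Function.Surjective S.g₁ ∨ Function.Surjective S.g₂) (u : Λbarˣ) :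
    S.boundary hr hsurj (Additive.ofMul u) = 0 ↔ ∃ m : ℕ,
      isoClass Λ (S.M u) + m • isoClass Λ Λ = isoClass Λ Λ + m • isoClass Λ Λ :=
  LocallyFreeClassGroup.mk_eq_zero_iff

theorem W_subset (hr : ∀ z : Λbar, r • z = 0)
    (hsurj : Function.Surjective S.g₁ ∨ Function.Surjective S.g₂) :
    S.W ⊆ {u | S.boundary hr hsurj (Additive.ofMul u) = 0} := fun u hu =>
  (S.boundary_eq_zero_iff hr hsurj u).mpr ⟨0, by rw [S.isoClass_M_eq_of_mem_W hu]⟩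

/-- The kernel of ∂ consists of the u with M(u) stably free, and `W` of those with M(u) free.
Cancellation over Λ identifies the two; conversely this identification is the hypothesis that
`hasMatrixSFC` needs. -/
theorem hasSFC_iff [Finite Λbar] (hr : ∀ z : Λbar, r • z = 0)
    (hsurj : Function.Surjective S.g₁ ∨ Function.Surjective S.g₂) :
    HasSFC Λ ↔ HasSFC Λ₁ ∧ HasSFC Λ₂ ∧
      S.W = {u | S.boundary hr hsurj (Additive.ofMul u) = 0} := by
  have := isNoetherianRing_of_finite R Λ
  have := isNoetherianRing_of_finite R Λ₁
  have := isNoetherianRing_of_finite R Λ₂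
  constructor
  · intro h
    have hM := hasMatrixSFC_of_hasSFC h
    refine ⟨hasSFC_of_hasMatrixSFC (S.hasMatrixSFC_fst hsurj hM),
      hasSFC_of_hasMatrixSFC (S.swap.hasMatrixSFC_fst hsurj.symm hM),
      (S.W_subset hr hsurj).antisymm fun u hu => ?_⟩
    obtain ⟨m, hm⟩ := (S.boundary_eq_zero_iff hr hsurj u).mp hu
    have := (S.isLocallyFree_M hr hsurj u).finite
    have hfin : Module.Finite Λ (S.M u) := Module.Finite.of_restrictScalars_finite R Λ _
    rw [← succ_nsmul', ← isoClass_pi, ← isoClass_pi, ← isoClass_prod, isoClass_eq_iff] at hm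
    obtain ⟨e⟩ := h (S.M u) hfin m 1 hm
    exact S.mem_W_of_isoClass_eq hsurj ((isoClass_eq_iff Λ).mpr
      ⟨e.trans (LinearEquiv.funUnique (Fin 1) Λ Λ)⟩)
  · rintro ⟨h₁, h₂, hW⟩
    refine hasSFC_of_hasMatrixSFC (S.hasMatrixSFC hsurj (hasMatrixSFC_of_hasSFC h₁)
      (hasMatrixSFC_of_hasSFC h₂) fun u m hm => ?_)
    rw [hW]
    exact (S.boundary_eq_zero_iff hr hsurj u).mpr ⟨m, hm⟩

theorem exact_boundary [Finite Λbar] [Module.IsTorsionFree R Λ₁] [Module.IsTorsionFree R Λ₂]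
    (hr : ∀ z : Λbar, r • z = 0)
    (hsurj : Function.Surjective S.g₁ ∨ Function.Surjective S.g₂) :
    Function.Exact (S.boundary hr hsurj) ((classGroupMap S.π₁).prod (classGroupMap S.π₂)) := by
  intro c
  constructor
  · intro hc
    exact exists_boundary_eq S hr hsurj c (congrArg Prod.fst hc) (congrArg Prod.snd hc)
  · rintro ⟨u, rfl⟩
    exact Prod.ext (classGroupMap_boundary S hr hsurj u).1 (classGroupMap_boundary S hr hsurj u).2

theorem card_ker_boundary_mul_card [Finite Λbar] [Module.IsTorsionFree R Λ₁]
    [Module.IsTorsionFree R Λ₂] (hr0 : r ≠ 0) (hr : ∀ z : Λbar, r • z = 0)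
    (hsurj : Function.Surjective S.g₁ ∨ Function.Surjective S.g₂) :
    Nat.card (S.boundary hr hsurj).ker * Nat.card (LocallyFreeClassGroup R Λ) =
      Nat.card (LocallyFreeClassGroup R Λ₁) * Nat.card (LocallyFreeClassGroup R Λ₂) *
        Nat.card Λbarˣ := by
  let d := S.boundary hr hsurj
  let ρ := (classGroupMap S.π₁).prod (classGroupMap S.π₂)
  have hρ : Function.Surjective ρ := fun ⟨c₁, c₂⟩ => by
    obtain ⟨c, h₁, h₂⟩ := exists_classGroupMap_eq S hr0 hr c₁ c₂
    exact ⟨c, Prod.ext h₁ h₂⟩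
  have h1 : Nat.card Λbarˣ = Nat.card d.range * Nat.card d.ker := by
    rw [← Nat.card_congr (QuotientAddGroup.quotientKerEquivRange d).toEquiv]
    exact AddSubgroup.card_eq_card_quotient_mul_card_addSubgroup d.ker
  have h2 : Nat.card (LocallyFreeClassGroup R Λ) =
      Nat.card (LocallyFreeClassGroup R Λ₁ × LocallyFreeClassGroup R Λ₂) * Nat.card ρ.ker := by
    rw [← Nat.card_congr (QuotientAddGroup.quotientKerEquivOfSurjective ρ hρ).toEquiv]
    exact AddSubgroup.card_eq_card_quotient_mul_card_addSubgroup ρ.ker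
  have h3 : ρ.ker = d.range := by
    ext c
    exact S.exact_boundary hr hsurj c
  rw [h2, h3, h1, Nat.card_prod]
  ring

end FibreProduct

end CancellationCriterion

end Orders

namespace Orders

/-! ### Full subgroups of rational vector spaces -/

section FullSubgroups

variable {V W : Type*} [AddCommGroup V] [AddCommGroup W]

/-- A subgroup is full if every element has a nonzero multiple in it. -/
def IsFull (X : Submodule ℤ V) : Prop := ∀ v, ∃ n : ℤ, n ≠ 0 ∧ n • v ∈ X

theorem IsFull.exists_smul_mem {L Y : Submodule ℤ V} (hL : IsFull L) (hY : Y.FG) :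
    ∃ n : ℤ, n ≠ 0 ∧ ∀ y ∈ Y, n • y ∈ L := by
  induction Y, hY using Submodule.fg_induction with
  | singleton v =>
    obtain ⟨n, hn, hv⟩ := hL v
    refine ⟨n, hn, fun y hy => ?_⟩
    obtain ⟨c, rfl⟩ := Submodule.mem_span_singleton.mp hy
    rw [smul_comm]
    exact L.smul_mem c hv
  | sup Y Z _ _ hY hZ =>
    obtain ⟨m, hm, hY⟩ := hY
    obtain ⟨n, hn, hZ⟩ := hZ
    refine ⟨m * n, mul_ne_zero hm hn, fun y hy => ?_⟩
    obtain ⟨a, ha, b, hb, rfl⟩ := Submodule.mem_sup.mp hy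
    rw [smul_add]
    refine L.add_mem ?_ ?_
    · rw [mul_comm, mul_smul]
      exact L.smul_mem _ (hY a ha)
    · rw [mul_smul]
      exact L.smul_mem _ (hZ b hb)

/-- The image of U in V / L is finitely generated and torsion, hence finite, and a subgroup
containing L is determined by its image there. -/
theorem finite_setOf_between {L U : Submodule ℤ V} (hL : IsFull L) (hU : U.FG) :
    {X : Submodule ℤ V | L ≤ X ∧ X ≤ U}.Finite := by
  have hfin : ((U.map L.mkQ : Submodule ℤ (V ⧸ L)) : Set (V ⧸ L)).Finite := by
    have : Module.Finite ℤ (U.map L.mkQ) := Module.Finite.iff_fg.mpr (hU.map _)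
    refine @Set.toFinite _ _ (Module.finite_of_fg_torsion (U.map L.mkQ) ?_)
    rintro ⟨_, v, hv, rfl⟩
    obtain ⟨n, hn, hnv⟩ := hL v
    refine ⟨⟨n, mem_nonZeroDivisors_of_ne_zero hn⟩, Subtype.ext ?_⟩
    change n • L.mkQ v = 0
    rw [← map_smul, Submodule.mkQ_apply, Submodule.Quotient.mk_eq_zero]
    exact hnv
  refine Set.Finite.of_finite_image
    (f := fun X => ((X.map L.mkQ : Submodule ℤ (V ⧸ L)) : Set (V ⧸ L))) (hfin.finite_subsets.subset ?_) ?_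
  · rintro _ ⟨X, hX, rfl⟩
    exact Submodule.map_mono hX.2
  · intro X hX Y hY h
    have h' : X.map L.mkQ = Y.map L.mkQ := SetLike.coe_injective h
    have := congrArg (Submodule.comap L.mkQ) h'
    rwa [Submodule.comap_map_mkQ, Submodule.comap_map_mkQ, sup_eq_right.mpr hX.1,
      sup_eq_right.mpr hY.1] at this

end FullSubgroups

/-! ### Lattices in direct sums -/

section Lattices

variable {A : Type*} [Ring A] {V V' V'' : Type*} [AddCommGroup V] [Module A V]
  [AddCommGroup V'] [Module A V'] [AddCommGroup V''] [Module A V'']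

/-- A full finitely generated subgroup of `V` which is stable under `O ⊆ A`. -/
structure IsLattice (O : Submodule ℤ A) (X : Submodule ℤ V) : Prop where
  fg : X.FG
  isFull : IsFull X
  smul_mem : ∀ a ∈ O, ∀ x ∈ X, a • x ∈ X

/-- The image of a subgroup under an `A`-linear map. -/
abbrev mapInt (X : Submodule ℤ V) (f : V →ₗ[A] V') : Submodule ℤ V' :=
  X.map (f.restrictScalars ℤ)

theorem mapInt_comp (X : Submodule ℤ V) (f : V →ₗ[A] V') (g : V' →ₗ[A] V'') :
    mapInt X (g ∘ₗ f) = mapInt (mapInt X f) g :=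
  Submodule.map_comp (f.restrictScalars ℤ) (g.restrictScalars ℤ) X

theorem IsLattice.mapInt_of_surjective {O : Submodule ℤ A} {X : Submodule ℤ V}
    (hX : IsLattice O X) (f : V →ₗ[A] V') (hf : Function.Surjective f) :
    IsLattice O (mapInt X f) where
  fg := hX.fg.map _
  isFull v := by
    obtain ⟨w, rfl⟩ := hf v
    obtain ⟨n, hn, hw⟩ := hX.isFull w
    exact ⟨n, hn, n • w, hw, map_zsmul f n w⟩
  smul_mem := by
    rintro a ha _ ⟨x, hx, rfl⟩
    exact ⟨a • x, hX.smul_mem a ha x hx, map_smul f a x⟩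

theorem IsLattice.comap_of_injective {O : Submodule ℤ A} {X : Submodule ℤ V}
    (hX : IsLattice O X) (f : V' →ₗ[A] V) (hf : Function.Injective f) :
    IsLattice O (X.comap (f.restrictScalars ℤ)) where
  fg := by
    refine Submodule.fg_of_fg_map_injective (f.restrictScalars ℤ) hf ?_
    exact hX.fg.of_le (Submodule.map_comap_le _ _)
  isFull v := by
    obtain ⟨n, hn, hw⟩ := hX.isFull (f v)
    exact ⟨n, hn, by rw [Submodule.mem_comap, map_smul]; exact hw⟩
  smul_mem a ha x hx := by
    change f (a • x) ∈ X
    rw [map_smul]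
    exact hX.smul_mem a ha _ hx

/-- Up to automorphisms there are only finitely many lattices in `V`. -/
def FinitelyManyLattices (O : Submodule ℤ A) (V : Type*) [AddCommGroup V] [Module A V] : Prop :=
  ∃ F : Set (Submodule ℤ V), F.Finite ∧ ∀ X : Submodule ℤ V, IsLattice O X →
    ∃ φ : V ≃ₗ[A] V, mapInt X φ.toLinearMap ∈ F

theorem FinitelyManyLattices.of_equiv {O : Submodule ℤ A} (h : FinitelyManyLattices O V)
    (e : V ≃ₗ[A] V') : FinitelyManyLattices O V' := by
  obtain ⟨F, hF, h⟩ := h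
  refine ⟨(fun X => mapInt X e.toLinearMap) '' F, hF.image _, fun X hX => ?_⟩
  obtain ⟨φ, hφ⟩ := h _ (hX.mapInt_of_surjective e.symm.toLinearMap e.symm.surjective)
  refine ⟨(e.symm.trans φ).trans e, _, hφ, ?_⟩
  simp only [← mapInt_comp]
  rfl

theorem finitelyManyLattices_of_subsingleton [Subsingleton V] (O : Submodule ℤ A) :
    FinitelyManyLattices O V :=
  ⟨Set.univ, Set.toFinite _, fun _ _ => ⟨LinearEquiv.refl A V, trivial⟩⟩

variable [Algebra ℚ A] [Module ℚ V'] [IsSemisimpleRing A]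

/-- Lattices in `V' ⊕ V''` with a given intersection with `V'` and a given projection to `V''`. -/
theorem exists_finite_extensions {O : Submodule ℤ A} (hO : IsFull O) {X' : Submodule ℤ V'}
    {X'' : Submodule ℤ V''} (hX' : IsLattice O X') (hX'' : IsLattice O X'') :
    ∃ F : Set (Submodule ℤ (V' × V'')), F.Finite ∧ ∀ X : Submodule ℤ (V' × V''),
      IsLattice O X → X.comap ((LinearMap.inl A V' V'').restrictScalars ℤ) = X' →
      mapInt X (LinearMap.snd A V' V'') = X'' →
      ∃ φ : (V' × V'') ≃ₗ[A] (V' × V''), mapInt X φ.toLinearMap ∈ F := by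
  obtain ⟨k, g, hg⟩ := Submodule.fg_iff_exists_fin_generating_family.mp hX''.fg
  have hgX : ∀ i, g i ∈ X'' := fun i => hg ▸ Submodule.subset_span ⟨i, rfl⟩
  let p : (Fin k → A) →ₗ[A] V'' := Fintype.linearCombination A g
  have hgp : X'' ≤ (LinearMap.range p).restrictScalars ℤ := by
    rw [← hg, Submodule.span_le]
    rintro _ ⟨i, rfl⟩
    exact ⟨Pi.single i 1, by simp [p]⟩
  have hp : Function.Surjective p := by
    intro v
    obtain ⟨n, hn, hv⟩ := hX''.isFull v
    obtain ⟨a, ha⟩ := hgp hv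
    refine ⟨algebraMap ℚ A (n : ℚ)⁻¹ • a, ?_⟩
    rw [map_smul, ha, ← Int.cast_smul_eq_zsmul A n v, smul_smul, ← map_intCast (algebraMap ℚ A),
      ← map_mul, inv_mul_cancel₀ (Int.cast_ne_zero.mpr hn), map_one, one_smul]
  have := Module.projective_of_isSemisimpleRing A V''
  obtain ⟨s, hs⟩ := Module.projective_lifting_property p LinearMap.id hp
  have hpi : IsFull (Submodule.pi Set.univ fun _ : Fin k => O) := by
    intro v
    choose n hn hv using fun i => hO (v i)
    refine ⟨∏ i, n i, Finset.prod_ne_zero_iff.mpr fun i _ => hn i, fun i _ => ?_⟩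
    rw [Pi.smul_apply, ← Finset.prod_erase_mul _ _ (Finset.mem_univ i), mul_smul]
    exact O.smul_mem _ (hv i)
  -- Semisimplicity splits p by s, and r makes r s(X'') integral with respect to O. Both depend on
  -- X'' alone, so the bounds below are uniform in X.
  obtain ⟨r, hr, hrs⟩ := hpi.exists_smul_mem (hX''.fg.map (s.restrictScalars ℤ))
  let c : V' →ₗ[ℤ] V' := (((r : ℚ)⁻¹ • LinearMap.id : V' →ₗ[ℚ] V')).restrictScalars ℤ
  refine ⟨{Z | X'.prod (X''.map (r • LinearMap.id)) ≤ Z ∧ Z ≤ (X'.map c).prod X''},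
    finite_setOf_between ?_ ((hX'.fg.map _).prod hX''.fg), fun X hX h' h'' => ?_⟩
  · rintro ⟨v, w⟩
    obtain ⟨m, hm, hv⟩ := hX'.isFull v
    obtain ⟨n, hn, hw⟩ := hX''.isFull w
    refine ⟨r * n * m, mul_ne_zero (mul_ne_zero hr hn) hm, ?_, ?_⟩
    · change (r * n * m) • v ∈ X'
      rw [mul_smul]
      exact X'.smul_mem _ hv
    · refine ⟨(m * n) • w, ?_, ?_⟩
      · rw [mul_smul]
        exact X''.smul_mem _ hw
      · change r • (m * n) • w = (r * n * m) • w
        rw [smul_smul]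
        congr 1
        ring
  have hlift : ∀ i, ∃ x ∈ X, x.2 = g i := by
    intro i
    have := hgX i
    rw [← h''] at this
    exact this
  choose x hx hxg using hlift
  -- A section of the projection built from lifts to X of the generators of X''; r times it maps X''
  -- into X. The shear φ below straightens it, so that φ(X) lies between X' ⊕ r X'' and r⁻¹ X' ⊕
  -- X''.
  let σ : V'' →ₗ[A] V' × V'' := Fintype.linearCombination A x ∘ₗ s
  have hσ : ∀ v, (σ v).2 = v := by
    intro v
    have h1 : (σ v).2 = p (s v) := by
      simp [σ, p, Fintype.linearCombination_apply, Prod.snd_sum, hxg]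
    rw [h1]
    exact LinearMap.congr_fun hs v
  have hσX : ∀ v ∈ X'', r • σ v ∈ X := by
    intro v hv
    have h1 := hrs (s v) ⟨v, hv, rfl⟩
    have h2 : r • σ v = ∑ i, (r • s v) i • x i := by
      simp only [σ, LinearMap.comp_apply, Fintype.linearCombination_apply, Finset.smul_sum,
        Pi.smul_apply, smul_assoc]
    rw [h2]
    exact X.sum_mem fun i _ => hX.smul_mem _ (h1 i trivial) _ (hx i)
  let θ : V'' →ₗ[A] V' := LinearMap.fst A V' V'' ∘ₗ σ
  let φ : (V' × V'') ≃ₗ[A] (V' × V'') := LinearEquiv.ofLinearMap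
    ((LinearMap.fst A V' V'' - θ ∘ₗ LinearMap.snd A V' V'').prod (LinearMap.snd A V' V''))
    ((LinearMap.fst A V' V'' + θ ∘ₗ LinearMap.snd A V' V'').prod (LinearMap.snd A V' V''))
    (LinearMap.ext fun v => by ext <;> simp) (LinearMap.ext fun v => by ext <;> simp)
  have hφ : ∀ v, φ v = (v.1 - (σ v.2).1, v.2) := fun v => rfl
  have hmem : ∀ v ∈ X'', ((0 : V'), r • v) ∈ mapInt X φ.toLinearMap := by
    intro v hv
    refine ⟨r • σ v, hσX v hv, ?_⟩
    change φ (r • σ v) = _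
    rw [map_zsmul, hφ, hσ]
    simp
  have hinl : ∀ v ∈ X', (v, (0 : V'')) ∈ mapInt X φ.toLinearMap := by
    intro v hv
    rw [← h'] at hv
    refine ⟨(v, 0), hv, ?_⟩
    change φ (v, 0) = _
    simp [hφ]
  refine ⟨φ, ?_, ?_⟩
  · rintro ⟨v, w⟩ ⟨hv, w, hw, rfl⟩
    have := add_mem (hinl v hv) (hmem w hw)
    simpa using this
  · rintro _ ⟨z, hz, rfl⟩
    have hz2 : z.2 ∈ X'' := h'' ▸ ⟨z, hz, rfl⟩
    refine ⟨⟨r • (φ z).1, ?_, ?_⟩, hz2⟩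
    · have h1 : r • z - r • σ z.2 ∈ X := sub_mem (X.smul_mem r hz) (hσX _ hz2)
      rw [← h']
      change (r • (φ z).1, (0 : V'')) ∈ X
      convert h1 using 1
      refine Prod.ext ?_ ?_
      · simp [hφ, smul_sub]
      · simp [hσ]
    · change (r : ℚ)⁻¹ • r • (φ z).1 = (φ z).1
      rw [← Int.cast_smul_eq_zsmul ℚ r, smul_smul, inv_mul_cancel₀ (Int.cast_ne_zero.mpr hr),
        one_smul]

/-- Automorphisms of the two summands bring the intersection with V' and the projection to V'' into
finite lists; for each such pair, finitely many lattices remain up to shears. -/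
theorem FinitelyManyLattices.prod {O : Submodule ℤ A} (hO : IsFull O)
    (h' : FinitelyManyLattices O V') (h'' : FinitelyManyLattices O V'') :
    FinitelyManyLattices O (V' × V'') := by
  obtain ⟨F', hF', h'⟩ := h'
  obtain ⟨F'', hF'', h''⟩ := h''
  classical
  let G : Submodule ℤ V' × Submodule ℤ V'' → Set (Submodule ℤ (V' × V'')) := fun Y =>
    if h : IsLattice O Y.1 ∧ IsLattice O Y.2 then
      (exists_finite_extensions hO h.1 h.2).choose else ∅
  refine ⟨⋃ Y ∈ F' ×ˢ F'', G Y, (hF'.prod hF'').biUnion fun Y _ => ?_, fun X hX => ?_⟩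
  · by_cases h : IsLattice O Y.1 ∧ IsLattice O Y.2
    · simp only [G, dif_pos h]
      exact (exists_finite_extensions hO h.1 h.2).choose_spec.1
    · simp [G, dif_neg h]
  · obtain ⟨φ', hφ'⟩ := h' _ (hX.comap_of_injective (LinearMap.inl A V' V'')
      LinearMap.inl_injective)
    obtain ⟨φ'', hφ''⟩ := h'' _ (hX.mapInt_of_surjective (LinearMap.snd A V' V'')
      LinearMap.snd_surjective)
    let φ := φ'.prodCongr φ''
    let Z := mapInt X φ.toLinearMap
    have hZ : IsLattice O Z := hX.mapInt_of_surjective _ φ.surjective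
    have hZ' : Z.comap ((LinearMap.inl A V' V'').restrictScalars ℤ) =
        mapInt (X.comap ((LinearMap.inl A V' V'').restrictScalars ℤ)) φ'.toLinearMap := by
      ext v
      constructor
      · rintro ⟨⟨a, b⟩, hx, hxv⟩
        have hxv : (φ' a, φ'' b) = (v, (0 : V'')) := hxv
        rw [Prod.mk.injEq, LinearEquiv.map_eq_zero_iff] at hxv
        obtain ⟨rfl, rfl⟩ := hxv
        exact ⟨a, hx, rfl⟩
      · rintro ⟨a, ha, rfl⟩
        refine ⟨(a, 0), ha, ?_⟩
        change (φ' a, φ'' 0) = (φ' a, (0 : V''))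
        rw [map_zero]
    have hZ'' : mapInt Z (LinearMap.snd A V' V'') =
        mapInt (mapInt X (LinearMap.snd A V' V'')) φ''.toLinearMap := by
      simp only [Z, ← mapInt_comp]
      rfl
    have hl : IsLattice O (mapInt (X.comap ((LinearMap.inl A V' V'').restrictScalars ℤ))
        φ'.toLinearMap) ∧
        IsLattice O (mapInt (mapInt X (LinearMap.snd A V' V'')) φ''.toLinearMap) := by
      rw [← hZ', ← hZ'']
      exact ⟨hZ.comap_of_injective _ LinearMap.inl_injective,
        hZ.mapInt_of_surjective _ LinearMap.snd_surjective⟩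
    obtain ⟨ψ, hψ⟩ := (exists_finite_extensions hO hl.1 hl.2).choose_spec.2 Z hZ hZ' hZ''
    refine ⟨φ.trans ψ, Set.mem_biUnion (Set.mk_mem_prod hφ' hφ'') ?_⟩
    simp only [G]
    rw [dif_pos hl]
    convert hψ using 1
    exact mapInt_comp X φ.toLinearMap ψ.toLinearMap

end Lattices

end Orders

namespace Orders

/-! ### Simultaneous approximation -/

section Approximation

/-- Simultaneous approximation by the pigeonhole principle. -/
theorem exists_approximation {ι : Type*} [Fintype ι] {f : (ι → ℚ) → ℚ} (hf : ContinuousAt f 0)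
    (h0 : f 0 = 0) : ∃ M : ℕ, ∀ x : ι → ℚ, ∃ k : ℕ, 0 < k ∧ k ≤ M ∧ ∃ w : ι → ℤ,
      |f fun i => k * x i - w i| < 1 := by
  classical
  obtain ⟨δ, hδ, hfδ⟩ := Metric.continuousAt_iff.mp hf 1 one_pos
  obtain ⟨n, hn⟩ := exists_nat_one_div_lt hδ
  let Q := n + 1
  have hQ : (0 : ℚ) < Q := by positivity
  refine ⟨Q ^ Fintype.card ι, fun x => ?_⟩
  -- The unit cube is cut into Q ^ card ι boxes, one fewer than the number of multiples considered.
  -- Two multiples with fractional parts in the same box differ by an integral vector up to an error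
  -- below 1 / Q in each coordinate.
  obtain ⟨k₁, hk₁, k₂, hk₂, hne, heq⟩ := Finset.exists_ne_map_eq_of_card_lt_of_maps_to
    (s := Finset.range (Q ^ Fintype.card ι + 1))
    (t := Fintype.piFinset fun _ : ι => Finset.range Q)
    (f := fun k i => ⌊Q * Int.fract (k * x i)⌋₊) (by simp) (fun k _ => by
      rw [Finset.mem_coe, Fintype.mem_piFinset]
      intro i
      rw [Finset.mem_range, Nat.floor_lt (by positivity)]
      exact mul_lt_of_lt_one_right hQ (Int.fract_lt_one _))
  wlog hlt : k₁ < k₂ generalizing k₁ k₂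
  · exact this k₂ hk₂ k₁ hk₁ hne.symm heq.symm (by omega)
  refine ⟨k₂ - k₁, by omega, by rw [Finset.mem_range] at hk₂; omega,
    fun i => ⌊k₂ * x i⌋ - ⌊k₁ * x i⌋, ?_⟩
  have hdist := @hfδ (fun i => (k₂ - k₁ : ℕ) * x i - ((⌊k₂ * x i⌋ - ⌊k₁ * x i⌋ : ℤ) : ℚ)) (by
    refine lt_of_le_of_lt ((dist_pi_le_iff (by positivity)).mpr fun i => ?_) hn
    have h1 : ((k₂ - k₁ : ℕ) * x i - ((⌊k₂ * x i⌋ - ⌊k₁ * x i⌋ : ℤ) : ℚ)) =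
        Int.fract (k₂ * x i) - Int.fract (k₁ * x i) := by
      rw [Nat.cast_sub hlt.le, Int.fract, Int.fract]
      push_cast
      ring
    have h2 : |Q * Int.fract (k₂ * x i) - Q * Int.fract (k₁ * x i)| < 1 := by
      refine Int.abs_sub_lt_one_of_floor_eq_floor ?_
      have h3 := congrFun heq i
      have h4 : ∀ k : ℕ, (⌊Q * Int.fract (k * x i)⌋₊ : ℤ) = ⌊Q * Int.fract (k * x i)⌋ := fun k =>
        Int.natCast_floor_eq_floor (by positivity)
      rw [← h4, ← h4]
      exact congrArg _ h3.symm
    rw [← mul_sub, abs_mul, abs_of_pos hQ, mul_comm, ← lt_div_iff₀ hQ] at h2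
    rw [h1, Pi.zero_apply, Rat.dist_eq]
    have h5 : ((|Int.fract (k₂ * x i) - Int.fract (k₁ * x i)| : ℚ) : ℝ) ≤ ((1 / Q : ℚ) : ℝ) := by
      exact_mod_cast h2.le
    convert h5 using 1
    · push_cast
      rw [sub_zero]
    · push_cast [Q]
      rfl)
  rw [h0, Rat.dist_eq, Rat.cast_zero, sub_zero] at hdist
  exact_mod_cast hdist

end Approximation

/-! ### Endomorphisms of simple modules and their determinants -/

section SimpleModules

variable {A : Type*} [Ring A] [Algebra ℚ A] {V : Type*} [AddCommGroup V] [Module A V] [Module ℚ V]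
  [IsScalarTower ℚ A V]

/-- The determinant over `ℚ` of an `A`-linear endomorphism. -/
noncomputable def endDet (d : Module.End A V) : ℚ := LinearMap.det (d.restrictScalars ℚ)

theorem endDet_mul (d d' : Module.End A V) : endDet (d * d') = endDet d * endDet d' :=
  LinearMap.det_comp (d.restrictScalars ℚ) (d'.restrictScalars ℚ)

theorem endDet_ne_zero [IsSimpleModule A V] {d : Module.End A V} (hd : d ≠ 0) : endDet d ≠ 0 := by
  let e := LinearEquiv.ofBijective d (LinearMap.bijective_of_ne_zero hd)
  exact (e.restrictScalars ℚ).isUnit_det'.ne_zero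

theorem endDet_zero [FiniteDimensional ℚ V] [Nontrivial V] : endDet (0 : Module.End A V) = 0 := LinearMap.det_zero''

/-- The matrices of a finitely generated group of endomorphisms have a common denominator. Bounded
denominators for the determinants allow choosing a nonzero element of least determinant. -/
theorem exists_endDet_eq_natCast [FiniteDimensional ℚ V] (Y : Submodule ℤ (Module.End A V)) (hY : Y.FG) :
    ∃ q : ℚ, 0 < q ∧ ∀ y ∈ Y, ∃ k : ℕ, q * |endDet y| = k := by
  let b := Module.finBasis ℚ V
  let I := Fin (Module.finrank ℚ V)
  let L : Submodule ℤ (Matrix I I ℚ) :=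
    LinearMap.range ((algebraMap ℤ ℚ).mapMatrix.toAddMonoidHom.toIntLinearMap :
      Matrix I I ℤ →ₗ[ℤ] Matrix I I ℚ)
  have hL : IsFull L := by
    intro M
    refine ⟨∏ i, ∏ j, ((M i j).den : ℤ), Finset.prod_ne_zero_iff.mpr fun i _ =>
      Finset.prod_ne_zero_iff.mpr fun j _ => by exact_mod_cast (M i j).den_ne_zero,
      Matrix.of fun i j => (∏ i' ∈ Finset.univ.erase i, ∏ j', ((M i' j').den : ℤ)) *
        (∏ j' ∈ Finset.univ.erase j, ((M i j').den : ℤ)) * (M i j).num, ?_⟩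
    ext i j
    rw [← Finset.prod_erase_mul _ _ (Finset.mem_univ i),
      ← Finset.prod_erase_mul Finset.univ (fun j => ((M i j).den : ℤ)) (Finset.mem_univ j)]
    change (((_ * _ * (M i j).num : ℤ)) : ℚ) = (_ * (_ * _) : ℤ) • M i j
    rw [zsmul_eq_mul, ← mul_assoc, Int.cast_mul, Int.cast_mul _ ((M i j).den : ℤ), mul_assoc]
    congr 1
    exact_mod_cast (Rat.den_mul_eq_num (M i j)).symm
  let f : Module.End A V →ₗ[ℤ] Matrix I I ℚ :=
    ((LinearMap.toMatrix b b).toLinearMap.restrictScalars ℤ) ∘ₗ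
      (LinearMap.restrictScalarsₗ ℚ A V V ℤ)
  obtain ⟨n, hn, hnY⟩ := hL.exists_smul_mem (hY.map f)
  refine ⟨|(n : ℚ)| ^ Fintype.card I, by positivity, fun y hy => ?_⟩
  obtain ⟨M, hM⟩ := hnY _ ⟨y, hy, rfl⟩
  have hM : M.map (algebraMap ℤ ℚ) = n • LinearMap.toMatrix b b (y.restrictScalars ℚ) := hM
  refine ⟨M.det.natAbs, ?_⟩
  have h1 : (M.det : ℚ) = (n : ℚ) ^ Fintype.card I * endDet y := by
    rw [endDet, ← LinearMap.det_toMatrix b, ← Matrix.det_smul, Int.cast_smul_eq_zsmul, ← hM]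
    exact RingHom.map_det (algebraMap ℤ ℚ) M
  rw [← abs_pow, ← abs_mul, ← h1, Nat.cast_natAbs, Int.cast_abs]

theorem exists_forall_endDet_le [FiniteDimensional ℚ V] (Y : Submodule ℤ (Module.End A V)) (hY : Y.FG) (hY0 : Y ≠ ⊥) :
    ∃ y ∈ Y, y ≠ 0 ∧ ∀ z ∈ Y, z ≠ 0 → |endDet y| ≤ |endDet z| := by
  classical
  obtain ⟨q, hq, hk⟩ := exists_endDet_eq_natCast Y hY
  obtain ⟨y₀, hy₀, hne⟩ := Submodule.exists_mem_ne_zero_of_ne_bot hY0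
  have hex : ∃ k : ℕ, ∃ y ∈ Y, y ≠ 0 ∧ q * |endDet y| = k := by
    obtain ⟨k, hk⟩ := hk y₀ hy₀
    exact ⟨k, y₀, hy₀, hne, hk⟩
  obtain ⟨y, hy, hy0, hyk⟩ := Nat.find_spec hex
  refine ⟨y, hy, hy0, fun z hz hz0 => ?_⟩
  obtain ⟨k, hkz⟩ := hk z hz
  have hle : Nat.find hex ≤ k := Nat.find_min' hex ⟨z, hz, hz0, hkz⟩
  refine le_of_mul_le_mul_left ?_ hq
  rw [hyk, hkz]
  exact_mod_cast hle

/-- V is a left ideal A e with e idempotent, and v₀ corresponds to e. For an element a e, right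
multiplication by a e is an endomorphism of this ideal sending e to e a e. Thus vectors of e V can
be traded for endomorphisms. -/
theorem exists_smul_mem_range_apply {A : Type*} [Ring A] [IsSemisimpleRing A] (V : Type*) [AddCommGroup V] [Module A V]
    [IsSimpleModule A V] :
    ∃ (v₀ : V) (e : A), v₀ ≠ 0 ∧ e • v₀ = v₀ ∧ ∀ v, ∃ d : Module.End A V, e • v = d v₀ := by
  obtain ⟨I, ⟨φ⟩⟩ := IsSemisimpleRing.exists_linearEquiv_ideal_of_isSimpleModule A V
  obtain ⟨e, he, rfl⟩ := IsSemisimpleRing.ideal_eq_span_idempotent I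
  let e₀ : Ideal.span {e} := ⟨e, Ideal.mem_span_singleton_self e⟩
  have hspan : ∀ x : Ideal.span {e}, ∃ a : A, x = a • e₀ := by
    intro x
    obtain ⟨a, ha⟩ := Ideal.mem_span_singleton'.mp x.2
    exact ⟨a, Subtype.ext ha.symm⟩
  refine ⟨φ.symm e₀, e, ?_, ?_, fun v => ?_⟩
  · intro h
    rw [LinearEquiv.map_eq_zero_iff] at h
    have := IsSimpleModule.nontrivial A V
    obtain ⟨v, hv⟩ := exists_ne (0 : V)
    obtain ⟨a, ha⟩ := hspan (φ v)
    rw [h, smul_zero, LinearEquiv.map_eq_zero_iff] at ha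
    exact hv ha
  · rw [← map_smul]
    exact congrArg _ (Subtype.ext he)
  · obtain ⟨a, ha⟩ := hspan (φ v)
    let ρ : Ideal.span {e} →ₗ[A] Ideal.span {e} :=
      LinearMap.toSpanSingleton A _ (a • e₀) ∘ₗ (Ideal.span {e}).subtype
    refine ⟨φ.symm.toLinearMap ∘ₗ ρ ∘ₗ φ.toLinearMap, ?_⟩
    simp only [LinearMap.comp_apply, LinearEquiv.coe_coe, LinearEquiv.apply_symm_apply]
    rw [LinearEquiv.eq_symm_apply, map_smul, ha]
    rfl

end SimpleModules

end Orders

namespace Orders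

/-! ### The Jordan–Zassenhaus theorem -/

section JordanZassenhaus

variable {A : Type*} [Ring A] [Algebra ℚ A]
  {V : Type*} [AddCommGroup V] [Module A V] [Module ℚ V]
  [IsScalarTower ℚ A V] [FiniteDimensional ℚ V]

theorem finite_moduleEnd : FiniteDimensional ℚ (Module.End A V) :=
  FiniteDimensional.of_injective (LinearMap.restrictScalarsₗ ℚ A V V ℚ)
    (LinearMap.restrictScalars_injective ℚ)

theorem exists_basis_mem_of_isFull {O : Submodule ℤ V} (hO : IsFull O) :
    ∃ (m : ℕ) (b : Module.Basis (Fin m) ℚ V), ∀ i, b i ∈ O := by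
  let b := Module.finBasis ℚ V
  choose n hn hb using fun i => hO (b i)
  refine ⟨_, b.isUnitSMul (w := fun i => (n i : ℚ)) fun i => (Int.cast_ne_zero.mpr (hn i)).isUnit,
    fun i => ?_⟩
  rw [Module.Basis.isUnitSMul_apply, Int.cast_smul_eq_zsmul]
  exact hb i

/-- The determinant is a continuous function of the coordinates vanishing at 0. The outcome is a
weak form of Euclidean division in the division algebra of endomorphisms. -/
theorem exists_endDet_approximation [IsSimpleModule A V] {m : ℕ}
    (t : Module.Basis (Fin m) ℚ (Module.End A V)) :
    ∃ M : ℕ, ∀ x : Module.End A V, ∃ k : ℕ, 0 < k ∧ k ≤ M ∧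
      ∃ w ∈ Submodule.span ℤ (Set.range t), |endDet (k • x - w)| < 1 := by
  have := IsSimpleModule.nontrivial A V
  let b := Module.finBasis ℚ V
  have hcont : Continuous fun c : Fin m → ℚ => endDet (∑ i, c i • t i) := by
    have h : ∀ c : Fin m → ℚ, endDet (∑ i, c i • t i) =
        (∑ i, c i • LinearMap.toMatrix b b ((t i).restrictScalars ℚ)).det := by
      intro c
      rw [endDet, ← LinearMap.det_toMatrix b]
      congr 1
      simp only [← map_smul, ← map_sum]
      congr 1
      ext v
      simp
    simp only [h]
    exact Continuous.matrix_det (by fun_prop)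
  obtain ⟨M, hM⟩ := exists_approximation hcont.continuousAt (by simp [endDet_zero])
  refine ⟨M, fun x => ?_⟩
  obtain ⟨k, hk, hkM, w, hw⟩ := hM (t.repr x)
  refine ⟨k, hk, hkM, ∑ i, w i • t i,
    Submodule.sum_mem _ fun i _ => Submodule.smul_mem _ _ (Submodule.subset_span ⟨i, rfl⟩), ?_⟩
  convert hw using 3
  simp only [sub_smul, Finset.sum_sub_distrib, mul_smul, ← Finset.smul_sum, t.sum_repr,
    Int.cast_smul_eq_zsmul, Nat.cast_smul_eq_nsmul]

/-- Inside the division algebra of endomorphisms, Y consists of the d with d v₀ in X. Let y be a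
nonzero element of Y with least determinant in absolute value. Weak Euclidean division shows M! Y ⊆
y T with M and T independent of X, so y⁻¹ X lies between two fixed full finitely generated
subgroups. -/
theorem finitelyManyLattices_of_isSimpleModule [FiniteDimensional ℚ A] [IsSemisimpleRing A]
    [IsSimpleModule A V] {O : Submodule ℤ A} (hO : IsFull O) : FinitelyManyLattices O V := by
  have := finite_moduleEnd (A := A) (V := V)
  obtain ⟨v₀, e, hv₀, hev₀, he⟩ := exists_smul_mem_range_apply (A := A) V
  let ev : Module.End A V →ₗ[ℚ] V := LinearMap.applyₗ' ℚ v₀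
  have hev : ∀ d, ev d = d v₀ := fun d => rfl
  have hev_inj : Function.Injective ev := by
    rw [injective_iff_map_eq_zero]
    intro d hd
    by_contra hd0
    exact hv₀ ((LinearMap.bijective_of_ne_zero hd0).injective (by rw [map_zero]; exact hd))
  have hAv₀ : ∀ v, ∃ a : A, a • v₀ = v := IsSimpleModule.toSpanSingleton_surjective A hv₀
  let L : Submodule ℤ V := O.map ((LinearMap.toSpanSingleton A V v₀).restrictScalars ℤ)
  have hL : IsFull L := by
    intro v
    obtain ⟨a, rfl⟩ := hAv₀ v
    obtain ⟨n, hn, ha⟩ := hO a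
    exact ⟨n, hn, n • a, ha, smul_assoc n a v₀⟩
  obtain ⟨m, t, ht⟩ := exists_basis_mem_of_isFull (O := L.comap (ev.restrictScalars ℤ))
    (fun d => by
      obtain ⟨n, hn, h⟩ := hL (ev d)
      exact ⟨n, hn, by rw [Submodule.mem_comap, map_smul]; exact h⟩)
  have ht' : ∀ i, ∃ a ∈ O, a • v₀ = t i v₀ := ht
  choose a ha hat using ht'
  obtain ⟨M, hM⟩ := exists_endDet_approximation t
  obtain ⟨l, β, hβ⟩ := exists_basis_mem_of_isFull hO
  obtain ⟨n, hn, hne⟩ := hO e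
  -- The products n e βⱼ carry a vector into e V, where it is given by an endomorphism. Together
  -- they determine the vector: those killed by e A form a submodule not containing v₀, which is
  -- zero by simplicity.
  let Ψ : V →ₗ[ℚ] (Fin l → V) :=
    LinearMap.pi fun j => Algebra.lsmul ℚ ℚ V ((n • e) * β j)
  have hΨ : LinearMap.ker Ψ = ⊥ := by
    let K : Submodule A V :=
      { carrier := {v | ∀ a : A, (e * a) • v = 0}
        add_mem' := fun {x y} hx hy a => by rw [smul_add, hx, hy, add_zero]
        zero_mem' := fun a => smul_zero _
        smul_mem' := fun c x hx a => by rw [smul_smul, mul_assoc]; exact hx _ }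
    have hK : K = ⊥ := by
      refine (eq_bot_or_eq_top K).resolve_right fun h => hv₀ ?_
      have : v₀ ∈ K := h ▸ Submodule.mem_top
      rw [← hev₀, ← mul_one e]
      exact this 1
    rw [eq_bot_iff]
    intro v hv
    have hvK : v ∈ K := by
      let θ : A →ₗ[ℚ] V := (LinearMap.toSpanSingleton A V v).restrictScalars ℚ ∘ₗ
        LinearMap.mulLeft ℚ e
      have hθ : θ = 0 := β.ext fun j => by
        have h1 : ((n • e) * β j) • v = 0 := congrFun hv j
        rw [smul_mul_assoc, smul_assoc] at h1
        rw [← Int.cast_smul_eq_zsmul ℚ] at h1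
        exact (smul_eq_zero.mp h1).resolve_left (Int.cast_ne_zero.mpr hn)
      exact fun a => LinearMap.congr_fun hθ a
    rw [hK] at hvK
    exact hvK
  obtain ⟨Θ, hΘ⟩ := Ψ.exists_leftInverse_of_injective hΨ
  let T := Submodule.span ℤ (Set.range t)
  let c : V →ₗ[ℤ] V := ((((M.factorial : ℚ))⁻¹ • LinearMap.id : V →ₗ[ℚ] V)).restrictScalars ℤ
  let P : Submodule ℤ V := (T.map (ev.restrictScalars ℤ)).map c
  have hP : P.FG := ((Submodule.fg_span (Set.finite_range t)).map _).map _
  let U : Submodule ℤ V := (Submodule.pi Set.univ fun _ : Fin l => P).map (Θ.restrictScalars ℤ)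
  refine ⟨{Z | L ≤ Z ∧ Z ≤ U},
    finite_setOf_between hL ((Submodule.fg_pi fun _ => hP).map _), fun X hX => ?_⟩
  let Y : Submodule ℤ (Module.End A V) := X.comap (ev.restrictScalars ℤ)
  have hYfg : Y.FG := by
    refine Submodule.fg_of_fg_map_injective (ev.restrictScalars ℤ) hev_inj ?_
    exact hX.fg.of_le (Submodule.map_comap_le _ _)
  have hY0 : Y ≠ ⊥ := by
    obtain ⟨k, hk, hkv⟩ := hX.isFull v₀
    rw [Submodule.ne_bot_iff]
    refine ⟨k • 1, hkv, fun h => ?_⟩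
    have h2 : k • v₀ = 0 := LinearMap.congr_fun h v₀
    rw [← Int.cast_smul_eq_zsmul ℚ] at h2
    exact hv₀ ((smul_eq_zero.mp h2).resolve_left (Int.cast_ne_zero.mpr hk))
  obtain ⟨y, hy, hy0, hmin⟩ := exists_forall_endDet_le Y hYfg hY0
  have hyX : y v₀ ∈ X := hy
  have hyT : ∀ w ∈ T, y * w ∈ Y := by
    intro w hw
    have hle : T ≤ Y.comap (LinearMap.mulLeft ℤ y) := by
      rw [Submodule.span_le]
      rintro _ ⟨i, rfl⟩
      change y (t i v₀) ∈ X
      rw [← hat, map_smul]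
      exact hX.smul_mem _ (ha i) _ hyX
    exact hle hw
  let φ := (LinearEquiv.ofBijective y (LinearMap.bijective_of_ne_zero hy0)).symm
  have hφ : ∀ v, φ (y v) = v :=
    (LinearEquiv.ofBijective y (LinearMap.bijective_of_ne_zero hy0)).symm_apply_apply
  have hφ' : ∀ v, y (φ v) = v :=
    (LinearEquiv.ofBijective y (LinearMap.bijective_of_ne_zero hy0)).apply_symm_apply
  -- With x = y⁻¹ d and k x close to w, the element y (k x - w) of Y has smaller determinant than y,
  -- so it vanishes. The factorial replaces the varying multiplier k ≤ M by a uniform one.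
  have key : ∀ d ∈ Y, ∃ w ∈ T, M.factorial • d = y * w := by
    intro d hd
    let x : Module.End A V := φ.toLinearMap ∘ₗ d
    have hx : y * x = d := LinearMap.ext fun v => hφ' (d v)
    obtain ⟨k, hk, hkM, w, hw, hlt⟩ := hM x
    have hyz : y * (k • x - w) = k • d - y * w := by
      rw [mul_sub, mul_smul_comm, hx]
    have hzero : y * (k • x - w) = 0 := by
      by_contra hne
      have h1 := hmin _ (by rw [hyz]; exact sub_mem (nsmul_mem hd k) (hyT w hw)) hne
      rw [endDet_mul, abs_mul] at h1
      have h2 : 0 < |endDet y| := abs_pos.mpr (endDet_ne_zero hy0)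
      exact absurd h1 (not_le.mpr (mul_lt_of_lt_one_right h2 hlt))
    obtain ⟨j, hj⟩ := Nat.dvd_factorial hk hkM
    refine ⟨j • w, nsmul_mem hw j, ?_⟩
    rw [hyz, sub_eq_zero] at hzero
    rw [hj, mul_comm, mul_smul, hzero, mul_smul_comm]
  refine ⟨φ, ?_, ?_⟩
  · rintro _ ⟨b, hb, rfl⟩
    refine ⟨b • y v₀, hX.smul_mem b hb _ hyX, ?_⟩
    change φ (b • y v₀) = b • v₀
    rw [map_smul, hφ]
  · rintro _ ⟨z, hz, rfl⟩
    refine ⟨Ψ (φ z), fun j _ => ?_, LinearMap.congr_fun hΘ (φ z)⟩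
    obtain ⟨d, hd⟩ := he (n • β j • z)
    have hd' : ((n • e) * β j) • z = d v₀ := by
      rw [← hd, mul_smul, smul_assoc, smul_comm]
    have hdY : d ∈ Y := by
      change d v₀ ∈ X
      rw [← hd', mul_smul]
      exact hX.smul_mem _ hne _ (hX.smul_mem _ (hβ j) _ hz)
    obtain ⟨w, hw, hdw⟩ := key d hdY
    refine ⟨w v₀, ⟨w, hw, rfl⟩, ?_⟩
    change (M.factorial : ℚ)⁻¹ • w v₀ = ((n • e) * β j) • φ z
    have h1 : M.factorial • d v₀ = y (w v₀) := LinearMap.congr_fun hdw v₀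
    have h2 : w v₀ = M.factorial • φ (d v₀) := by
      rw [← hφ (w v₀), ← h1, map_nsmul]
    rw [h2, ← Nat.cast_smul_eq_nsmul ℚ, smul_smul,
      inv_mul_cancel₀ (Nat.cast_ne_zero.mpr M.factorial_ne_zero), one_smul, ← hd', map_smul]

/-- The Jordan–Zassenhaus theorem over `ℤ`. -/
theorem finitelyManyLattices [FiniteDimensional ℚ A] [IsSemisimpleRing A] {O : Submodule ℤ A}
    (hO : IsFull O) (V : Type u) [AddCommGroup V] [Module A V] [Module ℚ V] [IsScalarTower ℚ A V]
    [FiniteDimensional ℚ V] : FinitelyManyLattices O V := by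
  induction hd : Module.finrank ℚ V using Nat.strong_induction_on generalizing V with
  | h n ih =>
    rcases subsingleton_or_nontrivial V with h | h
    · exact finitelyManyLattices_of_subsingleton O
    · obtain ⟨S, hS⟩ := IsSemisimpleModule.exists_simple_submodule A V
      obtain ⟨T, hT⟩ := exists_isCompl S
      have := IsSimpleModule.nontrivial A S
      let e := Submodule.prodEquivOfIsCompl S T hT
      have : FiniteDimensional ℚ S :=
        FiniteDimensional.finiteDimensional_submodule (S.restrictScalars ℚ)
      have : FiniteDimensional ℚ T :=
        FiniteDimensional.finiteDimensional_submodule (T.restrictScalars ℚ)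
      have hrank : Module.finrank ℚ T < n := by
        have h1 := (e.restrictScalars ℚ).finrank_eq
        have h2 : 0 < Module.finrank ℚ S := Module.finrank_pos
        rw [Module.finrank_prod] at h1
        omega
      exact ((finitelyManyLattices_of_isSimpleModule hO).prod hO (ih _ hrank T rfl)).of_equiv e

end JordanZassenhaus

end Orders

namespace Orders

theorem Subalgebra.isTorsionFree_of_isFractionRing {R : Type*} (K : Type*) {A : Type*} [CommRing R]
    [IsDomain R] [Field K] [Algebra R K] [IsFractionRing R K] [Ring A] [Algebra K A] [Algebra R A]
    [IsScalarTower R K A] (Λ : Subalgebra R A) : Module.IsTorsionFree R Λ := by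
  rw [Module.isTorsionFree_iff_smul_eq_zero]
  intro r x h
  have h' : algebraMap R K r • (x : A) = 0 := by
    rw [algebraMap_smul]
    exact congrArg Subtype.val h
  rcases smul_eq_zero.mp h' with h0 | h0
  · exact Or.inl ((IsFractionRing.injective R K) (by rw [h0, map_zero]))
  · exact Or.inr (Subtype.ext h0)

/-! ### Finiteness of the quotients of `R` -/

section FiniteQuotients

/-- Every element of R is algebraic over ℤ, and a nonzero algebraic element divides a nonzero
integer. -/
theorem exists_intCast_eq_mul {R : Type*} (K : Type*) [CommRing R] [IsDomain R] [Field K]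
    [NumberField K] [Algebra R K] [IsFractionRing R K]
    {r : R} (hr : r ≠ 0) : ∃ n : ℤ, n ≠ 0 ∧ ∃ s : R, (n : R) = r * s := by
  have hK : IsAlgebraic ℤ (algebraMap R K r) := by
    have := IsFractionRing.comap_isAlgebraic_iff (A := ℤ) (K := ℚ) (C := K)|>.mpr inferInstance
    exact Algebra.IsAlgebraic.isAlgebraic _
  have hR : IsAlgebraic ℤ r :=
    (isAlgebraic_algebraMap_iff (IsFractionRing.injective R K)).mp hK
  obtain ⟨n, hn, s, hs⟩ := hR.exists_nonzero_dvd (mem_nonZeroDivisors_of_ne_zero hr)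
  exact ⟨n, hn, s, hs⟩

/-- R may fail to be finitely generated over ℤ, but finitely many representatives generate a free
group G of rank at most [K : ℚ]. Elements congruent modulo n G are congruent modulo n, so at most n
^ [K : ℚ] classes exist. -/
theorem finite_quotient_span_natCast {R : Type*} (K : Type*) [CommRing R] [IsDomain R] [Field K]
    [NumberField K] [Algebra R K] [IsFractionRing R K]
    {n : ℕ} (hn : n ≠ 0) : Finite (R ⧸ Ideal.span {(n : R)}) := by
  have : NeZero n := ⟨hn⟩
  have : CharZero R := (algebraMap R K).charZero_iff (IsFractionRing.injective R K) |>.mpr inferInstance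
  by_contra hinf
  rw [not_finite_iff_infinite] at hinf
  obtain ⟨s, hs⟩ := Infinite.exists_subset_card_eq (R ⧸ Ideal.span {(n : R)})
    (n ^ Module.finrank ℚ K + 1)
  let out : (R ⧸ Ideal.span {(n : R)}) → R := Quotient.out
  have hout : ∀ q, Ideal.Quotient.mk (Ideal.span {(n : R)}) (out q) = q := Quotient.out_eq
  let G : Submodule ℤ R := Submodule.span ℤ (out '' s)
  have hG : Module.Finite ℤ G :=
    Module.Finite.iff_fg.mpr (Submodule.fg_span (s.finite_toSet.image out))
  obtain ⟨m, b⟩ := Module.basisOfFiniteTypeTorsionFree' (R := ℤ) (M := G)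
  have hm : m ≤ Module.finrank ℚ K := by
    let f : G →ₗ[ℤ] K := (algebraMap R K).toAddMonoidHom.toIntLinearMap ∘ₗ G.subtype
    have hf : Function.Injective f :=
      (IsFractionRing.injective R K).comp Subtype.val_injective
    have h1 : LinearIndependent ℤ (f ∘ b) :=
      b.linearIndependent.map' f (LinearMap.ker_eq_bot.mpr hf)
    have h2 := ((LinearIndependent.iff_fractionRing ℤ ℚ).mp h1).fintype_card_le_finrank
    simpa using h2
  let F : s → (Fin m → ZMod n) := fun q i =>
    (b.repr ⟨out q, Submodule.subset_span ⟨q, q.2, rfl⟩⟩ i : ZMod n)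
  have hF : Function.Injective F := by
    intro q q' h
    apply Subtype.ext
    rw [← hout q, ← hout q', Ideal.Quotient.eq]
    have h1 : ∀ i, ∃ c : ℤ, b.repr ⟨out q, Submodule.subset_span ⟨q, q.2, rfl⟩⟩ i -
        b.repr ⟨out q', Submodule.subset_span ⟨q', q'.2, rfl⟩⟩ i = n * c := by
      intro i
      have h2 := congrFun h i
      simp only [F] at h2
      rw [ZMod.intCast_eq_intCast_iff_dvd_sub] at h2
      obtain ⟨c, hc⟩ := h2
      exact ⟨-c, by linarith⟩
    choose c hc using h1
    have h3 : (⟨out q, Submodule.subset_span ⟨q, q.2, rfl⟩⟩ : G) -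
        ⟨out q', Submodule.subset_span ⟨q', q'.2, rfl⟩⟩ = (n : ℤ) • ∑ i, c i • b i := by
      apply b.repr.injective
      ext i
      rw [map_sub, Finsupp.sub_apply, hc, map_smul, Finsupp.smul_apply, b.repr_sum_self, smul_eq_mul]
    have h4 := congrArg Subtype.val h3
    rw [Ideal.mem_span_singleton]
    refine ⟨((∑ i, c i • b i : G) : R), ?_⟩
    have h5 : out q - out q' = (n : ℤ) • ((∑ i, c i • b i : G) : R) := h4
    rw [h5, zsmul_eq_mul, Int.cast_natCast]
  have hcard := Fintype.card_le_of_injective F hF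
  rw [Fintype.card_coe, hs, Fintype.card_fun, ZMod.card, Fintype.card_fin] at hcard
  exact absurd (hcard.trans (Nat.pow_le_pow_right (Nat.pos_of_ne_zero hn) hm)) (by omega)

theorem finite_quotient_span_singleton {R : Type*} (K : Type*) [CommRing R] [IsDomain R] [Field K]
    [NumberField K] [Algebra R K] [IsFractionRing R K]
    {r : R} (hr : r ≠ 0) : Finite (R ⧸ Ideal.span {r}) := by
  obtain ⟨n, hn, s, hs⟩ := exists_intCast_eq_mul K hr
  have := finite_quotient_span_natCast (R := R) K (Int.natAbs_ne_zero.mpr hn)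
  have hle : Ideal.span {((n.natAbs : ℕ) : R)} ≤ Ideal.span {r} := by
    rw [Ideal.span_singleton_le_span_singleton]
    refine dvd_trans (show r ∣ (n : R) from ⟨s, hs⟩) ?_
    rw [← Int.cast_natCast]
    exact Int.cast_dvd_cast _ _ Int.dvd_natAbs_self
  exact Finite.of_surjective _ (Ideal.Quotient.factor_surjective hle)

end FiniteQuotients

/-! ### Finiteness of the class group -/

section ClassNumber

theorem isFull_of_span_eq_top {V : Type*} [AddCommGroup V] [Module ℚ V] {L : Submodule ℤ V}
    (h : Submodule.span ℚ (L : Set V) = ⊤) : IsFull L := by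
  intro v
  have hv : v ∈ Submodule.span ℚ (L : Set V) := h ▸ Submodule.mem_top
  induction hv using Submodule.span_induction with
  | mem x hx => exact ⟨1, one_ne_zero, by rwa [one_smul]⟩
  | zero => exact ⟨1, one_ne_zero, by simp⟩
  | add x y _ _ hx hy =>
    obtain ⟨m, hm, hx⟩ := hx
    obtain ⟨n, hn, hy⟩ := hy
    refine ⟨m * n, mul_ne_zero hm hn, ?_⟩
    rw [smul_add]
    refine L.add_mem ?_ ?_
    · rw [mul_comm, mul_smul]
      exact L.smul_mem _ hx
    · rw [mul_smul]
      exact L.smul_mem _ hy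
  | smul q x _ hx =>
    obtain ⟨n, hn, hx⟩ := hx
    refine ⟨q.den * n, mul_ne_zero (by exact_mod_cast q.den_ne_zero) hn, ?_⟩
    have : ((q.den : ℤ) * n) • q • x = q.num • n • x := by
      rw [← Int.cast_smul_eq_zsmul ℚ, ← Int.cast_smul_eq_zsmul ℚ, ← Int.cast_smul_eq_zsmul ℚ,
        smul_smul, smul_smul]
      congr 1
      push_cast
      rw [mul_right_comm, Rat.den_mul_eq_num]
    rw [this]
    exact L.smul_mem _ hx

theorem Subalgebra.isFull {R : Type*} (K : Type*) [CommRing R] [IsDomain R] [Field K]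
    [NumberField K] [Algebra R K] [IsFractionRing R K] {A : Type*} [Ring A]
    [Algebra K A] [Algebra R A] [IsScalarTower R K A] (Λ : Subalgebra R A) (hΛ : Submodule.span K (Λ : Set A) = ⊤) :
    IsFull (Λ.toSubmodule.restrictScalars ℤ) := by
  intro a
  have ha : a ∈ Submodule.span K (Λ : Set A) := hΛ ▸ Submodule.mem_top
  obtain ⟨s, hs, hsa⟩ : ∃ s : R, s ≠ 0 ∧ s • a ∈ Λ := by
    induction ha using Submodule.span_induction with
    | mem x hx => exact ⟨1, one_ne_zero, by rwa [one_smul]⟩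
    | zero => exact ⟨1, one_ne_zero, by simp⟩
    | add x y _ _ hx hy =>
      obtain ⟨m, hm, hx⟩ := hx
      obtain ⟨n, hn, hy⟩ := hy
      refine ⟨m * n, mul_ne_zero hm hn, ?_⟩
      rw [smul_add]
      refine Λ.add_mem ?_ ?_
      · rw [mul_comm, mul_smul]
        exact Λ.smul_mem hx _
      · rw [mul_smul]
        exact Λ.smul_mem hy _
    | smul q x _ hx =>
      obtain ⟨n, hn, hx⟩ := hx
      obtain ⟨c, d, hd, rfl⟩ := IsFractionRing.div_surjective (A := R) q
      have hd0 : algebraMap R K d ≠ 0 :=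
        (map_ne_zero_iff _ (IsFractionRing.injective R K)).mpr (nonZeroDivisors.ne_zero hd)
      refine ⟨d * n, mul_ne_zero (nonZeroDivisors.ne_zero hd) hn, ?_⟩
      have : (d * n) • (algebraMap R K c / algebraMap R K d) • x = c • n • x := by
        rw [← algebraMap_smul K (d * n), ← algebraMap_smul K c, ← algebraMap_smul K n, smul_smul,
          smul_smul, map_mul]
        congr 1
        field_simp
      rw [this]
      exact Λ.smul_mem hx _
  -- The denominator s in R is replaced by an integer multiple of it.
  obtain ⟨n, hn, s', hn'⟩ := exists_intCast_eq_mul K hs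
  refine ⟨n, hn, ?_⟩
  change n • a ∈ Λ
  rw [← Int.cast_smul_eq_zsmul R, hn', mul_comm, mul_smul]
  exact Λ.smul_mem hsa _

/-- A full subgroup of a `ℚ`-algebra which is a ring contains one that is finitely generated. -/
theorem exists_fg_subring {A : Type*} [Ring A] [Algebra ℚ A] [FiniteDimensional ℚ A]
    (Λ : Subring A) (hΛ : IsFull Λ.toAddSubgroup.toIntSubmodule) :
    ∃ O : Submodule ℤ A, O.FG ∧ IsFull O ∧ 1 ∈ O ∧ O * O ≤ O ∧ ∀ x ∈ O, x ∈ Λ := by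
  let b := Module.finBasis ℚ A
  let L := Submodule.span ℤ (Set.range b)
  have hLfg : L.FG := Submodule.fg_span (Set.finite_range b)
  have hL : IsFull L := isFull_of_span_eq_top (by
    rw [eq_top_iff, ← b.span_eq]
    exact Submodule.span_mono Submodule.subset_span)
  -- The elements of Λ that preserve the ℤ-lattice L under left multiplication. Recording their
  -- products with the basis embeds O in a power of L, which bounds it.
  let O : Submodule ℤ A :=
    { carrier := {x | x ∈ Λ ∧ ∀ l ∈ L, x * l ∈ L}
      add_mem' := fun {x y} hx hy => ⟨Λ.add_mem hx.1 hy.1, fun l hl => by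
        rw [add_mul]; exact L.add_mem (hx.2 l hl) (hy.2 l hl)⟩
      zero_mem' := ⟨Λ.zero_mem, fun l _ => by rw [zero_mul]; exact L.zero_mem⟩
      smul_mem' := fun n x hx => ⟨zsmul_mem hx.1 n, fun l hl => by
        rw [smul_mul_assoc]; exact L.smul_mem n (hx.2 l hl)⟩ }
  refine ⟨O, ?_, fun a => ?_, ⟨Λ.one_mem, fun l hl => by rwa [one_mul]⟩, ?_, fun x hx => hx.1⟩
  · let Ψ : A →ₗ[ℚ] (Fin (Module.finrank ℚ A) → A) := LinearMap.pi fun i => LinearMap.mulRight ℚ (b i)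
    have hΨ : LinearMap.ker Ψ = ⊥ := by
      rw [eq_bot_iff]
      intro x hx
      have h1 : LinearMap.mulLeft ℚ x = 0 := b.ext fun i => congrFun hx i
      have h2 : x * 1 = 0 := LinearMap.congr_fun h1 1
      rwa [mul_one] at h2
    obtain ⟨Θ, hΘ⟩ := Ψ.exists_leftInverse_of_injective hΨ
    refine Submodule.FG.of_le (((Submodule.fg_pi fun _ => hLfg).map (Θ.restrictScalars ℤ)))
      fun x hx => ⟨Ψ x, fun i _ => hx.2 _ (Submodule.subset_span ⟨i, rfl⟩),
        LinearMap.congr_fun hΘ x⟩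
  · obtain ⟨m, hm, hma⟩ := hΛ a
    obtain ⟨n, hn, hna⟩ := hL.exists_smul_mem (hLfg.map (LinearMap.mulLeft ℤ a))
    refine ⟨m * n, mul_ne_zero hm hn, ?_, fun l hl => ?_⟩
    · rw [mul_comm, mul_smul]
      exact zsmul_mem (show m • a ∈ Λ from hma) n
    · rw [mul_smul, smul_mul_assoc, smul_mul_assoc]
      exact L.smul_mem m (hna _ ⟨l, hl, rfl⟩)
  · rw [Submodule.mul_le]
    exact fun x hx y hy => ⟨Λ.mul_mem hx.1 hy.1, fun l hl => by
      rw [mul_assoc]; exact hx.2 _ (hy.2 l hl)⟩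

/-- A map invertible up to a scalar at a single maximal ideal already suffices, because X is
torsion-free. -/
theorem PrincipalGenus.exists_injective {R : Type v} [CommRing R] [IsDedekindDomain R]
    {Λ : Type u} [Ring Λ] [Algebra R Λ] [Module.Finite R Λ] [Module.IsTorsionFree R Λ]
    (X : PrincipalGenus R Λ) :
    ∃ f : X.carrier →ₗ[Λ] Λ, Function.Injective f ∧ ∃ s : R, s ≠ 0 ∧ ∀ a, s • a ∈ LinearMap.range f := by
  have := X.isLocallyFree.finite
  have htf := X.isLocallyFree.isTorsionFree
  obtain ⟨p, hp⟩ := Ideal.exists_maximal R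
  obtain ⟨f, s, hs, h, h1, h2⟩ :=
    (X.isLocallyFree.locallyIsoAt isLocallyFree_self p).exists_invertibleAt
  have hs0 : s ≠ 0 := fun h0 => hs (h0 ▸ p.zero_mem)
  refine ⟨f, ?_, s, hs0, fun a => ⟨h a, h2 a⟩⟩
  rw [injective_iff_map_eq_zero]
  intro x hx
  have h3 : s • x = 0 := by rw [← h1, hx, map_zero]
  exact (smul_eq_zero.mp h3).resolve_left hs0

/-- The class number is finite. -/
theorem finite_locallyFreeClassGroup {R : Type v} (K : Type*) [CommRing R] [IsDedekindDomain R]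
    [Field K] [NumberField K] [Algebra R K] [IsFractionRing R K] {A : Type u} [Ring A] [Algebra K A]
    [FiniteDimensional K A] [IsSemisimpleRing A] [Algebra R A] [IsScalarTower R K A]
    (Λ : Subalgebra R A) [Module.Finite R Λ] (hΛ : Submodule.span K (Λ : Set A) = ⊤) :
    Finite (LocallyFreeClassGroup R Λ) := by
  let _ : Algebra ℚ A := Algebra.compHom A (algebraMap ℚ K)
  have : IsScalarTower ℚ K A := IsScalarTower.of_algebraMap_eq fun _ => rfl
  have : FiniteDimensional ℚ A := Module.Finite.trans K A
  have := Subalgebra.isTorsionFree_of_isFractionRing K Λ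
  have hΛfull := Subalgebra.isFull K Λ hΛ
  obtain ⟨O, hOfg, hO, hO1, hOO, hOΛ⟩ := exists_fg_subring Λ.toSubring hΛfull
  obtain ⟨F, hF, hFX⟩ := finitelyManyLattices hO A
  have key : ∀ X : PrincipalGenus R Λ, ∃ Z ∈ F,
      Nonempty (X.carrier ≃ₗ[Λ] Submodule.span Λ (Z : Set A)) := by
    intro X
    have := X.isLocallyFree.finite
    obtain ⟨f₀, hf₀, s, hs, hsf⟩ := X.exists_injective
    let f : X.carrier →ₗ[Λ] A :=
      { toFun := fun x => (f₀ x : A)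
        map_add' := fun x y => by rw [map_add]; rfl
        map_smul' := fun a x => by rw [map_smul]; rfl }
    have hf : Function.Injective f := Subtype.val_injective.comp hf₀
    have hfull : ∀ a : A, ∃ n : ℤ, n ≠ 0 ∧ n • a ∈ LinearMap.range f := by
      intro a
      obtain ⟨m, hm, hma⟩ := hΛfull a
      obtain ⟨n, hn, s', hn'⟩ := exists_intCast_eq_mul K hs
      obtain ⟨x, hx⟩ := hsf (s' • ⟨m • a, hma⟩)
      refine ⟨n * m, mul_ne_zero hn hm, x, ?_⟩
      change ((f₀ x : Λ) : A) = _
      rw [hx, smul_smul, ← hn', mul_smul, Int.cast_smul_eq_zsmul]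
      rfl
    obtain ⟨k, x, hx⟩ := Module.Finite.exists_fin (R := R) (M := X.carrier)
    -- The image of X is in general no ℤ-lattice, but O T is one, and its Λ-span recovers the image.
    -- Jordan–Zassenhaus applied to O T then bounds the isomorphism classes.
    let T := Submodule.span ℤ (Set.range fun j => f (x j))
    have hgT : ∀ j, f (x j) ∈ O * T := fun j => by
      rw [← one_mul (f (x j))]
      exact Submodule.mul_mem_mul hO1 (Submodule.subset_span ⟨j, rfl⟩)
    have hOT : O * T ≤ (LinearMap.range f).restrictScalars ℤ := by
      rw [Submodule.mul_le]
      intro o ho t ht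
      have hT : T ≤ (LinearMap.range f).restrictScalars ℤ := by
        rw [Submodule.span_le]
        rintro _ ⟨j, rfl⟩
        exact ⟨x j, rfl⟩
      exact (LinearMap.range f).smul_mem ⟨o, hOΛ o ho⟩ (hT ht)
    have hlat : IsLattice O (O * T) := by
      refine ⟨hOfg.mul (Submodule.fg_span (Set.finite_range _)), fun a => ?_, fun a ha t ht => ?_⟩
      · obtain ⟨n, hn, y, hy⟩ := hfull a
        have hy' : y ∈ Submodule.span R (Set.range x) := hx ▸ Submodule.mem_top
        obtain ⟨c, rfl⟩ := (Submodule.mem_span_range_iff_exists_fun R).mp hy'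
        obtain ⟨m, hm, hmc⟩ := hO.exists_smul_mem (Submodule.fg_span (R := ℤ)
          (Set.finite_range fun j => algebraMap R A (c j)))
        refine ⟨m * n, mul_ne_zero hm hn, ?_⟩
        rw [mul_smul, ← hy, map_sum, Finset.smul_sum]
        refine Submodule.sum_mem _ fun j _ => ?_
        rw [smul_map, Algebra.smul_def (c j), ← smul_mul_assoc]
        exact Submodule.mul_mem_mul (hmc _ (Submodule.subset_span ⟨j, rfl⟩))
          (Submodule.subset_span ⟨j, rfl⟩)
      · have h1 := Submodule.mul_mem_mul ha ht
        rw [← mul_assoc] at h1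
        exact (mul_le_mul' hOO le_rfl : O * O * T ≤ O * T) h1
    obtain ⟨φ, hφ⟩ := hFX _ hlat
    refine ⟨_, hφ, ?_⟩
    let f' : X.carrier →ₗ[Λ] A := (φ.toLinearMap.restrictScalars Λ) ∘ₗ f
    have hf' : Function.Injective f' := φ.injective.comp hf
    have hrange : LinearMap.range f' = Submodule.span Λ (mapInt (O * T) φ.toLinearMap : Set A) := by
      refine le_antisymm ?_ (Submodule.span_le.mpr ?_)
      · rintro _ ⟨y, rfl⟩
        have hy : y ∈ Submodule.span R (Set.range x) := hx ▸ Submodule.mem_top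
        obtain ⟨c, rfl⟩ := (Submodule.mem_span_range_iff_exists_fun R).mp hy
        rw [map_sum]
        refine Submodule.sum_mem _ fun j _ => ?_
        rw [← algebraMap_smul Λ, map_smul]
        exact Submodule.smul_mem _ _ (Submodule.subset_span ⟨_, hgT j, rfl⟩)
      · rintro _ ⟨t, ht, rfl⟩
        obtain ⟨y, rfl⟩ := hOT ht
        exact ⟨y, rfl⟩
    exact ⟨(LinearEquiv.ofInjective f' hf').trans (LinearEquiv.ofEq _ _ hrange)⟩
  have key' : ∀ c : LocallyFreeClassGroup R Λ, ∃ Z : F, ∃ X : PrincipalGenus R Λ,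
      c = Quotient.mk _ X ∧ Nonempty (X.carrier ≃ₗ[Λ] Submodule.span Λ (Z.1 : Set A)) := by
    rintro ⟨X⟩
    obtain ⟨Z, hZ, e⟩ := key X
    exact ⟨⟨Z, hZ⟩, X, rfl, e⟩
  choose Z hZ using key'
  have := hF.to_subtype
  refine Finite.of_injective Z fun c c' h => ?_
  obtain ⟨X, rfl, ⟨e⟩⟩ := hZ c
  obtain ⟨X', rfl, ⟨e'⟩⟩ := hZ c'
  rw [h] at e
  exact PrincipalGenus.sound 0 (by rw [(isoClass_eq_iff Λ).mpr ⟨e.trans e'.symm⟩])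

end ClassNumber

end Orders

/-! ### The main theorem -/

theorem mainTheorem9
    {R K : Type*} [CommRing R] [IsDedekindDomain R] [Field K] [NumberField K]
    [Algebra R K] [IsFractionRing R K]
    {A A₁ A₂ : Type u} [Ring A] [Ring A₁] [Ring A₂]
    [Algebra K A] [Algebra K A₁] [Algebra K A₂]
    [FiniteDimensional K A] [FiniteDimensional K A₁] [FiniteDimensional K A₂]
    [IsSemisimpleRing A] [IsSemisimpleRing A₁] [IsSemisimpleRing A₂]
    [Algebra R A] [Algebra R A₁] [Algebra R A₂]
    [IsScalarTower R K A] [IsScalarTower R K A₁] [IsScalarTower R K A₂]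
    -- `Λ`, `Λ₁`, `Λ₂` are `R`-orders in `A`, `A₁`, `A₂`
    (Λ : Subalgebra R A) (Λ₁ : Subalgebra R A₁) (Λ₂ : Subalgebra R A₂)
    [Module.Finite R Λ] [Module.Finite R Λ₁] [Module.Finite R Λ₂]
    (hΛ : Submodule.span K (Λ : Set A) = ⊤)
    (hΛ₁ : Submodule.span K (Λ₁ : Set A₁) = ⊤)
    (hΛ₂ : Submodule.span K (Λ₂ : Set A₂) = ⊤)
    {Λbar : Type*} [Ring Λbar] [Algebra R Λbar] (htors : Module.IsTorsion R Λbar)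
    (S : Orders.FibreProduct R Λ Λ₁ Λ₂ Λbar)
    (hsurj : Function.Surjective S.g₁ ∨ Function.Surjective S.g₂) :
    ∃ (d : Additive Λbarˣ →+ Orders.LocallyFreeClassGroup R Λ)
      (ρ : Orders.LocallyFreeClassGroup R Λ →+
        Orders.LocallyFreeClassGroup R Λ₁ × Orders.LocallyFreeClassGroup R Λ₂),
      -- `d` is the map `∂`: each `M(u)` is locally free of rank `1` and `∂(u) = [M(u)]`
      (∀ u : Λbarˣ, ∃ h : Orders.IsLocallyFree R Λ 1 (S.M u),
        d (Additive.ofMul u) = Orders.LocallyFreeClassGroup.mk (S.M u) h) ∧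
      -- `ρ` is induced by extension of scalars: `ρ[X] = ([Λ₁ ⊗_Λ X], [Λ₂ ⊗_Λ X])`
      (∀ (X : Type u) [AddCommGroup X] [Module R X] [Module Λ X] [IsScalarTower R Λ X]
        (hX : Orders.IsLocallyFree R Λ 1 X),
        ∃ (h₁ : Orders.IsLocallyFree R Λ₁ 1 (Orders.BaseChange S.π₁ X))
          (h₂ : Orders.IsLocallyFree R Λ₂ 1 (Orders.BaseChange S.π₂ X)),
          ρ (Orders.LocallyFreeClassGroup.mk X hX) =
            (Orders.LocallyFreeClassGroup.mk _ h₁, Orders.LocallyFreeClassGroup.mk _ h₂)) ∧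
      -- exactness of `1 → ker ∂ → Λbarˣ → Cl(Λ) → Cl(Λ₁) ⊕ Cl(Λ₂) → 0`
      Function.Injective d.ker.subtype ∧
      Function.Exact d.ker.subtype d ∧
      Function.Exact d ρ ∧
      Function.Surjective ρ ∧
      -- all cardinalities are finite
      Finite Λbarˣ ∧
      Finite (Orders.LocallyFreeClassGroup R Λ) ∧
      Finite (Orders.LocallyFreeClassGroup R Λ₁) ∧
      Finite (Orders.LocallyFreeClassGroup R Λ₂) ∧
      -- the inequality
      Nat.card S.W ≤ Nat.card d.ker ∧
      (Nat.card d.ker : ℚ) =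
        Nat.card (Orders.LocallyFreeClassGroup R Λ₁) *
          Nat.card (Orders.LocallyFreeClassGroup R Λ₂) * Nat.card Λbarˣ /
          Nat.card (Orders.LocallyFreeClassGroup R Λ) ∧
      -- the criterion
      (Orders.HasSFC Λ ↔ Orders.HasSFC Λ₁ ∧ Orders.HasSFC Λ₂ ∧
        (Nat.card S.W : ℚ) =
          Nat.card (Orders.LocallyFreeClassGroup R Λ₁) *
            Nat.card (Orders.LocallyFreeClassGroup R Λ₂) * Nat.card Λbarˣ /
            Nat.card (Orders.LocallyFreeClassGroup R Λ)) := by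
  have := Orders.Subalgebra.isTorsionFree_of_isFractionRing K Λ₁
  have := Orders.Subalgebra.isTorsionFree_of_isFractionRing K Λ₂
  -- A nonzero scalar killing 1 kills the whole algebra.
  obtain ⟨r, hr1⟩ := @htors 1
  have hr0 : (r : R) ≠ 0 := nonZeroDivisors.ne_zero r.2
  have hr : ∀ z : Λbar, (r : R) • z = 0 := fun z => by
    rw [← one_mul z, ← smul_mul_assoc]
    exact (congrArg (· * z) hr1).trans (zero_mul z)
  have hfin : Finite (R ⧸ Ideal.span {(r : R)}) := Orders.finite_quotient_span_singleton K hr0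
  have : Module.Finite R Λbar := hsurj.elim
    (fun h => Module.Finite.of_surjective S.g₁.toLinearMap h)
    (fun h => Module.Finite.of_surjective S.g₂.toLinearMap h)
  have : Finite Λbar := Orders.finite_of_forall_smul_eq_zero (R := R) hr
  have hCl := Orders.finite_locallyFreeClassGroup K Λ hΛ
  have hCl₁ := Orders.finite_locallyFreeClassGroup K Λ₁ hΛ₁
  have hCl₂ := Orders.finite_locallyFreeClassGroup K Λ₂ hΛ₂
  have hpos : (Nat.card (Orders.LocallyFreeClassGroup R Λ) : ℚ) ≠ 0 :=
    Nat.cast_ne_zero.mpr Nat.card_pos.ne'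
  let d := S.boundary hr hsurj
  have hcard : (Nat.card d.ker : ℚ) = Nat.card (Orders.LocallyFreeClassGroup R Λ₁) *
      Nat.card (Orders.LocallyFreeClassGroup R Λ₂) * Nat.card Λbarˣ /
      Nat.card (Orders.LocallyFreeClassGroup R Λ) := by
    rw [eq_div_iff hpos]
    exact_mod_cast S.card_ker_boundary_mul_card hr0 hr hsurj
  have hker : Nat.card d.ker = Nat.card {u : Λbarˣ | d (Additive.ofMul u) = 0} :=
    Nat.card_congr (Equiv.refl _)
  refine ⟨d, (Orders.classGroupMap S.π₁).prod (Orders.classGroupMap S.π₂),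
    fun u => ⟨S.isLocallyFree_M hr hsurj u, rfl⟩,
    fun X _ _ _ _ hX => ⟨hX.baseChange S.π₁, hX.baseChange S.π₂, rfl⟩,
    d.ker.subtype_injective, fun u => ?_, S.exact_boundary hr hsurj, fun c => ?_,
    inferInstance, hCl, hCl₁, hCl₂, ?_, hcard, ?_⟩
  · rw [AddSubgroup.coe_subtype, Subtype.range_coe]
    rfl
  · obtain ⟨x, h₁, h₂⟩ := Orders.exists_classGroupMap_eq S hr0 hr c.1 c.2
    exact ⟨x, Prod.ext h₁ h₂⟩
  · rw [hker]
    exact Nat.card_mono (Set.toFinite _) (S.W_subset hr hsurj)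
  · rw [S.hasSFC_iff hr hsurj, ← hcard, hker, Nat.cast_inj]
    refine and_congr_right fun _ => and_congr_right fun _ => ⟨fun h => ?_, fun h => ?_⟩
    · exact congrArg (fun s : Set Λbarˣ => Nat.card s) h
    -- `W` is contained in the finite kernel, so equal cardinalities force equality of sets.
    · exact Set.eq_of_subset_of_ncard_le (S.W_subset hr hsurj) h.ge
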